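/- Let $\omega_1,\omega_2,\dots$ be independent random variables on a probability space, uniformly distributed on the circle $\mathbb T=\mathbb R/\mathbb Z$, and let $(\ell_n)_{n\ge1}$ be a nonincreasing sequence in $(0,1)$ with $\ell_n\to0$. Let $I_n=(\omega_n,\omega_n+\ell_n)\bmod 1$ be the random open arcs and $E=\mathbb T\setminus\bigcup_{n\ge1}I_n$ the non-covered set. Put $$P_n(t)=\frac{1-\mathbf 1_{I_n}(t)}{1-\ell_n},\qquad \mu_n(\mathrm dt)=\prod_{k=1}^nP_k(t)\,\mathrm dt,\qquad K(t)=\exp\Bigl(\sum_{n\ge1}(\ell_n-\|t\|)_+\Bigr),$$ where $\|t\|$ is the distance from $t$ to the nearest integer. Assume $$\sum_{n\ge1}\ell_n=\infty,\qquad \sum_{n\ge1}(\ell_n-\ell_{n+1})\exp\Bigl(\sum_{k=1}^n\ell_k\Bigr)<\infty,$$ and that for some integer $d\ge1$ $$\int_{\mathbb T^d}K(t_1)\cdots K(t_d)\,K\Bigl(-\sum_{i=1}^dt_i\Bigr)\,\mathrm dt_1\cdots\mathrm dt_d<\infty .$$ Then almost surely the following holds: the measures $\mu_n$ converge weakly to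 a finite measure $\mu_D$ (the Dvoretzky measure); $\mu_D$ is carried by $E$; its Fourier coefficients $\widehat{\mu_D}(k)$ tend to $0$ as $|k|\to\infty$; and, if $E\neq\emptyset$, then $\mu_D\ne0$ and $E$ is an $M_0$-set (it carries a nonzero finite measure whose Fourier coefficients tend to $0$) and a set of multiplicity (there is a trigonometric series $\sum_kc_ke^{2\pi ikt}$, not all of whose coefficients vanish, that converges to $0$ at every $t\notin E$). Moreover $E\ne\emptyset$ with positive probability. All the hypotheses on $(\ell_n)$ hold, for some $d\ge1$, when $\ell_n=\alpha/n$ with $0<\alpha<1$. -/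

import Mathlib

open MeasureTheory ProbabilityTheory Filter Topology
open scoped ENNReal

namespace Dvoretzky

noncomputable section

/-- The open arc `(x, x + r) mod 1` of the circle `𝕋 = ℝ / ℤ`. -/
def arc (x : UnitAddCircle) (r : ℝ) : Set UnitAddCircle :=
  (fun s : ℝ => x + (s : UnitAddCircle)) '' Set.Ioo 0 r

/-- The non-covered set `E = 𝕋 ∖ ⋃ₙ (xₙ, xₙ + ℓₙ)`, for given left end points `xₙ`. -/
def uncovered (ℓ : ℕ → ℝ) (x : ℕ → UnitAddCircle) : Set UnitAddCircle :=
  (⋃ n, arc (x n) (ℓ n))ᶜ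

/-- The function `Pₙ(t) = (1 - 𝟏_{(0, ℓₙ)}(t - xₙ)) / (1 - ℓₙ)`. -/
def factor (ℓ : ℕ → ℝ) (x : ℕ → UnitAddCircle) (n : ℕ) (t : UnitAddCircle) : ℝ :=
  (1 - (arc (x n) (ℓ n)).indicator (fun _ => (1 : ℝ)) t) / (1 - ℓ n)

/-- The density `Mₙ(t)`, the product of the first `n` functions `P`. -/
def density (ℓ : ℕ → ℝ) (x : ℕ → UnitAddCircle) (n : ℕ) (t : UnitAddCircle) : ℝ :=
  ∏ k ∈ Finset.range n, factor ℓ x k t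

theorem abs_density_le (ℓ : ℕ → ℝ) (x : ℕ → UnitAddCircle) (n : ℕ) (t : UnitAddCircle) :
    ‖density ℓ x n t‖ ≤ ∏ k ∈ Finset.range n, (1 / |1 - ℓ k|) := by
  rw [density, Real.norm_eq_abs, Finset.abs_prod]
  refine Finset.prod_le_prod (fun _ _ => abs_nonneg _) fun k _ => ?_
  rw [factor, abs_div]
  refine div_le_div_of_nonneg_right ?_ (abs_nonneg _)
  by_cases h : t ∈ arc (x k) (ℓ k) <;> simp [h]

/-- The finite measure `μₙ(dt) = Mₙ(t) dt` on the circle (`dt` is the normalized Lebesgue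
measure). -/
def approxMeasure (ℓ : ℕ → ℝ) (x : ℕ → UnitAddCircle) (n : ℕ) : FiniteMeasure UnitAddCircle :=
  ⟨volume.withDensity fun t => ENNReal.ofReal (density ℓ x n t),
    isFiniteMeasure_withDensity_ofReal
      (HasFiniteIntegral.of_bounded (ae_of_all _ (abs_density_le ℓ x n)))⟩

/-- The Dvoretzky measure `μ_D`: the limit of the `μₙ` for weak convergence of finite measures
(an arbitrary value where the limit does not exist). -/
def dvoretzkyMeasure (ℓ : ℕ → ℝ) (x : ℕ → UnitAddCircle) : FiniteMeasure UnitAddCircle :=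
  limUnder atTop (approxMeasure ℓ x)

/-- The kernel `K(t) = exp (∑ₙ (ℓₙ - |t|)₊)`, with values in `[0, ∞]`. The norm on `𝕋` is the
distance to the nearest integer, so it is `|t|` for `|t| ≤ 1 / 2`. -/
def kernelK (ℓ : ℕ → ℝ) (t : UnitAddCircle) : ℝ≥0∞ :=
  EReal.exp ((∑' n, ENNReal.ofReal (ℓ n - ‖t‖) : ℝ≥0∞) : EReal)

/-- The hypotheses on the lengths. The length with index `n + 1` of the mathematical text is
`ℓ n`. -/
structure Admissible (ℓ : ℕ → ℝ) (d : ℕ) : Prop where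
  pos : ∀ n, 0 < ℓ n
  lt_one : ∀ n, ℓ n < 1
  anti : Antitone ℓ
  tendsto_zero : Tendsto ℓ atTop (𝓝 0)
  diverges : ¬ Summable ℓ
  summable_exp :
    Summable fun n => (ℓ n - ℓ (n + 1)) * Real.exp (∑ k ∈ Finset.range (n + 1), ℓ k)
  one_le : 1 ≤ d
  lintegral_lt_top :
    ∫⁻ t : Fin d → UnitAddCircle, (∏ i, kernelK ℓ (t i)) * kernelK ℓ (-∑ i, t i) < ∞

/-- The Fourier coefficients of `μ` tend to `0`. -/
def IsRajchman (μ : Measure UnitAddCircle) : Prop :=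
  Tendsto (fun k : ℤ => ∫ t, fourier (-k) t ∂μ) cofinite (𝓝 0)

/-- `S` is an `M₀`-set: it carries a nonzero (positive, finite) measure whose Fourier coefficients
tend to `0`. -/
def IsM0Set (S : Set UnitAddCircle) : Prop :=
  ∃ μ : FiniteMeasure UnitAddCircle,
    μ ≠ 0 ∧ (μ : Measure UnitAddCircle) Sᶜ = 0 ∧ IsRajchman (μ : Measure UnitAddCircle)

/-- `S` is a set of uniqueness: a trigonometric series that converges to `0` at every point outside
`S` (symmetric partial sums) has all its coefficients equal to `0`. -/
def IsSetOfUniqueness (S : Set UnitAddCircle) : Prop :=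
  ∀ c : ℤ → ℂ,
    (∀ t ∉ S, Tendsto (fun N : ℕ => ∑ k ∈ Finset.Icc (-(N : ℤ)) N, c k * fourier k t)
      atTop (𝓝 0)) →
    ∀ k, c k = 0

/-- A set of multiplicity is a set that is not a set of uniqueness. -/
def IsSetOfMultiplicity (S : Set UnitAddCircle) : Prop :=
  ¬ IsSetOfUniqueness S

end

end Dvoretzky

open MeasureTheory ProbabilityTheory Filter Topology
open scoped ENNReal

namespace Dvoretzky

noncomputable section

/-! ### The circle in coordinates, and two-point correlations of a single arc. -/

section

/-! Convergence. The density `Mₙ(t)` has mean one at every `t` and is a martingale in `n`. The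
integrals of a countable dense family of continuous functions therefore converge almost surely, and
compactness of measures of bounded mass gives a weak limit (`ae_exists_tendsto_approxMeasure`). The
limit does not charge the open arcs, because `μₙ` vanishes on the `k`-th arc as soon as `n > k`.

Decay of the Fourier coefficients. By Fatou it is enough that the moments of order `2 (d + 1)` of
the coefficients of `μₙ` are summable over the frequencies, uniformly in `n`
(`Admissible.exists_sum_fourierMoment_le`). Such a moment is an integral over `2 d + 2` points: a
product over the arcs of mixed moments, against a character of the alternating sum of the points.
For a short arc the mixed moment is at most the product of the correlations of neighbouring points,
up to a factor `exp (O(ℓ²))` (`exists_perm_mixedMoment_le`), and `∑ ℓₙ²` converges. An oscillating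
integrand cannot be majorised in this way, so the frequencies are averaged with Fejér weights, which
makes the integrand nonnegative and also allows all orderings of the points to be added. For one
ordering the increments are independent and uniform, and the integral becomes a product of Fourier
coefficients `corrCoeff` at multiples of the frequency. By parity `d + 1` of the multipliers are
nonzero. Finally the sum of the powers `corrCoeff ^ (d + 1)` is a convolution at `0`, which the
integral hypothesis bounds because the product of the correlations is at most a constant times `K`.

Nonvanishing. A second moment bound with the integrable kernel `K` gives survival of the mass with
positive probability. For survival almost surely on `E ≠ ∅`, fix a scale `r` at which about `1 / r`
lengths exceed `r` and the integral of `K` over the ball of radius `r` is comparable to `r` times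
the value of `K` at distance `r` (`Admissible.exists_good_scale`). If some point is uncovered, then
so is some right endpoint; take the first one after a base point. The other arcs that start shortly
after it can be moved without changing it, so with probability bounded below an interval of length
`r` on its right is free of the long arcs. The second moment method on this interval, with the
remaining arcs, gives survival with a conditional probability bounded below, uniformly over events
that depend on finitely many arcs (`Admissible.exists_measure_inter_cylinder_le`). Approximating the
event of extinction by such events shows that it is incompatible with `E ≠ ∅`, up to a null set.

Multiplicity. The Fourier series of a measure carried by the closed set `E`, with coefficients
tending to `0`, converges to `0` off `E` by localisation (`isSetOfMultiplicity_of_isRajchman`). For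
`ℓₙ = α / n` the kernel is at most a constant times `‖t‖ ^ (-α)`, and it suffices that `α (1 + 1 /
d) < 1`. -/

instance : IsProbabilityMeasure (volume : Measure UnitAddCircle) :=
  ⟨UnitAddCircle.measure_univ⟩

/-- The representative in `[0, 1)` of a point of the circle. -/
def rep (t : UnitAddCircle) : ℝ := (AddCircle.equivIco 1 0 t : ℝ)

theorem rep_nonneg (t : UnitAddCircle) : 0 ≤ rep t := (AddCircle.equivIco 1 0 t).2.1

theorem rep_lt_one (t : UnitAddCircle) : rep t < 1 :=
  (AddCircle.equivIco (1 : ℝ) 0 t).2.2.trans_eq (zero_add 1)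

theorem coe_rep (t : UnitAddCircle) : ((rep t : ℝ) : UnitAddCircle) = t :=
  (AddCircle.equivIco (1 : ℝ) 0).symm_apply_apply t

theorem rep_coe {s : ℝ} (h0 : 0 ≤ s) (h1 : s < 1) : rep (s : UnitAddCircle) = s := by
  rw [rep, AddCircle.equivIco_coe_eq (p := (1 : ℝ)) (a := 0) (x := s) ⟨h0, by simpa using h1⟩]

theorem rep_zero : rep 0 = 0 := by simpa using rep_coe (s := 0) le_rfl one_pos

theorem coe_one_eq : ((1 : ℝ) : UnitAddCircle) = 0 := AddCircle.coe_period 1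

theorem measurable_rep : Measurable rep :=
  measurable_subtype_coe.comp (AddCircle.measurableEquivIco (1 : ℝ) 0).measurable

/-- If `u = ↑s` with `s ∈ [0, 1)` then `rep u = s`. -/
theorem rep_eq_of_coe_eq {u : UnitAddCircle} {s : ℝ} (h : (s : UnitAddCircle) = u)
    (h0 : 0 ≤ s) (h1 : s < 1) : rep u = s := by
  rw [← h, rep_coe h0 h1]

theorem rep_add (u v : UnitAddCircle) :
    rep (u + v) = if rep u + rep v < 1 then rep u + rep v else rep u + rep v - 1 := by
  have hu := rep_nonneg u
  have hv := rep_nonneg v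
  have hu1 := rep_lt_one u
  have hv1 := rep_lt_one v
  split_ifs with h
  · exact rep_eq_of_coe_eq (by rw [AddCircle.coe_add, coe_rep, coe_rep]) (by linarith) h
  · exact rep_eq_of_coe_eq (by
      rw [AddCircle.coe_sub, AddCircle.coe_add, coe_rep, coe_rep, coe_one_eq, sub_zero])
      (by linarith) (by linarith)

theorem rep_sub (u v : UnitAddCircle) :
    rep (u - v) = if rep v ≤ rep u then rep u - rep v else rep u - rep v + 1 := by
  have hu := rep_nonneg u
  have hv := rep_nonneg v
  have hu1 := rep_lt_one u
  have hv1 := rep_lt_one v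
  split_ifs with h
  · exact rep_eq_of_coe_eq (by rw [AddCircle.coe_sub, coe_rep, coe_rep]) (by linarith)
      (by linarith)
  · exact rep_eq_of_coe_eq (by
      rw [AddCircle.coe_add, AddCircle.coe_sub, coe_rep, coe_rep, coe_one_eq, add_zero])
      (by linarith) (by linarith)

theorem norm_eq_min_rep (t : UnitAddCircle) : ‖t‖ = min (rep t) (1 - rep t) := by
  have h0 := rep_nonneg t
  have h1 := rep_lt_one t
  conv_lhs => rw [← coe_rep t, UnitAddCircle.norm_eq]
  rw [abs_sub_round_eq_min, Int.fract_eq_self.2 ⟨h0, h1⟩]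

theorem volume_rep_preimage {S : Set ℝ} (hS : MeasurableSet S) :
    volume (rep ⁻¹' S) = volume (S ∩ Set.Ioc 0 1) := by
  have hm : MeasurableSet (rep ⁻¹' S) := measurable_rep hS
  have := (UnitAddCircle.measurePreserving_mk 0).measure_preimage hm.nullMeasurableSet
  rw [← this, Measure.restrict_apply ((AddCircle.measurable_mk') hm), zero_add]
  refine measure_congr ?_
  -- On the fundamental domain `(0, 1]` the equation `rep s = s` fails only at `s = 1`.
  have h1 : ∀ᵐ s : ℝ, s ≠ 1 := by simp [ae_iff]
  filter_upwards [h1] with s hs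
  apply propext
  constructor
  · rintro ⟨h, h'⟩
    refine ⟨?_, h'⟩
    have : rep (s : UnitAddCircle) = s := rep_coe h'.1.le (lt_of_le_of_ne h'.2 hs)
    change rep (s : UnitAddCircle) ∈ S at h
    rwa [this] at h
  · rintro ⟨h, h'⟩
    refine ⟨?_, h'⟩
    have : rep (s : UnitAddCircle) = s := rep_coe h'.1.le (lt_of_le_of_ne h'.2 hs)
    change rep (s : UnitAddCircle) ∈ S
    rwa [this]

theorem mem_arc_iff {x t : UnitAddCircle} {r : ℝ} (hr : r ≤ 1) :
    t ∈ arc x r ↔ 0 < rep (t - x) ∧ rep (t - x) < r := by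
  constructor
  · rintro ⟨s, ⟨h0, h1⟩, rfl⟩
    simp only [add_sub_cancel_left]
    rw [rep_coe h0.le (h1.trans_le hr)]
    exact ⟨h0, h1⟩
  · rintro ⟨h0, h1⟩
    exact ⟨rep (t - x), ⟨h0, h1⟩, by simp [coe_rep]⟩

theorem isOpen_arc (x : UnitAddCircle) (r : ℝ) : IsOpen (arc x r) := by
  have : arc x r = (fun t => x + t) '' ((fun s : ℝ => (s : UnitAddCircle)) '' Set.Ioo 0 r) := by
    rw [arc, Set.image_image]
  rw [this]
  exact (Homeomorph.addLeft x).isOpenMap _ (QuotientAddGroup.isOpenMap_coe _ isOpen_Ioo)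

/-- The normalized indicator function of the complement of the arc `(0, r)`. -/
def pf (r : ℝ) (u : UnitAddCircle) : ℝ := if 0 < rep u ∧ rep u < r then 0 else 1 / (1 - r)

theorem measurableSet_arc0 (r : ℝ) : MeasurableSet {u : UnitAddCircle | 0 < rep u ∧ rep u < r} :=
  measurable_rep measurableSet_Ioo

theorem measurable_pf (r : ℝ) : Measurable (pf r) :=
  Measurable.ite (measurableSet_arc0 r) measurable_const measurable_const

theorem pf_nonneg {r : ℝ} (hr : r < 1) (u : UnitAddCircle) : 0 ≤ pf r u := by
  unfold pf
  split_ifs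
  · exact le_rfl
  · exact div_nonneg zero_le_one (by linarith)

theorem pf_le {r : ℝ} (hr : r < 1) (u : UnitAddCircle) : pf r u ≤ 1 / (1 - r) := by
  unfold pf
  split_ifs
  · exact div_nonneg zero_le_one (by linarith)
  · exact le_rfl

theorem factor_eq {ℓ : ℕ → ℝ} (x : ℕ → UnitAddCircle) {n : ℕ} (h : ℓ n < 1) (t : UnitAddCircle) :
    factor ℓ x n t = pf (ℓ n) (t - x n) := by
  unfold factor pf
  by_cases ht : t ∈ arc (x n) (ℓ n)
  · rw [if_pos ((mem_arc_iff h.le).1 ht)]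
    simp [ht]
  · rw [if_neg (fun h' => ht ((mem_arc_iff h.le).2 h'))]
    simp [ht]

theorem pf_eq {r : ℝ} (u : UnitAddCircle) :
    pf r u = (1 - {u : UnitAddCircle | 0 < rep u ∧ rep u < r}.indicator (fun _ => (1 : ℝ)) u)
      / (1 - r) := by
  unfold pf
  split_ifs with h
  · simp [h]
  · rw [Set.indicator_of_notMem (by simpa using h)]; simp

theorem volume_real_arc0 {r : ℝ} (h0 : 0 ≤ r) (h1 : r ≤ 1) :
    volume.real {u : UnitAddCircle | 0 < rep u ∧ rep u < r} = r := by
  rw [measureReal_def]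
  change (volume (rep ⁻¹' Set.Ioo 0 r)).toReal = r
  rw [volume_rep_preimage measurableSet_Ioo]
  have : Set.Ioo 0 r ∩ Set.Ioc 0 1 = Set.Ioo 0 r :=
    Set.inter_eq_left.2 fun s hs => ⟨hs.1, hs.2.le.trans h1⟩
  rw [this, Real.volume_Ioo, sub_zero, ENNReal.toReal_ofReal h0]

theorem integral_pf {r : ℝ} (h0 : 0 ≤ r) (h1 : r < 1) : ∫ u, pf r u = 1 := by
  simp_rw [pf_eq]
  rw [integral_div, integral_sub (integrable_const _)
    ((integrable_const _).indicator (measurableSet_arc0 r)),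
    integral_indicator_const _ (measurableSet_arc0 r), volume_real_arc0 h0 h1.le]
  rw [integral_const, probReal_univ]
  simp only [smul_eq_mul, mul_one]
  exact div_self (by linarith)

/-- The length of the intersection of `(0, r)` with its translate by `-t`. -/
theorem volume_real_overlap {r : ℝ} (h1 : r ≤ 1 / 2) (t : UnitAddCircle) :
    volume.real ({u : UnitAddCircle | 0 < rep u ∧ rep u < r} ∩
      {u : UnitAddCircle | 0 < rep (u + t) ∧ rep (u + t) < r}) = max 0 (r - ‖t‖) := by
  have hs0 := rep_nonneg t
  have hs1 := rep_lt_one t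
  set s := rep t with hs
  -- The second interval comes from wrapping around. Since `r ≤ 1 / 2`, at most one of the two is
  -- nonempty, which is why a single positive part remains.
  have hset : ({u : UnitAddCircle | 0 < rep u ∧ rep u < r} ∩
      {u : UnitAddCircle | 0 < rep (u + t) ∧ rep (u + t) < r}) =
      rep ⁻¹' (Set.Ioo 0 (r - s) ∪ Set.Ioo (1 - s) r) := by
    ext u
    have hu0 := rep_nonneg u
    have hu1 := rep_lt_one u
    simp only [Set.mem_inter_iff, Set.mem_ofPred_eq, Set.mem_preimage, Set.mem_union, Set.mem_Ioo]
    rw [rep_add, ← hs]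
    split_ifs with h
    · constructor
      · rintro ⟨⟨a, b⟩, c, d⟩
        exact Or.inl ⟨a, by linarith⟩
      · rintro (⟨a, b⟩ | ⟨a, b⟩)
        · exact ⟨⟨a, by linarith⟩, by linarith, by linarith⟩
        · linarith
    · constructor
      · rintro ⟨⟨a, b⟩, c, d⟩
        exact Or.inr ⟨by linarith, by linarith⟩
      · rintro (⟨a, b⟩ | ⟨a, b⟩)
        · linarith
        · exact ⟨⟨by linarith, by linarith⟩, by linarith, by linarith⟩
  rw [hset, measureReal_def, volume_rep_preimage (measurableSet_Ioo.union measurableSet_Ioo)]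
  have : (Set.Ioo 0 (r - s) ∪ Set.Ioo (1 - s) r) ∩ Set.Ioc 0 1 =
      (Set.Ioo 0 (r - s) ∪ Set.Ioo (1 - s) r) := by
    refine Set.inter_eq_left.2 ?_
    rintro v (⟨a, b⟩ | ⟨a, b⟩)
    · exact ⟨a, by linarith⟩
    · exact ⟨by linarith, by linarith⟩
  rw [this, measure_union _ measurableSet_Ioo, Real.volume_Ioo, Real.volume_Ioo, sub_zero,
    norm_eq_min_rep, ← hs]
  · rw [ENNReal.toReal_add ENNReal.ofReal_ne_top ENNReal.ofReal_ne_top, ENNReal.toReal_ofReal',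
      ENNReal.toReal_ofReal']
    rcases le_total s (1 - s) with h | h
    · rw [min_eq_left h, max_eq_right (a := r - (1 - s)) (by linarith), add_zero, max_comm]
    · rw [min_eq_right h, max_eq_right (a := r - s) (by linarith), zero_add, max_comm]
  · rw [Set.disjoint_left]
    rintro v ⟨a, b⟩ ⟨c, d⟩
    linarith

/-- The correlation function of `pf r`. -/
def corr (r : ℝ) (t : UnitAddCircle) : ℝ := (1 - 2 * r + max 0 (r - ‖t‖)) / (1 - r) ^ 2

theorem integral_pf_mul_pf {r : ℝ} (h0 : 0 ≤ r) (h1 : r ≤ 1 / 2) (t : UnitAddCircle) :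
    ∫ u, pf r u * pf r (u + t) = corr r t := by
  set A := {u : UnitAddCircle | 0 < rep u ∧ rep u < r} with hA
  have hAm : MeasurableSet A := measurableSet_arc0 r
  set A' := {u : UnitAddCircle | 0 < rep (u + t) ∧ rep (u + t) < r} with hA'
  have hAm' : MeasurableSet A' := (measurable_add_const t) hAm
  have hA'v : volume.real A' = r := by
    rw [← volume_real_arc0 h0 (by linarith : r ≤ 1), measureReal_def, measureReal_def]
    congr 1
    exact measure_preimage_add_right volume t A
  have key : ∀ u, pf r u * pf r (u + t) = (1 - A.indicator (fun _ => (1 : ℝ)) u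
      - A'.indicator (fun _ => (1 : ℝ)) u + (A ∩ A').indicator (fun _ => (1 : ℝ)) u)
      / (1 - r) ^ 2 := by
    intro u
    have e : A'.indicator (fun _ => (1 : ℝ)) u = A.indicator (fun _ => (1 : ℝ)) (u + t) := rfl
    have e2 : (A ∩ A').indicator (fun _ => (1 : ℝ)) u =
        A.indicator (fun _ => (1 : ℝ)) u * A'.indicator (fun _ => (1 : ℝ)) u := by
      by_cases h : u ∈ A <;> by_cases h' : u ∈ A' <;> simp [h, h']
    rw [pf_eq, pf_eq, e2, e]
    field_simp
    ring
  simp_rw [key]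
  have iA := (integrable_const (μ := (volume : Measure UnitAddCircle)) (1 : ℝ)).indicator hAm
  have iA' := (integrable_const (μ := (volume : Measure UnitAddCircle)) (1 : ℝ)).indicator hAm'
  have iAA := (integrable_const (μ := (volume : Measure UnitAddCircle)) (1 : ℝ)).indicator
    (hAm.inter hAm')
  have i1 := integrable_const (μ := (volume : Measure UnitAddCircle)) (1 : ℝ)
  have i2 : Integrable (fun u => (1 : ℝ) - A.indicator (fun _ => (1 : ℝ)) u) volume := i1.sub iA
  have i3 : Integrable (fun u => (1 : ℝ) - A.indicator (fun _ => (1 : ℝ)) u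
    - A'.indicator (fun _ => (1 : ℝ)) u) volume := i2.sub iA'
  rw [integral_div, integral_add i3 iAA, integral_sub i2 iA', integral_sub i1 iA,
    integral_indicator_const _ hAm, integral_indicator_const _ hAm',
    integral_indicator_const _ (hAm.inter hAm'), volume_real_overlap h1, hA'v,
    volume_real_arc0 h0 (by linarith), corr,
    integral_const, probReal_univ]
  simp only [smul_eq_mul, mul_one]
  ring

theorem corr_pos {r : ℝ} (h1 : r < 1 / 2) (t : UnitAddCircle) : 0 < corr r t := by
  have := le_max_left 0 (r - ‖t‖)
  exact div_pos (by linarith) (by have : 0 < 1 - r := by linarith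
                                  positivity)

theorem continuous_corr (r : ℝ) : Continuous (corr r) := by
  unfold corr; fun_prop

theorem one_div_one_sub_le {r : ℝ} (h0 : 0 ≤ r) (h1 : r ≤ 1 / 4) :
    1 / (1 - r) ≤ Real.exp (r + 2 * r ^ 2) := by
  have := Real.add_one_le_exp (r + 2 * r ^ 2)
  refine le_trans ?_ this
  rw [div_le_iff₀ (by linarith)]
  nlinarith [mul_nonneg h0 h0, mul_nonneg (mul_nonneg h0 h0) (by linarith : 0 ≤ 1 - 4 * r)]

theorem one_div_one_sub_pow_le {r : ℝ} (h0 : 0 ≤ r) (h1 : r ≤ 1 / 4) (n : ℕ) :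
    1 / (1 - r) ^ n ≤ Real.exp (n * (r + 2 * r ^ 2)) := by
  have h' : 0 ≤ 1 / (1 - r) := div_nonneg zero_le_one (by linarith)
  calc 1 / (1 - r) ^ n = (1 / (1 - r)) ^ n := by rw [div_pow, one_pow]
    _ ≤ (Real.exp (r + 2 * r ^ 2)) ^ n := by gcongr; exact one_div_one_sub_le h0 h1
    _ = Real.exp (n * (r + 2 * r ^ 2)) := by rw [← Real.exp_nat_mul]

/-- The first-order term `-2 r` of the numerator cancels against the denominator; only the overlap
and an error of order `r ^ 2` remain, and these errors are summable over the arcs. -/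
theorem corr_le {r : ℝ} (h0 : 0 ≤ r) (h1 : r ≤ 1 / 4) (t : UnitAddCircle) :
    corr r t ≤ Real.exp (max 0 (r - ‖t‖) + 4 * r ^ 2) := by
  set a := max 0 (r - ‖t‖)
  have ha : 0 ≤ a := le_max_left _ _
  have h2 : 1 - 2 * r + a ≤ Real.exp (a - 2 * r) := by
    have := Real.add_one_le_exp (a - 2 * r); linarith
  calc corr r t = (1 - 2 * r + a) * (1 / (1 - r) ^ 2) := by rw [corr]; ring
    _ ≤ Real.exp (a - 2 * r) * Real.exp ((2 : ℕ) * (r + 2 * r ^ 2)) := by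
        gcongr
        exact one_div_one_sub_pow_le h0 h1 2
    _ = _ := by rw [← Real.exp_add]; push_cast; ring_nf

theorem exp_neg_le_one_sub {v : ℝ} (h0 : 0 ≤ v) (h1 : v ≤ 1 / 2) :
    Real.exp (-(v + v ^ 2)) ≤ 1 - v := by
  have h : 1 / (1 - v) ≥ 0 := div_nonneg zero_le_one (by linarith)
  have h2 := Real.add_one_le_exp (v + v ^ 2)
  have hp : 0 < 1 - v := by linarith
  rw [Real.exp_neg, inv_le_comm₀ (Real.exp_pos _) hp]
  -- With `w = v + v ^ 2`, the quantity `(1 - v) * (1 + w + w ^ 2 / 2) - 1` equals `v ^ 2 * (1 - v -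
  -- v ^ 2 - v ^ 3) / 2`, which is nonnegative for `v ≤ 1 / 2`.
  refine le_trans ?_ (Real.quadratic_le_exp_of_nonneg (by positivity))
  rw [inv_le_iff_one_le_mul₀ hp]
  nlinarith [mul_nonneg h0 h0, mul_nonneg (mul_nonneg h0 h0) h0,
    mul_nonneg (mul_nonneg h0 h0) (mul_nonneg h0 h0),
    mul_nonneg (mul_nonneg (mul_nonneg h0 h0) (mul_nonneg h0 h0)) h0,
    mul_nonneg (mul_nonneg h0 h0) (by linarith : 0 ≤ 1 - 2 * v),
    mul_nonneg (mul_nonneg (mul_nonneg h0 h0) h0) (by linarith : 0 ≤ 1 - 2 * v),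
    mul_nonneg (mul_nonneg (mul_nonneg h0 h0) (mul_nonneg h0 h0)) (by linarith : 0 ≤ 1 - 2 * v)]

/-- The matching lower bound is what lets a product of correlations dominate a mixed moment of
several points. -/
theorem le_corr {r : ℝ} (h0 : 0 ≤ r) (h1 : r ≤ 1 / 4) (t : UnitAddCircle) :
    Real.exp (max 0 (r - ‖t‖) - 4 * r ^ 2) ≤ corr r t := by
  set a := max 0 (r - ‖t‖)
  have ha : 0 ≤ a := le_max_left _ _
  have har : a ≤ r := max_le h0 (by linarith [norm_nonneg t])
  have h2 : Real.exp (-((2 * r - a) + (2 * r - a) ^ 2)) ≤ 1 - (2 * r - a) :=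
    exp_neg_le_one_sub (by linarith) (by linarith)
  have h3 : Real.exp (2 * r) ≤ 1 / (1 - r) ^ 2 := by
    rw [le_div_iff₀ (by have : 0 < 1 - r := by linarith
                        positivity)]
    have h4 : 1 - r ≤ Real.exp (-r) := by have := Real.add_one_le_exp (-r); linarith
    calc Real.exp (2 * r) * (1 - r) ^ 2 ≤ Real.exp (2 * r) * (Real.exp (-r)) ^ 2 := by
          gcongr; linarith
      _ = 1 := by rw [← Real.exp_nat_mul, ← Real.exp_add]; simp
  calc Real.exp (a - 4 * r ^ 2)
      ≤ Real.exp (-((2 * r - a) + (2 * r - a) ^ 2)) * Real.exp (2 * r) := by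
        rw [← Real.exp_add]
        apply Real.exp_le_exp.2
        nlinarith
    _ ≤ (1 - (2 * r - a)) * (1 / (1 - r) ^ 2) := by
        gcongr
        linarith
    _ = corr r t := by rw [corr]; ring

end

/-! ### Independent uniform endpoints, and factorisation of moments over the arcs. -/

section

/-- The law of a sequence of independent uniform points of the circle. -/
def unifSeq : Measure (ℕ → UnitAddCircle) := Measure.infinitePi fun _ => volume

instance : IsProbabilityMeasure unifSeq :=
  inferInstanceAs (IsProbabilityMeasure (Measure.infinitePi fun _ => volume))

/-- Resampling one coordinate does not change the law of a sequence. -/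
theorem measurePreserving_update (N : ℕ) :
    MeasurePreserving (fun z : (ℕ → UnitAddCircle) × UnitAddCircle => Function.update z.1 N z.2)
      (unifSeq.prod volume) unifSeq := by
  have hm : Measurable
      (fun z : (ℕ → UnitAddCircle) × UnitAddCircle => Function.update z.1 N z.2) := by
    refine measurable_pi_iff.2 fun i => ?_
    by_cases h : i = N
    · subst h; simpa using measurable_snd
    · simpa [Function.update_of_ne h] using measurable_fst.eval
  refine ⟨hm, Measure.eq_infinitePi _ fun s t ht => ?_⟩
  rw [Measure.map_apply hm (.pi s.countable_toSet fun i _ => ht i)]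
  have : (fun z : (ℕ → UnitAddCircle) × UnitAddCircle => Function.update z.1 N z.2) ⁻¹'
      ((s : Set ℕ).pi t) =
      ((s.erase N : Finset ℕ) : Set ℕ).pi t ×ˢ (if N ∈ s then t N else Set.univ) := by
    ext ⟨x, u⟩
    simp only [Set.mem_preimage, Set.mem_pi, Finset.mem_coe, Set.mem_prod, Finset.mem_erase]
    constructor
    · intro h
      refine ⟨fun i hi => by simpa [Function.update_of_ne hi.1] using h i hi.2, ?_⟩
      split_ifs with hN
      · simpa using h N hN
      · trivial
    · rintro ⟨h1, h2⟩ i hi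
      by_cases hN : i = N
      · subst hN; rw [if_pos hi] at h2; simpa using h2
      · simpa [Function.update_of_ne hN] using h1 i ⟨hN, hi⟩
  rw [this, Measure.prod_prod, unifSeq, Measure.infinitePi_pi _ (fun i _ => ht i)]
  split_ifs with hN
  · rw [mul_comm, Finset.mul_prod_erase s (fun i => volume (t i)) hN]
  · rw [Finset.erase_eq_of_notMem hN, measure_univ, mul_one]

/-- Resampling in integral form: it serves to integrate out one endpoint at a time. -/
theorem lintegral_update (N : ℕ) {F : (ℕ → UnitAddCircle) → ℝ≥0∞} (hF : Measurable F) :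
    ∫⁻ x, F x ∂unifSeq = ∫⁻ x, (∫⁻ u, F (Function.update x N u)) ∂unifSeq := by
  rw [← (measurePreserving_update N).lintegral_comp hF]
  exact lintegral_prod (fun z : (ℕ → UnitAddCircle) × UnitAddCircle =>
    F (Function.update z.1 N z.2)) (hF.comp (measurePreserving_update N).measurable).aemeasurable

/-- Rotating a single arc; used to compare the probabilities of different positions of that arc. -/
theorem measurePreserving_shift (i : ℕ) (v : UnitAddCircle) :
    MeasurePreserving (fun x : ℕ → UnitAddCircle => Function.update x i (x i + v))
      unifSeq unifSeq := by
  have h : (fun x : ℕ → UnitAddCircle => Function.update x i (x i + v)) =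
      fun x j => (if j = i then fun u : UnitAddCircle => u + v else id) (x j) := by
    funext x j
    by_cases hj : j = i
    · subst hj; simp
    · simp [hj]
  have hf : ∀ j, MeasurePreserving (if j = i then fun u : UnitAddCircle => u + v else id)
      volume volume := by
    intro j
    split_ifs
    · exact measurePreserving_add_right volume v
    · exact MeasurePreserving.id volume
  rw [h]
  refine ⟨measurable_pi_iff.2 fun j => (hf j).measurable.comp (measurable_pi_apply j), ?_⟩
  rw [unifSeq, Measure.infinitePi_map_pi _ (fun j => (hf j).measurable)]
  congr 1
  funext j
  exact (hf j).map_eq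

/-- Independence, by induction on `s`: resampling the coordinate `a` affects only the factor `f a`,
whose integral can then be taken out. -/
theorem lintegral_mul_prod_coord (s : Finset ℕ) (Z : (ℕ → UnitAddCircle) → ℝ≥0∞)
    (hZ : Measurable Z) (hZs : ∀ k ∈ s, ∀ x u, Z (Function.update x k u) = Z x)
    (f : ℕ → UnitAddCircle → ℝ≥0∞) (hf : ∀ k, Measurable (f k)) :
    ∫⁻ x, Z x * ∏ k ∈ s, f k (x k) ∂unifSeq = (∫⁻ x, Z x ∂unifSeq) * ∏ k ∈ s, ∫⁻ u, f k u := by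
  classical
  induction s using Finset.induction_on with
  | empty => simp
  | insert a s ha ih =>
    have hmk : ∀ k, Measurable fun x : ℕ → UnitAddCircle => f k (x k) := fun k =>
      (hf k).comp (measurable_pi_apply k)
    have hm : Measurable fun x : ℕ → UnitAddCircle => Z x * ∏ k ∈ s, f k (x k) :=
      hZ.mul (Finset.measurable_prod s fun k _ => hmk k)
    have hm2 : Measurable fun x : ℕ → UnitAddCircle => (Z x * ∏ k ∈ s, f k (x k)) * f a (x a) :=
      hm.mul (hmk a)
    have e1 : ∀ x : ℕ → UnitAddCircle, Z x * ∏ k ∈ insert a s, f k (x k) =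
        (Z x * ∏ k ∈ s, f k (x k)) * f a (x a) := fun x => by
      rw [Finset.prod_insert ha]; ring
    simp_rw [e1]
    rw [lintegral_update a hm2]
    have e2 : ∀ (x : ℕ → UnitAddCircle) (u : UnitAddCircle),
        (Z (Function.update x a u) * ∏ k ∈ s, f k (Function.update x a u k)) *
          f a (Function.update x a u a) = (Z x * ∏ k ∈ s, f k (x k)) * f a u := by
      intro x u
      rw [hZs a (Finset.mem_insert_self a s), Function.update_self]
      congr 2
      refine Finset.prod_congr rfl fun k hk => ?_
      rw [Function.update_of_ne (ne_of_mem_of_not_mem hk ha)]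
    simp_rw [e2]
    simp_rw [lintegral_const_mul _ (hf a)]
    rw [lintegral_mul_const _ hm, ih (fun k hk => hZs k (Finset.mem_insert_of_mem hk)),
      Finset.prod_insert ha]
    ring

/-- The product over `k ∈ s` of the functions `P`. -/
def partialDensity (ℓ : ℕ → ℝ) (s : Finset ℕ) (x : ℕ → UnitAddCircle) (t : UnitAddCircle) : ℝ :=
  ∏ k ∈ s, pf (ℓ k) (t - x k)

theorem density_eq {ℓ : ℕ → ℝ} (h : ∀ n, ℓ n < 1) (x : ℕ → UnitAddCircle) (n : ℕ)
    (t : UnitAddCircle) : density ℓ x n t = partialDensity ℓ (Finset.range n) x t :=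
  Finset.prod_congr rfl fun k _ => factor_eq x (h k) t

theorem partialDensity_nonneg {ℓ : ℕ → ℝ} (h : ∀ n, ℓ n < 1) (s : Finset ℕ)
    (x : ℕ → UnitAddCircle) (t : UnitAddCircle) : 0 ≤ partialDensity ℓ s x t :=
  Finset.prod_nonneg fun k _ => pf_nonneg (h k) _

theorem partialDensity_le {ℓ : ℕ → ℝ} (h : ∀ n, ℓ n < 1) (s : Finset ℕ)
    (x : ℕ → UnitAddCircle) (t : UnitAddCircle) :
    partialDensity ℓ s x t ≤ ∏ k ∈ s, (1 / (1 - ℓ k)) :=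
  Finset.prod_le_prod (fun k _ => pf_nonneg (h k) _) fun k _ => pf_le (h k) _

theorem measurable_partialDensity_uncurry (ℓ : ℕ → ℝ) (s : Finset ℕ) :
    Measurable fun z : (ℕ → UnitAddCircle) × UnitAddCircle => partialDensity ℓ s z.1 z.2 := by
  unfold partialDensity
  refine Finset.measurable_prod s fun k _ => (measurable_pf (ℓ k)).comp ?_
  exact measurable_snd.sub ((measurable_pi_apply k).comp measurable_fst)

theorem partialDensity_update {ℓ : ℕ → ℝ} {s : Finset ℕ} {k : ℕ} (hk : k ∉ s)
    (x : ℕ → UnitAddCircle) (u t : UnitAddCircle) :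
    partialDensity ℓ s (Function.update x k u) t = partialDensity ℓ s x t := by
  refine Finset.prod_congr rfl fun j hj => ?_
  rw [Function.update_of_ne (ne_of_mem_of_not_mem hj hk)]

/-- The mixed moment of the translates of `pf r` at the points `t i`. -/
def mixedMoment {ι : Type*} [Fintype ι] (r : ℝ) (t : ι → UnitAddCircle) : ℝ :=
  ∫ u, ∏ i, pf r (t i - u)

theorem prod_pf_nonneg {ι : Type*} [Fintype ι] {r : ℝ} (hr : r < 1) (t : ι → UnitAddCircle)
    (u : UnitAddCircle) : 0 ≤ ∏ i, pf r (t i - u) :=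
  Finset.prod_nonneg fun _ _ => pf_nonneg hr _

theorem measurable_prod_pf {ι : Type*} [Fintype ι] (r : ℝ) (t : ι → UnitAddCircle) :
    Measurable fun u => ∏ i, pf r (t i - u) :=
  Finset.measurable_prod _ fun _ _ => (measurable_pf r).comp (measurable_const.sub measurable_id)

theorem integrable_prod_pf {ι : Type*} [Fintype ι] {r : ℝ} (hr : r < 1)
    (t : ι → UnitAddCircle) : Integrable (fun u => ∏ i, pf r (t i - u)) volume := by
  refine Integrable.of_bound (measurable_prod_pf r t).aestronglyMeasurable
    (∏ _ : ι, (1 / (1 - r))) (ae_of_all _ fun u => ?_)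
  rw [Real.norm_of_nonneg (prod_pf_nonneg hr t u)]
  exact Finset.prod_le_prod (fun _ _ => pf_nonneg hr _) fun _ _ => pf_le hr _

theorem mixedMoment_nonneg {ι : Type*} [Fintype ι] {r : ℝ} (hr : r < 1)
    (t : ι → UnitAddCircle) : 0 ≤ mixedMoment r t :=
  integral_nonneg (prod_pf_nonneg hr t)

theorem mixedMoment_le {ι : Type*} [Fintype ι] {r : ℝ} (hr : r < 1)
    (t : ι → UnitAddCircle) : mixedMoment r t ≤ (1 / (1 - r)) ^ Fintype.card ι := by
  have : mixedMoment r t ≤ ∫ _u : UnitAddCircle, (1 / (1 - r)) ^ Fintype.card ι := by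
    refine integral_mono (integrable_prod_pf hr t) (integrable_const _) fun u => ?_
    calc ∏ i, pf r (t i - u) ≤ ∏ _i : ι, (1 / (1 - r)) :=
          Finset.prod_le_prod (fun _ _ => pf_nonneg hr _) fun _ _ => pf_le hr _
      _ = _ := by simp
  simpa using this

/-- For fixed points the arcs contribute independent factors, one mixed moment each. The weight `Z`
carries the dependence on the arcs outside `s`, as needed for conditional second moments. -/
theorem lintegral_mul_prod_partialDensity {ι : Type*} [Fintype ι] {ℓ : ℕ → ℝ} (h : ∀ n, ℓ n < 1)
    (s : Finset ℕ) (Z : (ℕ → UnitAddCircle) → ℝ≥0∞) (hZ : Measurable Z)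
    (hZs : ∀ k ∈ s, ∀ x u, Z (Function.update x k u) = Z x) (t : ι → UnitAddCircle) :
    ∫⁻ x, Z x * ENNReal.ofReal (∏ i, partialDensity ℓ s x (t i)) ∂unifSeq =
      (∫⁻ x, Z x ∂unifSeq) * ENNReal.ofReal (∏ k ∈ s, mixedMoment (ℓ k) t) := by
  have e1 : ∀ x, ENNReal.ofReal (∏ i, partialDensity ℓ s x (t i)) =
      ∏ k ∈ s, ENNReal.ofReal (∏ i, pf (ℓ k) (t i - x k)) := by
    intro x
    simp only [partialDensity]
    rw [Finset.prod_comm, ENNReal.ofReal_prod_of_nonneg fun k _ => prod_pf_nonneg (h k) t (x k)]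
  simp_rw [e1]
  rw [lintegral_mul_prod_coord s Z hZ hZs
    (fun k u => ENNReal.ofReal (∏ i, pf (ℓ k) (t i - u)))
    (fun k => (measurable_prod_pf (ℓ k) t).ennreal_ofReal),
    ENNReal.ofReal_prod_of_nonneg fun k _ => mixedMoment_nonneg (h k) t]
  congr 1
  refine Finset.prod_congr rfl fun k _ => ?_
  rw [mixedMoment, ofReal_integral_eq_lintegral_ofReal (integrable_prod_pf (h k) t)
    (ae_of_all _ (prod_pf_nonneg (h k) t))]

theorem integral_pf_const_sub {r : ℝ} (h0 : 0 ≤ r) (h1 : r < 1) (t : UnitAddCircle) :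
    ∫ u, pf r (t - u) = 1 := by
  rw [integral_sub_left_eq_self (pf r) volume t, integral_pf h0 h1]

theorem mixedMoment_one {r : ℝ} (h0 : 0 ≤ r) (h1 : r < 1) (t : Fin 1 → UnitAddCircle) :
    mixedMoment r t = 1 := by
  simp only [mixedMoment, Finset.univ_unique, Finset.prod_singleton]
  exact integral_pf_const_sub h0 h1 _

theorem mixedMoment_two {r : ℝ} (h0 : 0 ≤ r) (h1 : r ≤ 1 / 2) (s t : UnitAddCircle) :
    mixedMoment r ![s, t] = corr r (t - s) := by
  rw [← integral_pf_mul_pf h0 h1, mixedMoment,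
    ← integral_sub_left_eq_self (fun u => pf r u * pf r (u + (t - s))) volume s]
  refine integral_congr_ae (ae_of_all _ fun u => ?_)
  simp only [Fin.prod_univ_two, Matrix.cons_val_zero, Matrix.cons_val_one]
  congr 2
  abel

theorem lintegral_mul_partialDensity {ℓ : ℕ → ℝ} (h0 : ∀ n, 0 ≤ ℓ n) (h : ∀ n, ℓ n < 1)
    (s : Finset ℕ) (Z : (ℕ → UnitAddCircle) → ℝ≥0∞) (hZ : Measurable Z)
    (hZs : ∀ k ∈ s, ∀ x u, Z (Function.update x k u) = Z x) (t : UnitAddCircle) :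
    ∫⁻ x, Z x * ENNReal.ofReal (partialDensity ℓ s x t) ∂unifSeq = ∫⁻ x, Z x ∂unifSeq := by
  have := lintegral_mul_prod_partialDensity h s Z hZ hZs (fun _ : Fin 1 => t)
  simpa [mixedMoment_one (h0 _) (h _)] using this

theorem lintegral_mul_partialDensity_mul {ℓ : ℕ → ℝ} (h : ∀ n, ℓ n < 1)
    (s : Finset ℕ) (Z : (ℕ → UnitAddCircle) → ℝ≥0∞) (hZ : Measurable Z)
    (hZs : ∀ k ∈ s, ∀ x u, Z (Function.update x k u) = Z x) (t t' : UnitAddCircle) :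
    ∫⁻ x, Z x * ENNReal.ofReal (partialDensity ℓ s x t * partialDensity ℓ s x t') ∂unifSeq =
      (∫⁻ x, Z x ∂unifSeq) * ENNReal.ofReal (∏ k ∈ s, mixedMoment (ℓ k) ![t, t']) := by
  simpa [Fin.prod_univ_two] using lintegral_mul_prod_partialDensity h s Z hZ hZs ![t, t']

end

/-! ### Measures with vanishing Fourier coefficients, and sets of multiplicity. -/

section

theorem integrable_continuousMap (μ : Measure UnitAddCircle) [IsFiniteMeasure μ]
    (g : C(UnitAddCircle, ℂ)) : Integrable (fun s => g s) μ :=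
  Integrable.of_bound g.continuous.aestronglyMeasurable ‖g‖
    (ae_of_all _ fun s => g.norm_coe_le_norm s)

/-- If the Fourier coefficients of `μ` tend to `0`, so do those of `g μ` for every continuous
function `g`. -/
theorem IsRajchman.mul_continuous {μ : Measure UnitAddCircle} [IsFiniteMeasure μ]
    (h : IsRajchman μ) (g : C(UnitAddCircle, ℂ)) :
    Tendsto (fun k : ℤ => ∫ s, fourier (-k) s * g s ∂μ) cofinite (𝓝 0) := by
  -- Multiplication by a character shifts the coefficients, so the claim holds for trigonometric
  -- polynomials; these are uniformly dense.
  have hspan : ∀ f ∈ Submodule.span ℂ (Set.range (fourier (T := (1 : ℝ)))),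
      Tendsto (fun k : ℤ => ∫ s, fourier (-k) s * f s ∂μ) cofinite (𝓝 0) := by
    intro f hf
    induction hf using Submodule.span_induction with
    | mem f hf =>
      obtain ⟨j, rfl⟩ := hf
      have e : ∀ k : ℤ, ∫ s, fourier (-k) s * fourier j s ∂μ =
          ∫ s, fourier (-(k - j)) s ∂μ := fun k => by
        refine integral_congr_ae (ae_of_all _ fun s => ?_)
        simp only
        rw [← fourier_add]
        congr 2
        ring
      simp_rw [e]
      exact h.comp (sub_left_injective (b := j)).tendsto_cofinite
    | zero => simp
    | add f1 f2 _ _ h1 h2 =>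
      have e : ∀ k : ℤ, ∫ s, fourier (-k) s * (f1 + f2) s ∂μ =
          ∫ s, fourier (-k) s * f1 s ∂μ + ∫ s, fourier (-k) s * f2 s ∂μ := fun k => by
        refine Eq.trans ?_ (integral_add (integrable_continuousMap μ (fourier (-k) * f1))
          (integrable_continuousMap μ (fourier (-k) * f2)))
        refine integral_congr_ae (ae_of_all _ fun s => ?_)
        simp only [ContinuousMap.add_apply]
        ring
      simp_rw [e]
      simpa using h1.add h2
    | smul a f _ h1 =>
      have e : ∀ k : ℤ, ∫ s, fourier (-k) s * (a • f) s ∂μ =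
          a * ∫ s, fourier (-k) s * f s ∂μ := fun k => by
        rw [← integral_const_mul]
        refine integral_congr_ae (ae_of_all _ fun s => ?_)
        simp only [ContinuousMap.smul_apply, smul_eq_mul]
        ring
      simp_rw [e]
      simpa using h1.const_mul a
  rw [Metric.tendsto_nhds]
  intro ε hε
  set m := μ.real Set.univ
  have hm : 0 ≤ m := measureReal_nonneg
  -- The denominator has `m + 1` in place of `m` so that a measure of mass `0` is allowed.
  have hg : g ∈ (Submodule.span ℂ (Set.range (fourier (T := (1 : ℝ))))).topologicalClosure := by
    rw [span_fourier_closure_eq_top]; trivial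
  obtain ⟨f, hf, hfg⟩ := Metric.mem_closure_iff.1 hg (ε / (2 * (m + 1))) (by positivity)
  have hf0 := hspan f hf
  rw [Metric.tendsto_nhds] at hf0
  filter_upwards [hf0 (ε / 2) (by positivity)] with k hk
  rw [dist_zero_right] at hk ⊢
  have e : ∫ s, fourier (-k) s * g s ∂μ =
      ∫ s, fourier (-k) s * f s ∂μ + ∫ s, fourier (-k) s * (g - f) s ∂μ := by
    refine Eq.trans ?_ (integral_add (integrable_continuousMap μ (fourier (-k) * f))
      (integrable_continuousMap μ (fourier (-k) * (g - f))))
    refine integral_congr_ae (ae_of_all _ fun s => ?_)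
    simp only [ContinuousMap.sub_apply]
    ring
  have hb : ‖∫ s, fourier (-k) s * (g - f) s ∂μ‖ ≤ ε / (2 * (m + 1)) * m := by
    refine norm_integral_le_of_norm_le_const (ae_of_all _ fun s => ?_)
    rw [norm_mul, fourier_apply, Circle.norm_coe, one_mul]
    refine ((g - f).norm_coe_le_norm s).trans ?_
    rw [← dist_eq_norm]
    exact hfg.le
  have hb2 : ε / (2 * (m + 1)) * m ≤ ε / 2 := by
    rw [div_mul_eq_mul_div, div_le_div_iff₀ (by positivity) (by positivity)]
    nlinarith
  rw [e]
  calc _ ≤ _ := norm_add_le _ _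
    _ < ε := by linarith

/-- Telescoping form of the Dirichlet kernel, kept free of division so that it also holds at `u =
0`. -/
theorem sum_fourier_mul_sub_one (N : ℕ) (u : UnitAddCircle) :
    (∑ k ∈ Finset.Icc (-(N : ℤ)) N, fourier k u) * (fourier 1 u - 1) =
      fourier ((N : ℤ) + 1) u - fourier (-(N : ℤ)) u := by
  induction N with
  | zero => simp
  | succ N ih =>
    have e : Finset.Icc (-((N + 1 : ℕ) : ℤ)) ((N + 1 : ℕ) : ℤ) =
        insert (-((N : ℤ) + 1)) (insert ((N : ℤ) + 1) (Finset.Icc (-(N : ℤ)) N)) := by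
      ext k
      simp only [Finset.mem_Icc, Finset.mem_insert]
      push_cast
      omega
    rw [e, Finset.sum_insert (by simp; omega), Finset.sum_insert (by simp), add_mul, add_mul, ih]
    have e1 : fourier (-(N : ℤ)) u = fourier (-((N : ℤ) + 1)) u * fourier 1 u := by
      rw [← fourier_add]; congr 2; ring
    have e2 : fourier (((N + 1 : ℕ) : ℤ) + 1) u = fourier ((N : ℤ) + 1) u * fourier 1 u := by
      rw [← fourier_add]; push_cast; rfl
    rw [e1, e2]
    push_cast
    ring

/-- On the compact set `S` the modulus of `fourier 1 (t - s) - 1` is bounded away from `0`.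
Truncating its square from below by `η` in the quotient of the conjugate by the squared modulus
extends the inverse continuously to the whole circle. -/
theorem exists_continuous_inverse {S : Set UnitAddCircle} (hS : IsClosed S) {t : UnitAddCircle}
    (ht : t ∉ S) : ∃ g : C(UnitAddCircle, ℂ), ∀ s ∈ S, (fourier 1 (t - s) - 1) * g s = 1 := by
  have hc : Continuous fun s : UnitAddCircle => fourier 1 (t - s) - 1 := by fun_prop
  have hc2 : Continuous fun s : UnitAddCircle => ‖fourier 1 (t - s) - 1‖ ^ 2 := by fun_prop
  have hpos : ∀ s ∈ S, 0 < ‖fourier 1 (t - s) - 1‖ ^ 2 := by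
    intro s hs
    have : fourier 1 (t - s) - 1 ≠ 0 := by
      intro h
      rw [sub_eq_zero, fourier_one] at h
      have h2 : AddCircle.toCircle (t - s) = AddCircle.toCircle (0 : UnitAddCircle) := by
        rw [AddCircle.toCircle_zero]; exact Circle.ext h
      have h3 := AddCircle.injective_toCircle (one_ne_zero) h2
      rw [sub_eq_zero] at h3
      exact ht (h3 ▸ hs)
    positivity
  obtain ⟨η, hη, hηS⟩ := hS.isCompact.exists_forall_le' hc2.continuousOn hpos
  refine ⟨⟨fun s => starRingEnd ℂ (fourier 1 (t - s) - 1) *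
    (((max (‖fourier 1 (t - s) - 1‖ ^ 2) η)⁻¹ : ℝ) : ℂ), ?_⟩, fun s hs => ?_⟩
  · refine (Complex.continuous_conj.comp hc).mul (Complex.continuous_ofReal.comp ?_)
    exact (hc2.max continuous_const).inv₀ fun s => (lt_max_of_lt_right hη).ne'
  · change (fourier 1 (t - s) - 1) * (starRingEnd ℂ (fourier 1 (t - s) - 1) *
      (((max (‖fourier 1 (t - s) - 1‖ ^ 2) η)⁻¹ : ℝ) : ℂ)) = 1
    rw [max_eq_left (hηS s hs), ← mul_assoc, Complex.mul_conj, Complex.normSq_eq_norm_sq,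
      ← Complex.ofReal_mul, mul_inv_cancel₀ (hpos s hs).ne', Complex.ofReal_one]

theorem fourier_sub_eq (k : ℤ) (t s : UnitAddCircle) :
    fourier k (t - s) = fourier (-k) s * fourier k t := by
  simp only [fourier_apply]
  rw [smul_sub, sub_eq_neg_add, AddCircle.toCircle_add, neg_smul]
  push_cast
  rfl

/-- The symmetric partial sums of the Fourier series of a measure carried by `S`, at a point `t`
of the complement of `S`. -/
theorem sum_integral_fourier_mul {S : Set UnitAddCircle} {μ : Measure UnitAddCircle}
    [IsFiniteMeasure μ] (hμS : μ Sᶜ = 0) {t : UnitAddCircle} {g : C(UnitAddCircle, ℂ)}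
    (hg : ∀ s ∈ S, (fourier 1 (t - s) - 1) * g s = 1) (N : ℕ) :
    ∑ k ∈ Finset.Icc (-(N : ℤ)) N, (∫ s, fourier (-k) s ∂μ) * fourier k t =
      fourier ((N : ℤ) + 1) t * (∫ s, fourier (-((N : ℤ) + 1)) s * g s ∂μ) -
        fourier (-(N : ℤ)) t * (∫ s, fourier (-(-(N : ℤ))) s * g s ∂μ) := by
  have hint : ∀ k j : ℤ, Integrable (fun s => fourier k t * (fourier j s * g s)) μ := by
    intro k j
    have : Integrable (fun s => fourier j s * g s) μ :=
      integrable_continuousMap μ (fourier j * g)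
    exact this.const_mul _
  have hint2 : ∀ k : ℤ, Integrable (fun s => fourier (-k) s * fourier k t) μ := fun k =>
    (integrable_continuousMap μ (fourier (-k))).mul_const (fourier k t)
  simp_rw [← integral_mul_const, ← integral_const_mul]
  rw [← integral_finsetSum _ fun k _ => hint2 k, ← integral_sub (hint _ _) (hint _ _)]
  refine integral_congr_ae ?_
  have hae : ∀ᵐ s ∂μ, s ∈ S := hμS
  filter_upwards [hae] with s hs
  have e := sum_fourier_mul_sub_one N (t - s)
  have hg' := hg s hs
  simp_rw [fourier_sub_eq _ t s] at e hg'
  have alg : ∀ a b c d p q v : ℂ, a * b = p * c - q * d → b * v = 1 →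
      a = c * (p * v) - d * (q * v) := by
    intro a b c d p q v h1 h2
    calc a = a * b * v := by rw [mul_assoc, h2, mul_one]
      _ = _ := by rw [h1]; ring
  exact alg _ _ _ _ _ _ _ e hg'

/-- Riemann localisation: off `S` the `N`-th symmetric partial sum of the Fourier series of `μ` is a
combination of only two coefficients of the measure `g μ`, at `N + 1` and `-N`, and these tend to
`0`. The coefficient of index `0` is the mass of `μ`, which is not `0`. -/
theorem isSetOfMultiplicity_of_isRajchman {S : Set UnitAddCircle} (hS : IsClosed S)
    (μ : FiniteMeasure UnitAddCircle) (hμ : μ ≠ 0) (hμS : (μ : Measure UnitAddCircle) Sᶜ = 0)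
    (hR : IsRajchman (μ : Measure UnitAddCircle)) : IsSetOfMultiplicity S := by
  intro hU
  have h0 := hU (fun k => ∫ s, fourier (-k) s ∂(μ : Measure UnitAddCircle)) ?_ 0
  · simp only [neg_zero, fourier_zero] at h0
    have : (μ : Measure UnitAddCircle).real Set.univ = 0 := by simpa using h0
    rw [measureReal_eq_zero_iff, Measure.measure_univ_eq_zero] at this
    exact hμ (Subtype.ext this)
  · intro t ht
    obtain ⟨g, hg⟩ := exists_continuous_inverse hS ht
    simp_rw [sum_integral_fourier_mul hμS hg]
    have hT := hR.mul_continuous g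
    have i1 : Tendsto (fun N : ℕ => (N : ℤ) + 1) atTop cofinite :=
      Nat.cofinite_eq_atTop ▸ Function.Injective.tendsto_cofinite
        (fun a b h => by simpa using h)
    have i2 : Tendsto (fun N : ℕ => -(N : ℤ)) atTop cofinite :=
      Nat.cofinite_eq_atTop ▸ Function.Injective.tendsto_cofinite
        (fun a b h => by simpa using h)
    have z : ∀ (u : ℕ → ℤ), Tendsto u atTop cofinite → Tendsto (fun N => fourier (u N) t *
        ∫ s, fourier (-(u N)) s * g s ∂(μ : Measure UnitAddCircle)) atTop (𝓝 0) := by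
      intro u hu
      rw [tendsto_zero_iff_norm_tendsto_zero]
      have := (tendsto_zero_iff_norm_tendsto_zero.1 (hT.comp hu))
      refine this.congr fun N => ?_
      rw [norm_mul, fourier_apply, Circle.norm_coe, one_mul]
      rfl
    simpa using (z _ i1).sub (z _ i2)

theorem isClosed_uncovered (ℓ : ℕ → ℝ) (x : ℕ → UnitAddCircle) : IsClosed (uncovered ℓ x) :=
  (isOpen_iUnion fun n => isOpen_arc (x n) (ℓ n)).isClosed_compl

theorem partialDensity_eq_zero_of_mem_arc {ℓ : ℕ → ℝ} (h : ∀ n, ℓ n < 1) {s : Finset ℕ}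
    {x : ℕ → UnitAddCircle} {t : UnitAddCircle} {k : ℕ} (hk : k ∈ s) (ht : t ∈ arc (x k) (ℓ k)) :
    partialDensity ℓ s x t = 0 :=
  Finset.prod_eq_zero hk (by rw [pf, if_pos ((mem_arc_iff (h k).le).1 ht)])

theorem approxMeasure_apply (ℓ : ℕ → ℝ) (h : ∀ n, ℓ n < 1) (x : ℕ → UnitAddCircle) (n : ℕ) :
    (approxMeasure ℓ x n : Measure UnitAddCircle) =
      volume.withDensity fun t => ENNReal.ofReal (partialDensity ℓ (Finset.range n) x t) := by
  simp_rw [← density_eq h]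
  rfl

/-- A weak limit of the measures `μₙ` is carried by the non-covered set. -/
theorem measure_compl_uncovered_eq_zero {ℓ : ℕ → ℝ} (h : ∀ n, ℓ n < 1) {x : ℕ → UnitAddCircle}
    {μ : FiniteMeasure UnitAddCircle} (hμ : Tendsto (approxMeasure ℓ x) atTop (𝓝 μ)) :
    (μ : Measure UnitAddCircle) (uncovered ℓ x)ᶜ = 0 := by
  rw [uncovered, compl_compl, measure_iUnion_null_iff]
  intro k
  have hopen := isOpen_arc (x k) (ℓ k)
  set U := arc (x k) (ℓ k)
  -- The distance to `Uᶜ` is continuous and positive exactly on `U`, provided that `Uᶜ` is nonempty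
  -- (the distance to the empty set is `0` by convention). An open arc omits its left endpoint.
  have hne : Uᶜ.Nonempty := ⟨x k, fun hx => by
    have := ((mem_arc_iff (h k).le).1 hx).1
    rw [sub_self, rep_zero] at this
    exact lt_irrefl _ this⟩
  let f : BoundedContinuousFunction UnitAddCircle ℝ :=
    BoundedContinuousFunction.mkOfCompact ⟨fun t => Metric.infDist t Uᶜ, by fun_prop⟩
  have hf : ∀ t, f t = Metric.infDist t Uᶜ := fun t => rfl
  have hlim := (FiniteMeasure.tendsto_iff_forall_integral_tendsto.1 hμ) f
  have hz : ∀ n, k < n → ∫ t, f t ∂(approxMeasure ℓ x n : Measure UnitAddCircle) = 0 := by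
    intro n hn
    refine integral_eq_zero_of_ae ?_
    have h0 : (approxMeasure ℓ x n : Measure UnitAddCircle) U = 0 := by
      rw [approxMeasure_apply ℓ h, withDensity_apply _ hopen.measurableSet]
      refine (setLIntegral_congr_fun hopen.measurableSet fun t ht => ?_).trans lintegral_zero
      rw [partialDensity_eq_zero_of_mem_arc h (Finset.mem_range.2 hn) ht, ENNReal.ofReal_zero]
    filter_upwards [measure_eq_zero_iff_ae_notMem.1 h0] with t ht
    exact (hf t).trans (Metric.infDist_zero_of_mem ht)
  have h0 : ∫ t, f t ∂(μ : Measure UnitAddCircle) = 0 := by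
    refine tendsto_nhds_unique hlim ?_
    refine tendsto_const_nhds.congr' ?_
    filter_upwards [eventually_gt_atTop k] with n hn using (hz n hn).symm
  have hf0 : 0 ≤ fun t => f t := fun t => Metric.infDist_nonneg
  rw [integral_eq_zero_iff_of_nonneg hf0 (f.integrable _)] at h0
  rw [measure_eq_zero_iff_ae_notMem]
  filter_upwards [h0] with t ht htU
  exact (hopen.isClosed_compl.mem_iff_infDist_zero hne).2 ht htU

end

/-! ### The martingale of integrals, and almost sure weak convergence. -/

section

theorem integrable_mul_partialDensity {ℓ : ℕ → ℝ} (h : ∀ n, ℓ n < 1) (s : Finset ℕ)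
    (f : C(UnitAddCircle, ℝ)) :
    Integrable (fun z : (ℕ → UnitAddCircle) × UnitAddCircle => f z.2 * partialDensity ℓ s z.1 z.2)
      (unifSeq.prod volume) := by
  refine Integrable.of_bound (C := ‖f‖ * ∏ k ∈ s, (1 / (1 - ℓ k))) ?_ (ae_of_all _ fun z => ?_)
  · exact ((f.continuous.measurable.comp measurable_snd).mul
      (measurable_partialDensity_uncurry ℓ s)).aestronglyMeasurable
  · rw [norm_mul, Real.norm_of_nonneg (partialDensity_nonneg h s z.1 z.2)]
    exact mul_le_mul (f.norm_coe_le_norm _) (partialDensity_le h s _ _)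
      (partialDensity_nonneg h s _ _) (norm_nonneg _)

theorem measurable_partialDensity (ℓ : ℕ → ℝ) (s : Finset ℕ) (x : ℕ → UnitAddCircle) :
    Measurable (partialDensity ℓ s x) :=
  Finset.measurable_prod s fun _ _ => (measurable_pf _).comp (measurable_id.sub measurable_const)

theorem integral_approxMeasure {ℓ : ℕ → ℝ} (h : ∀ n, ℓ n < 1) (x : ℕ → UnitAddCircle) (n : ℕ)
    {E : Type*} [NormedAddCommGroup E] [NormedSpace ℝ E] (f : UnitAddCircle → E) :
    ∫ t, f t ∂(approxMeasure ℓ x n : Measure UnitAddCircle) =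
      ∫ t, partialDensity ℓ (Finset.range n) x t • f t := by
  rw [approxMeasure_apply ℓ h, integral_withDensity_eq_integral_toReal_smul
    (measurable_partialDensity ℓ _ x).ennreal_ofReal (ae_of_all _ fun _ => ENNReal.ofReal_lt_top)]
  refine integral_congr_ae (ae_of_all _ fun t => ?_)
  simp only [ENNReal.toReal_ofReal (partialDensity_nonneg h _ x t)]

/-- Keep the first `n` coordinates of a sequence and replace the others by `0`. -/
def trunc (n : ℕ) (x : ℕ → UnitAddCircle) : ℕ → UnitAddCircle := fun k => if k < n then x k else 0

theorem measurable_trunc (n : ℕ) : Measurable (trunc n) :=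
  measurable_pi_iff.2 fun k => by
    unfold trunc
    split_ifs
    · exact measurable_pi_apply k
    · exact measurable_const

theorem trunc_update {n k : ℕ} (h : n ≤ k) (x : ℕ → UnitAddCircle) (u : UnitAddCircle) :
    trunc n (Function.update x k u) = trunc n x := by
  funext j
  unfold trunc
  split_ifs with hj
  · rw [Function.update_of_ne (by omega)]
  · rfl

theorem trunc_trunc {m n : ℕ} (h : m ≤ n) (x : ℕ → UnitAddCircle) :
    trunc m (trunc n x) = trunc m x := by
  funext j
  unfold trunc
  split_ifs <;> first | rfl | omega

theorem partialDensity_trunc {ℓ : ℕ → ℝ} {s : Finset ℕ} {n : ℕ} (hs : ∀ k ∈ s, k < n)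
    (x : ℕ → UnitAddCircle) (t : UnitAddCircle) :
    partialDensity ℓ s (trunc n x) t = partialDensity ℓ s x t :=
  Finset.prod_congr rfl fun k hk => by rw [trunc, if_pos (hs k hk)]

/-- The filtration generated by the coordinates. -/
def coordFiltration : Filtration ℕ (MeasurableSpace.pi : MeasurableSpace (ℕ → UnitAddCircle)) where
  seq n := MeasurableSpace.pi.comap (trunc n)
  mono' m n h := by
    have : trunc m = trunc m ∘ trunc n := funext fun x => (trunc_trunc h x).symm
    simp only
    rw [this, ← MeasurableSpace.comap_comp]
    exact MeasurableSpace.comap_mono (measurable_trunc m).comap_le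
  le' n := (measurable_trunc n).comap_le

theorem measurableSet_coordFiltration_update {n k : ℕ} (h : n ≤ k) {A : Set (ℕ → UnitAddCircle)}
    (hA : MeasurableSet[coordFiltration n] A) (x : ℕ → UnitAddCircle) (u : UnitAddCircle) :
    Function.update x k u ∈ A ↔ x ∈ A := by
  obtain ⟨B, -, rfl⟩ := hA
  rw [Set.mem_preimage, Set.mem_preimage, trunc_update h]

theorem lintegral_lintegral_partialDensity {ℓ : ℕ → ℝ} (h0 : ∀ n, 0 ≤ ℓ n) (h : ∀ n, ℓ n < 1)
    (s : Finset ℕ) :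
    ∫⁻ x, (∫⁻ t, ENNReal.ofReal (partialDensity ℓ s x t)) ∂unifSeq = 1 := by
  rw [lintegral_lintegral_swap (measurable_partialDensity_uncurry ℓ s).ennreal_ofReal.aemeasurable]
  have : ∀ t, ∫⁻ x, ENNReal.ofReal (partialDensity ℓ s x t) ∂unifSeq = 1 := fun t => by
    have := lintegral_mul_partialDensity h0 h s (fun _ => 1) measurable_const (by simp) t
    simpa using this
  simp [this]

/-- The integrals of a continuous function against the measures `μₙ` form a martingale. -/
theorem martingale_integral {ℓ : ℕ → ℝ} (h0 : ∀ n, 0 ≤ ℓ n) (h : ∀ n, ℓ n < 1)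
    (f : C(UnitAddCircle, ℝ)) :
    Martingale (fun n x => ∫ t, f t * partialDensity ℓ (Finset.range n) x t)
      coordFiltration unifSeq := by
  have hsm : ∀ n, StronglyMeasurable fun x : ℕ → UnitAddCircle =>
      ∫ t, f t * partialDensity ℓ (Finset.range n) x t := fun n =>
    StronglyMeasurable.integral_prod_right (f := fun x t => f t * partialDensity ℓ (Finset.range n) x t)
      ((f.continuous.measurable.comp measurable_snd).mul
        (measurable_partialDensity_uncurry ℓ _)).stronglyMeasurable
  refine martingale_of_setIntegral_eq_succ (fun n => ?_)
    (fun n => (integrable_mul_partialDensity h (Finset.range n) f).integral_prod_left) ?_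
  · have e : (fun x : ℕ → UnitAddCircle => ∫ t, f t * partialDensity ℓ (Finset.range n) x t) =
        (fun x => ∫ t, f t * partialDensity ℓ (Finset.range n) x t) ∘ trunc n := by
      funext x
      simp only [Function.comp]
      simp_rw [partialDensity_trunc (fun k hk => Finset.mem_range.1 hk) x]
    rw [e]
    exact (hsm n).comp_measurable (comap_measurable (trunc n))
  · intro n A hA
    have hAm : MeasurableSet A := coordFiltration.le n A hA
    have hF : Integrable (fun x => ∫ t, f t * partialDensity ℓ (Finset.range (n + 1)) x t) unifSeq :=
      (integrable_mul_partialDensity h (Finset.range (n + 1)) f).integral_prod_left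
    have hFA := hF.indicator hAm
    rw [← integral_indicator hAm, ← integral_indicator hAm]
    -- The event `A` does not depend on the coordinate `n`. Resampling this coordinate and averaging
    -- over its new value `u` replaces the last factor of the density by its mean `1`.
    have hmp := measurePreserving_update n
    have hFA' := (hmp.integrable_comp hFA.aestronglyMeasurable).2 hFA
    have hmap : ∀ F : (ℕ → UnitAddCircle) → ℝ, AEStronglyMeasurable F unifSeq →
        ∫ x, F x ∂unifSeq = ∫ z, F (Function.update z.1 n z.2) ∂(unifSeq.prod volume) := by
      intro F hF
      conv_lhs => rw [← hmp.map_eq]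
      exact integral_map hmp.measurable.aemeasurable (by rwa [hmp.map_eq])
    rw [hmap _ hFA.aestronglyMeasurable]
    refine Eq.trans ?_ (integral_prod _ hFA').symm
    refine integral_congr_ae (ae_of_all _ fun x => ?_)
    have hu : ∀ u, A.indicator (fun x => ∫ t, f t * partialDensity ℓ (Finset.range (n + 1)) x t)
        (Function.update x n u) = A.indicator (fun _ => (1 : ℝ)) x *
          ∫ t, f t * (partialDensity ℓ (Finset.range n) x t * pf (ℓ n) (t - u)) := by
      intro u
      have e : ∀ t, partialDensity ℓ (Finset.range (n + 1)) (Function.update x n u) t =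
          partialDensity ℓ (Finset.range n) x t * pf (ℓ n) (t - u) := fun t => by
        have e' := partialDensity_update (ℓ := ℓ) (s := Finset.range n) (k := n) (by simp) x u t
        rw [← e', partialDensity, Finset.prod_range_succ, Function.update_self]
        rfl
      by_cases hx : x ∈ A
      · rw [Set.indicator_of_mem ((measurableSet_coordFiltration_update le_rfl hA x u).2 hx),
          Set.indicator_of_mem hx, one_mul]
        simp_rw [e]
      · rw [Set.indicator_of_notMem
          (fun h' => hx ((measurableSet_coordFiltration_update le_rfl hA x u).1 h')),
          Set.indicator_of_notMem hx, zero_mul]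
    simp only [Function.comp]
    simp_rw [hu]
    rw [integral_const_mul, integral_integral_swap]
    · have : ∀ t, ∫ u, f t * (partialDensity ℓ (Finset.range n) x t * pf (ℓ n) (t - u)) =
          f t * partialDensity ℓ (Finset.range n) x t := fun t => by
        simp_rw [← mul_assoc]
        rw [integral_const_mul, integral_pf_const_sub (h0 n) (h n), mul_one]
      simp_rw [this]
      by_cases hx : x ∈ A <;> simp [hx]
    · refine Integrable.of_bound
        (C := ‖f‖ * ((∏ k ∈ Finset.range n, (1 / (1 - ℓ k))) * (1 / (1 - ℓ n)))) ?_
        (ae_of_all _ fun z => ?_)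
      · refine Measurable.aestronglyMeasurable ?_
        exact (f.continuous.measurable.comp measurable_snd).mul
          (((measurable_partialDensity ℓ _ x).comp measurable_snd).mul
            ((measurable_pf _).comp (measurable_snd.sub measurable_fst)))
      · have p1 := partialDensity_nonneg h (Finset.range n) x z.2
        have p2 := pf_nonneg (h n) (z.2 - z.1)
        simp only [Function.uncurry]
        rw [norm_mul, Real.norm_of_nonneg (mul_nonneg p1 p2)]
        have p3 := partialDensity_le h (Finset.range n) x z.2
        exact mul_le_mul (f.norm_coe_le_norm _) (mul_le_mul p3 (pf_le (h n) _) p2 (p1.trans p3))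
          (mul_nonneg p1 p2) (norm_nonneg _)

/-- Martingale convergence: the densities are nonnegative with mean one, so the martingale is
bounded in `L¹` by the sup norm of `f`. -/
theorem ae_exists_tendsto_integral {ℓ : ℕ → ℝ} (h0 : ∀ n, 0 ≤ ℓ n) (h : ∀ n, ℓ n < 1)
    (f : C(UnitAddCircle, ℝ)) :
    ∀ᵐ x ∂unifSeq, ∃ c, Tendsto (fun n => ∫ t, f t * partialDensity ℓ (Finset.range n) x t)
      atTop (𝓝 c) := by
  have hbdd : ∀ n, eLpNorm (fun x => ∫ t, f t * partialDensity ℓ (Finset.range n) x t) 1 unifSeq ≤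
      (‖f‖₊ : ℝ≥0∞) := by
    intro n
    rw [eLpNorm_one_eq_lintegral_enorm]
    calc ∫⁻ x, ‖∫ t, f t * partialDensity ℓ (Finset.range n) x t‖ₑ ∂unifSeq
        ≤ ∫⁻ x, (∫⁻ t, (‖f‖₊ : ℝ≥0∞) * ENNReal.ofReal (partialDensity ℓ (Finset.range n) x t))
            ∂unifSeq := by
          refine lintegral_mono fun x => (enorm_integral_le_lintegral_enorm _).trans
            (lintegral_mono fun t => ?_)
          rw [enorm_mul, Real.enorm_of_nonneg (partialDensity_nonneg h _ x t)]
          gcongr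
          have := f.norm_coe_le_norm t
          exact ENNReal.coe_le_coe.2 this
      _ = (‖f‖₊ : ℝ≥0∞) * ∫⁻ x, (∫⁻ t, ENNReal.ofReal (partialDensity ℓ (Finset.range n) x t))
            ∂unifSeq := by
          simp_rw [lintegral_const_mul _ ((measurable_partialDensity ℓ _ _).ennreal_ofReal)]
          rw [lintegral_const_mul]
          exact (measurable_partialDensity_uncurry ℓ _).ennreal_ofReal.lintegral_prod_right
      _ = _ := by rw [lintegral_lintegral_partialDensity h0 h, mul_one]
  exact (martingale_integral h0 h f).submartingale.exists_ae_tendsto_of_bdd hbdd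

theorem continuous_integral_continuousMap (μ : Measure UnitAddCircle) [IsFiniteMeasure μ] :
    Continuous fun f : C(UnitAddCircle, ℝ) => ∫ t, f t ∂μ := by
  have hi : ∀ f : C(UnitAddCircle, ℝ), Integrable (fun t => f t) μ := fun f =>
    Integrable.of_bound f.continuous.aestronglyMeasurable ‖f‖
      (ae_of_all _ fun s => f.norm_coe_le_norm s)
  refine (LipschitzWith.of_dist_le_mul (K := (μ.real Set.univ).toNNReal) fun f g => ?_).continuous
  rw [dist_eq_norm, ← integral_sub (hi f) (hi g), Real.coe_toNNReal _ measureReal_nonneg, mul_comm]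
  refine norm_integral_le_of_norm_le_const (ae_of_all _ fun t => ?_)
  rw [← dist_eq_norm]
  exact ContinuousMap.dist_apply_le_dist t

/-- A sequence of finite measures on the circle converges weakly as soon as the integrals of the
members of a dense sequence of continuous functions, and of the constant `1`, converge. -/
theorem exists_tendsto_finiteMeasure {μ : ℕ → FiniteMeasure UnitAddCircle}
    (hμ : ∀ i, ∃ c, Tendsto (fun n => ∫ t, TopologicalSpace.denseSeq C(UnitAddCircle, ℝ) i t
      ∂(μ n : Measure UnitAddCircle)) atTop (𝓝 c))
    (h1 : ∃ c, Tendsto (fun n => (μ n : Measure UnitAddCircle).real Set.univ) atTop (𝓝 c)) :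
    ∃ ν, Tendsto μ atTop (𝓝 ν) := by
  obtain ⟨c, hc⟩ := h1
  obtain ⟨b, hb⟩ := hc.bddAbove_range
  have hmass : ∀ n, μ n ∈ {ν : FiniteMeasure UnitAddCircle | ν.mass ≤ b.toNNReal} := by
    intro n
    have : (μ n : Measure UnitAddCircle).real Set.univ ≤ b := hb ⟨n, rfl⟩
    exact NNReal.le_toNNReal_of_coe_le this
  have hK := isCompact_setOfPred_finiteMeasure_le_of_compactSpace UnitAddCircle b.toNNReal
  choose L hL using hμ
  -- All cluster points give the same integrals to the dense functions, hence to all continuous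
  -- functions; in a compact set, uniqueness of the cluster point gives convergence.
  have hcl : ∀ ν, MapClusterPt ν atTop μ → ∀ i,
      ∫ t, TopologicalSpace.denseSeq C(UnitAddCircle, ℝ) i t ∂(ν : Measure UnitAddCircle) = L i := by
    intro ν hν i
    set g := TopologicalSpace.denseSeq C(UnitAddCircle, ℝ) i
    have hcont : Continuous fun ν : FiniteMeasure UnitAddCircle =>
        ∫ t, g t ∂(ν : Measure UnitAddCircle) := by
      rw [continuous_iff_continuousAt]
      intro ν
      exact (FiniteMeasure.tendsto_iff_forall_integral_tendsto.1 tendsto_id)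
        (BoundedContinuousFunction.mkOfCompact g)
    have := hν.continuousAt_comp hcont.continuousAt
    obtain ⟨φ, hφ, hφ'⟩ := this.tendsto_subseq
    exact tendsto_nhds_unique hφ' ((hL i).comp hφ.tendsto_atTop)
  obtain ⟨ν, -, hν⟩ := hK.exists_mapClusterPt (f := atTop) (u := μ)
    (tendsto_principal.2 (Eventually.of_forall hmass))
  refine ⟨ν, hK.tendsto_nhds_of_unique_mapClusterPt (univ_mem' hmass) fun ν' _ hν' => ?_⟩
  refine FiniteMeasure.ext_of_forall_integral_eq fun f => ?_
  have heq := (TopologicalSpace.denseRange_denseSeq C(UnitAddCircle, ℝ)).equalizer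
    (continuous_integral_continuousMap (ν' : Measure UnitAddCircle))
    (continuous_integral_continuousMap (ν : Measure UnitAddCircle))
    (funext fun i => (hcl ν' hν' i).trans (hcl ν hν i).symm)
  exact congrFun heq f.toContinuousMap

theorem ae_exists_tendsto_approxMeasure {ℓ : ℕ → ℝ} (h0 : ∀ n, 0 ≤ ℓ n) (h : ∀ n, ℓ n < 1) :
    ∀ᵐ x ∂unifSeq, ∃ ν, Tendsto (approxMeasure ℓ x) atTop (𝓝 ν) := by
  filter_upwards [ae_all_iff.2 fun i => ae_exists_tendsto_integral h0 h
    (TopologicalSpace.denseSeq C(UnitAddCircle, ℝ) i), ae_exists_tendsto_integral h0 h 1]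
    with x hx hx1
  have e : ∀ (f : UnitAddCircle → ℝ) n, ∫ t, f t * partialDensity ℓ (Finset.range n) x t =
      ∫ t, f t ∂(approxMeasure ℓ x n : Measure UnitAddCircle) := fun f n => by
    rw [integral_approxMeasure h]
    simp_rw [smul_eq_mul, mul_comm]
  refine exists_tendsto_finiteMeasure (fun i => ?_) ?_
  · simpa only [e] using hx i
  · obtain ⟨c, hc⟩ := hx1
    refine ⟨c, hc.congr fun n => ?_⟩
    rw [e]
    simp

end

/-! ### Mixed moments of several points and chains of correlations. -/

section

/-- By `hconv` the indices with `b = 1` form a block. A nonempty block has one more element than it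
has consecutive pairs, so the right-hand side is `0`; for an empty block it is `1`. -/
theorem prod_one_sub_eq {N : ℕ} (b : Fin (N + 1) → ℝ) (hb : ∀ i, b i = 0 ∨ b i = 1)
    (hconv : ∀ i j k, i ≤ j → j ≤ k → b i = 1 → b k = 1 → b j = 1) :
    ∏ i, (1 - b i) = 1 - ∑ i, b i + ∑ j : Fin N, b j.castSucc * b j.succ := by
  induction N with
  | zero => simp
  | succ N ih =>
    have ih' := ih (fun i => b i.castSucc) (fun i => hb _) (fun i j k hij hjk =>
      hconv _ _ _ (Fin.castSucc_le_castSucc_iff.2 hij) (Fin.castSucc_le_castSucc_iff.2 hjk))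
    have key : b (Fin.last (N + 1)) * ∏ i : Fin (N + 1), (1 - b i.castSucc) =
        b (Fin.last (N + 1)) * (1 - b (Fin.last N).castSucc) := by
      rcases hb (Fin.last (N + 1)) with h | h
      · rw [h, zero_mul, zero_mul]
      · rcases hb (Fin.last N).castSucc with h' | h'
        · rw [h', Finset.prod_eq_one, sub_zero]
          intro i _
          rcases hb i.castSucc with h'' | h''
          · rw [h'', sub_zero]
          · have := hconv i.castSucc (Fin.last N).castSucc (Fin.last (N + 1))
              (Fin.castSucc_le_castSucc_iff.2 (Fin.le_last i)) (Fin.le_last _) h'' h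
            rw [h'] at this
            exact absurd this zero_ne_one
        · rw [Finset.prod_eq_zero (Finset.mem_univ (Fin.last N)) (by rw [h', sub_self]), h',
            sub_self]
    have e1 : ∑ j : Fin (N + 1), b j.castSucc * b j.succ =
        ∑ j : Fin N, b j.castSucc.castSucc * b j.succ.castSucc +
          b (Fin.last N).castSucc * b (Fin.last (N + 1)) := by
      rw [Fin.sum_univ_castSucc, Fin.succ_last]
      rfl
    rw [Fin.prod_univ_castSucc, Fin.sum_univ_castSucc (n := N + 1), e1, mul_sub, mul_one,
      mul_comm _ (b (Fin.last (N + 1))), key, ih']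
    ring

/-- Among `N + 2` arcs of equal length that partition the circle, one contains none of `N + 1`
given points. -/
theorem exists_cut {N : ℕ} (t : Fin (N + 1) → UnitAddCircle) :
    ∃ c : UnitAddCircle, ∀ i, 1 / ((N : ℝ) + 2) ≤ rep (t i - c) := by
  have hpos : (0 : ℝ) < (N : ℝ) + 2 := by positivity
  have hlt : ∀ i, ⌊((N : ℝ) + 2) * rep (t i)⌋₊ < N + 2 := by
    intro i
    rw [Nat.floor_lt (mul_nonneg hpos.le (rep_nonneg _))]
    push_cast
    nlinarith [rep_lt_one (t i)]
  let g : Fin (N + 1) → Fin (N + 2) := fun i => ⟨_, hlt i⟩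
  have hg : ¬ Function.Surjective g := fun h => by
    have := Fintype.card_le_of_surjective g h
    simp at this
  simp only [Function.Surjective, not_forall, not_exists] at hg
  obtain ⟨j, hj⟩ := hg
  have hj1 : (j : ℝ) + 1 ≤ (N : ℝ) + 2 := by exact_mod_cast j.2
  -- The cut is the left end of an arc of the partition that contains no point, which exists by the
  -- pigeonhole principle.
  refine ⟨((j / ((N : ℝ) + 2) : ℝ) : UnitAddCircle), fun i => ?_⟩
  by_contra hlt'
  push Not at hlt'
  refine hj i (Fin.ext ?_)
  change ⌊((N : ℝ) + 2) * rep (t i)⌋₊ = j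
  set v := rep (t i - ((j / ((N : ℝ) + 2) : ℝ) : UnitAddCircle)) with hv
  have hv0 : 0 ≤ v := rep_nonneg _
  rw [lt_div_iff₀ hpos] at hlt'
  have e : rep (t i) = j / ((N : ℝ) + 2) + v := by
    refine rep_eq_of_coe_eq ?_ (by positivity) ?_
    · rw [AddCircle.coe_add, hv, coe_rep]; abel
    · rw [div_add' _ _ _ hpos.ne', div_lt_one hpos]; linarith
  rw [e, mul_add, mul_div_cancel₀ _ hpos.ne', Nat.floor_eq_iff (by positivity)]
  constructor <;> nlinarith

theorem integral_indicator_arc0_sub {r : ℝ} (h0 : 0 ≤ r) (h1 : r ≤ 1) (t : UnitAddCircle) :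
    ∫ u, {u : UnitAddCircle | 0 < rep u ∧ rep u < r}.indicator (fun _ => (1 : ℝ)) (t - u) = r := by
  rw [integral_sub_left_eq_self
    ({u : UnitAddCircle | 0 < rep u ∧ rep u < r}.indicator (fun _ => (1 : ℝ))) volume t,
    integral_indicator_const _ (measurableSet_arc0 r), volume_real_arc0 h0 h1, smul_eq_mul, mul_one]

theorem integral_indicator_arc0_sub_mul {r : ℝ} (h1 : r ≤ 1 / 2) (s t : UnitAddCircle) :
    ∫ u, {u : UnitAddCircle | 0 < rep u ∧ rep u < r}.indicator (fun _ => (1 : ℝ)) (s - u) *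
      {u : UnitAddCircle | 0 < rep u ∧ rep u < r}.indicator (fun _ => (1 : ℝ)) (t - u) =
      max 0 (r - ‖t - s‖) := by
  set A := {u : UnitAddCircle | 0 < rep u ∧ rep u < r} with hA
  have hAm : MeasurableSet A := measurableSet_arc0 r
  set A' := {u : UnitAddCircle | 0 < rep (u + (t - s)) ∧ rep (u + (t - s)) < r} with hA'
  have hAm' : MeasurableSet A' := (measurable_add_const (t - s)) hAm
  rw [← volume_real_overlap h1, ← hA, ← hA']
  have e : ∀ u, A.indicator (fun _ => (1 : ℝ)) (s - u) * A.indicator (fun _ => (1 : ℝ)) (t - u) =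
      (A ∩ A').indicator (fun _ => (1 : ℝ)) (s - u) := by
    intro u
    have e1 : A.indicator (fun _ => (1 : ℝ)) (t - u) = A'.indicator (fun _ => (1 : ℝ)) (s - u) := by
      change A.indicator (fun _ => (1 : ℝ)) (t - u) =
        A.indicator (fun _ => (1 : ℝ)) (s - u + (t - s))
      congr 1; abel
    rw [e1]
    by_cases h : s - u ∈ A <;> by_cases h' : s - u ∈ A' <;> simp [h, h']
  simp_rw [e]
  rw [integral_sub_left_eq_self ((A ∩ A').indicator (fun _ => (1 : ℝ))) volume s,
    integral_indicator_const _ (hAm.inter hAm'), smul_eq_mul, mul_one]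

/-- The mixed moments of `N + 1` points are controlled by the correlations of consecutive points,
for some ordering of the points that does not depend on the length of the arcs. -/
theorem exists_perm_mixedMoment_le {N : ℕ} (t : Fin (N + 1) → UnitAddCircle) :
    ∃ σ : Equiv.Perm (Fin (N + 1)), ∀ r : ℝ, 0 ≤ r → r ≤ 1 / (4 * ((N : ℝ) + 2)) →
      mixedMoment r t ≤ Real.exp (6 * ((N : ℝ) + 1) * r ^ 2) *
        ∏ j : Fin N, corr r (t (σ j.succ) - t (σ j.castSucc)) := by
  obtain ⟨c, hc⟩ := exists_cut t
  set y : Fin (N + 1) → ℝ := fun i => rep (t i - c) with hy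
  refine ⟨Tuple.sort y, fun r h0 hr => ?_⟩
  have hmono : Monotone (y ∘ Tuple.sort y) := Tuple.monotone_sort y
  set σ := Tuple.sort y
  have hN : (0 : ℝ) < (N : ℝ) + 2 := by positivity
  have hr4 : r ≤ 1 / 4 := hr.trans (by
    rw [div_le_div_iff₀ (by positivity) (by norm_num)]
    nlinarith [(Nat.cast_nonneg N : (0 : ℝ) ≤ N)])
  have hrN : r ≤ 1 / ((N : ℝ) + 2) := hr.trans (by
    rw [div_le_div_iff₀ (by positivity) hN]; linarith)
  set A := {u : UnitAddCircle | 0 < rep u ∧ rep u < r} with hA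
  have hAm : MeasurableSet A := measurableSet_arc0 r
  set B : Fin (N + 1) → UnitAddCircle → ℝ := fun i u => A.indicator (fun _ => (1 : ℝ)) (t i - u)
    with hB
  have hBm : ∀ i, Measurable (B i) := fun i =>
    (measurable_const.indicator hAm).comp (measurable_const.sub measurable_id)
  have hB01 : ∀ i u, B i u = 0 ∨ B i u = 1 := fun i u => by
    by_cases h : t i - u ∈ A
    · right; simp [hB, h]
    · left; simp [hB, h]
  have hBb : ∀ i u, ‖B i u‖ ≤ 1 := fun i u => by
    rcases hB01 i u with h | h <;> simp [h]
  have hBi : ∀ i, Integrable (B i) volume := fun i =>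
    Integrable.of_bound (hBm i).aestronglyMeasurable 1 (ae_of_all _ (hBb i))
  have hBBi : ∀ i j, Integrable (fun u => B i u * B j u) volume := fun i j =>
    Integrable.of_bound ((hBm i).mul (hBm j)).aestronglyMeasurable 1 (ae_of_all _ fun u => by
      rw [norm_mul]; exact mul_le_one₀ (hBb i u) (norm_nonneg _) (hBb j u))
  -- Every point is at distance at least `1 / (N + 2) ≥ r` after the cut `c`. The arc of length `r`
  -- that ends at the point therefore does not cross the cut, and the condition becomes one about
  -- real intervals.
  have hBiff : ∀ i u, B i u = 1 ↔ y i - r < rep (u - c) ∧ rep (u - c) < y i := by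
    intro i u
    have h1 : B i u = 1 ↔ t i - u ∈ A := by
      by_cases h : t i - u ∈ A <;> simp [hB, h]
    rw [h1, hA, Set.mem_ofPred_eq, show t i - u = (t i - c) - (u - c) by abel, rep_sub]
    have h2 := hc i
    have h3 := rep_lt_one (u - c)
    have h4 := rep_nonneg (u - c)
    change 1 / ((N : ℝ) + 2) ≤ y i at h2
    change 0 < (if rep (u - c) ≤ y i then y i - rep (u - c) else y i - rep (u - c) + 1) ∧
      (if rep (u - c) ≤ y i then y i - rep (u - c) else y i - rep (u - c) + 1) < r ↔ _
    split_ifs with h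
    · constructor <;> rintro ⟨a, b⟩ <;> constructor <;> linarith
    · constructor
      · rintro ⟨a, b⟩; linarith
      · rintro ⟨a, b⟩; exact absurd b.le h
  have hid : ∀ u, ∏ i, pf r (t i - u) = (1 - ∑ i, B i u +
      ∑ j : Fin N, B (σ j.castSucc) u * B (σ j.succ) u) / (1 - r) ^ (N + 1) := by
    intro u
    have e1 : ∏ i, pf r (t i - u) = (∏ i, (1 - B i u)) / (1 - r) ^ (N + 1) := by
      simp_rw [pf_eq]
      rw [Finset.prod_div_distrib]
      simp [hB, hA]
    rw [e1, ← Equiv.prod_comp σ, ← Equiv.sum_comp σ (fun i => B i u),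
      prod_one_sub_eq (fun i => B (σ i) u) (fun i => hB01 _ u)]
    -- The points with `B = 1` are those whose coordinate lies in an interval of length `r` starting
    -- at `rep (u - c)`; in sorted order they form a block.
    intro i j k hij hjk hi hk
    rw [hBiff] at hi hk ⊢
    have m1 : y (σ i) ≤ y (σ j) := hmono hij
    have m2 : y (σ j) ≤ y (σ k) := hmono hjk
    exact ⟨by linarith, by linarith⟩
  have hmm : mixedMoment r t = (1 - ((N : ℝ) + 1) * r +
      ∑ j : Fin N, max 0 (r - ‖t (σ j.succ) - t (σ j.castSucc)‖)) / (1 - r) ^ (N + 1) := by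
    rw [mixedMoment]
    simp_rw [hid]
    have i1 : Integrable (fun u => 1 - ∑ i, B i u) volume :=
      (integrable_const _).sub (integrable_finsetSum _ fun i _ => hBi i)
    have i2 : Integrable (fun u => ∑ j : Fin N, B (σ j.castSucc) u * B (σ j.succ) u) volume :=
      integrable_finsetSum _ fun j _ => hBBi _ _
    rw [integral_div, integral_add i1 i2, integral_sub (integrable_const _)
      (integrable_finsetSum _ fun i _ => hBi i), integral_finsetSum _ (fun i _ => hBi i),
      integral_finsetSum _ (fun j _ => hBBi _ _)]
    have s1 : ∀ i, ∫ u, B i u = r := fun i =>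
      integral_indicator_arc0_sub h0 (by linarith : r ≤ 1) (t i)
    have s2 : ∀ i j, ∫ u, B i u * B j u = max 0 (r - ‖t j - t i‖) := fun i j =>
      integral_indicator_arc0_sub_mul (by linarith) _ _
    simp_rw [s1, s2]
    simp
  set a : Fin N → ℝ := fun j => max 0 (r - ‖t (σ j.succ) - t (σ j.castSucc)‖) with ha
  rw [hmm]
  have hp : 0 < 1 - r := by linarith
  have b1 : 1 - ((N : ℝ) + 1) * r + ∑ j, a j ≤ Real.exp (∑ j, a j - ((N : ℝ) + 1) * r) := by
    have := Real.add_one_le_exp (∑ j, a j - ((N : ℝ) + 1) * r); linarith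
  have b2 : Real.exp (∑ j, a j - N * (4 * r ^ 2)) ≤
      ∏ j : Fin N, corr r (t (σ j.succ) - t (σ j.castSucc)) := by
    have e : ∑ j, a j - N * (4 * r ^ 2) = ∑ j : Fin N, (a j - 4 * r ^ 2) := by
      rw [Finset.sum_sub_distrib]; simp
    rw [e, Real.exp_sum]
    exact Finset.prod_le_prod (fun _ _ => (Real.exp_pos _).le) fun j _ => le_corr h0 hr4 _
  calc (1 - ((N : ℝ) + 1) * r + ∑ j, a j) / (1 - r) ^ (N + 1)
      = (1 - ((N : ℝ) + 1) * r + ∑ j, a j) * (1 / (1 - r) ^ (N + 1)) := by ring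
    _ ≤ Real.exp (∑ j, a j - ((N : ℝ) + 1) * r) *
        Real.exp (((N + 1 : ℕ) : ℝ) * (r + 2 * r ^ 2)) := by
        gcongr
        exact one_div_one_sub_pow_le h0 hr4 (N + 1)
    -- The first-order terms cancel. The left side has an error `2 (N + 1) r²` and the lower bounds
    -- for the correlations cost `4 N r²`; the total is at most `6 (N + 1) r²`.
    _ ≤ Real.exp (6 * ((N : ℝ) + 1) * r ^ 2) * Real.exp (∑ j, a j - N * (4 * r ^ 2)) := by
        rw [← Real.exp_add, ← Real.exp_add]
        apply Real.exp_le_exp.2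
        push_cast
        nlinarith [sq_nonneg r]
    _ ≤ _ := by gcongr

end

/-! ### Fourier analysis in the increments, and coefficients of the correlation product. -/

section

theorem fourier_finset_sum {ι : Type*} (s : Finset ι) (n : ℤ) (g : ι → UnitAddCircle) :
    fourier n (∑ i ∈ s, g i) = ∏ i ∈ s, fourier n (g i) := by
  classical
  induction s using Finset.induction_on with
  | empty => simp
  | insert a s ha ih =>
    rw [Finset.sum_insert ha, Finset.prod_insert ha, ← ih]
    simp only [fourier_apply, smul_add, AddCircle.toCircle_add]
    push_cast
    rfl

theorem fourier_sum_index {ι : Type*} (s : Finset ι) (a : ι → ℤ) (t : UnitAddCircle) :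
    fourier (∑ i ∈ s, a i) t = ∏ i ∈ s, fourier (a i) t := by
  classical
  induction s using Finset.induction_on with
  | empty => simp
  | insert b s hb ih => rw [Finset.sum_insert hb, Finset.prod_insert hb, ← ih, fourier_add]

theorem measurable_fourier (n : ℤ) : Measurable fun t : UnitAddCircle => fourier n t :=
  (fourier n).continuous.measurable

/-- The partial sums of a sequence of increments. -/
def partialSums (N : ℕ) : (Fin (N + 1) → UnitAddCircle) →+ (Fin (N + 1) → UnitAddCircle) where
  toFun g i := ∑ j ∈ Finset.Iic i, g j
  map_zero' := by funext i; simp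
  map_add' g g' := by funext i; simp [Finset.sum_add_distrib]

theorem partialSums_apply {N : ℕ} (g : Fin (N + 1) → UnitAddCircle) (i : Fin (N + 1)) :
    partialSums N g i = ∑ j ∈ Finset.Iic i, g j := rfl

theorem partialSums_succ {N : ℕ} (g : Fin (N + 1) → UnitAddCircle) (j : Fin N) :
    partialSums N g j.succ = partialSums N g j.castSucc + g j.succ := by
  have e : Finset.Iic j.succ = insert j.succ (Finset.Iic j.castSucc) := by
    ext i
    simp only [Finset.mem_Iic, Finset.mem_insert, Fin.le_def, Fin.ext_iff, Fin.val_succ,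
      Fin.val_castSucc]
    omega
  rw [partialSums_apply, e, Finset.sum_insert (by simp), add_comm]
  rfl

/-- Passing from increments to points is a continuous surjective endomorphism of a compact group, so
it preserves Haar measure: the increments of independent uniform points are again independent and
uniform. -/
theorem measurePreserving_partialSums (N : ℕ) :
    MeasurePreserving (partialSums N) volume volume := by
  refine AddMonoidHom.measurePreserving ?_ ?_ rfl
  · refine continuous_pi fun i => ?_
    simp only [partialSums_apply]
    exact continuous_finsetSum _ fun j _ => continuous_apply j
  · intro x
    refine ⟨Fin.cons (x 0) (fun j => x j.succ - x j.castSucc), funext fun i => ?_⟩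
    induction i using Fin.induction with
    | zero =>
      rw [partialSums_apply]
      have : Finset.Iic (0 : Fin (N + 1)) = {0} := by
        ext i; simp
      rw [this, Finset.sum_singleton, Fin.cons_zero]
    | succ j ih => rw [partialSums_succ, ih, Fin.cons_succ]; abel

/-- Integration of a product of functions of the increments against a character. -/
theorem integral_prod_increments {N : ℕ} {h : UnitAddCircle → ℂ} (hm : Measurable h)
    (a : Fin (N + 1) → ℤ) (ha : ∑ i, a i = 0) :
    ∫ t : Fin (N + 1) → UnitAddCircle,
      (∏ j : Fin N, h (t j.succ - t j.castSucc)) * ∏ i, fourier (a i) (t i) =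
      ∏ j : Fin N, ∫ u, h u * fourier (∑ i ∈ Finset.Ici j.succ, a i) u := by
  have hmp := measurePreserving_partialSums N
  have hF : Measurable fun t : Fin (N + 1) → UnitAddCircle =>
      (∏ j : Fin N, h (t j.succ - t j.castSucc)) * ∏ i, fourier (a i) (t i) := by
    have h1 : ∀ j : Fin N, Measurable fun t : Fin (N + 1) → UnitAddCircle =>
        h (t j.succ - t j.castSucc) := fun j =>
      hm.comp ((measurable_pi_apply j.succ).sub (measurable_pi_apply j.castSucc))
    have h2 : ∀ i, Measurable fun t : Fin (N + 1) → UnitAddCircle => fourier (a i) (t i) :=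
      fun i => (measurable_fourier (a i)).comp (measurable_pi_apply i)
    exact (Finset.measurable_prod _ fun j _ => h1 j).mul (Finset.measurable_prod _ fun i _ => h2 i)
  have hφ : ∀ g : Fin (N + 1) → UnitAddCircle,
      (∏ j : Fin N, h (partialSums N g j.succ - partialSums N g j.castSucc)) *
        ∏ i, fourier (a i) (partialSums N g i) =
      ∏ j : Fin (N + 1), (Fin.cons (fun _ => (1 : ℂ)) (fun j : Fin N => fun u =>
        h u * fourier (∑ i ∈ Finset.Ici j.succ, a i) u) : Fin (N + 1) → UnitAddCircle → ℂ)
          j (g j) := by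
    intro g
    -- Summation by parts: the increment `j` carries the tail sum of the frequencies from `j` on.
    -- The tail from `0` vanishes by `ha`, so the first increment integrates to `1`.
    have e1 : ∏ i, fourier (a i) (partialSums N g i) =
        ∏ j, fourier (∑ i ∈ Finset.Ici j, a i) (g j) := by
      simp_rw [partialSums_apply, fourier_finset_sum, fourier_sum_index]
      exact Finset.prod_comm' (by simp)
    have e2 : Finset.Ici (0 : Fin (N + 1)) = Finset.univ := by ext; simp
    rw [e1, Fin.prod_univ_succ, Fin.prod_univ_succ, e2, ha, fourier_zero]
    simp only [Fin.cons_zero, Fin.cons_succ, one_mul]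
    rw [← Finset.prod_mul_distrib]
    refine Finset.prod_congr rfl fun j _ => ?_
    rw [partialSums_succ, add_sub_cancel_left]
  have e3 : ∫ t : Fin (N + 1) → UnitAddCircle,
      (∏ j : Fin N, h (t j.succ - t j.castSucc)) * ∏ i, fourier (a i) (t i) =
      ∫ g : Fin (N + 1) → UnitAddCircle,
        (∏ j : Fin N, h (partialSums N g j.succ - partialSums N g j.castSucc)) *
        ∏ i, fourier (a i) (partialSums N g i) := by
    conv_lhs => rw [← hmp.map_eq]
    exact integral_map hmp.measurable.aemeasurable hF.aestronglyMeasurable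
  rw [e3]
  simp_rw [hφ]
  rw [integral_fintype_prod_volume_eq_prod, Fin.prod_univ_succ]
  simp

theorem measurable_partialDensity_left (ℓ : ℕ → ℝ) (s : Finset ℕ) (t : UnitAddCircle) :
    Measurable fun x => partialDensity ℓ s x t :=
  Finset.measurable_prod s fun k _ =>
    (measurable_pf _).comp (measurable_const.sub (measurable_pi_apply k))

theorem integral_prod_partialDensity {ι : Type*} [Fintype ι] {ℓ : ℕ → ℝ} (h : ∀ n, ℓ n < 1)
    (s : Finset ℕ) (t : ι → UnitAddCircle) :
    ∫ x, ∏ i, partialDensity ℓ s x (t i) ∂unifSeq = ∏ k ∈ s, mixedMoment (ℓ k) t := by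
  rw [integral_eq_lintegral_of_nonneg_ae]
  · have := lintegral_mul_prod_partialDensity h s (fun _ => 1) measurable_const (by simp) t
    simp only [one_mul, lintegral_const, measure_univ] at this
    rw [this, ENNReal.toReal_ofReal]
    exact Finset.prod_nonneg fun k _ => mixedMoment_nonneg (h k) t
  · exact ae_of_all _ fun x => Finset.prod_nonneg fun i _ => partialDensity_nonneg h s x (t i)
  · exact (Finset.measurable_prod _ fun i _ =>
      measurable_partialDensity_left ℓ s (t i)).aestronglyMeasurable

/-- The mixed moments of the Fourier coefficients of the random densities. -/
theorem integral_prod_fourier_partialDensity {ι : Type*} [Fintype ι] {ℓ : ℕ → ℝ}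
    (h : ∀ n, ℓ n < 1) (s : Finset ℕ) (a : ι → ℤ) :
    ∫ x, ∏ i, (∫ t, (partialDensity ℓ s x t : ℂ) * fourier (a i) t) ∂unifSeq =
      ∫ t : ι → UnitAddCircle,
        ((∏ k ∈ s, mixedMoment (ℓ k) t : ℝ) : ℂ) * ∏ i, fourier (a i) (t i) := by
  have e1 : ∀ x, ∏ i, (∫ t, (partialDensity ℓ s x t : ℂ) * fourier (a i) t) =
      ∫ t : ι → UnitAddCircle,
        ∏ i, ((partialDensity ℓ s x (t i) : ℂ) * fourier (a i) (t i)) := fun x =>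
    (integral_fintype_prod_volume_eq_prod (fun (i : ι) (t : UnitAddCircle) =>
      (partialDensity ℓ s x t : ℂ) * fourier (a i) t)).symm
  simp_rw [e1]
  rw [integral_integral_swap]
  · refine integral_congr_ae (ae_of_all _ fun t => ?_)
    simp only
    simp_rw [Finset.prod_mul_distrib]
    rw [integral_mul_const, ← integral_prod_partialDensity h s t, ← integral_complex_ofReal]
    simp
  · refine Integrable.of_bound (C := ∏ _ : ι, ∏ k ∈ s, (1 / (1 - ℓ k))) ?_ (ae_of_all _ fun z => ?_)
    · have h1 : ∀ i, Measurable fun z : (ℕ → UnitAddCircle) × (ι → UnitAddCircle) =>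
          (partialDensity ℓ s z.1 (z.2 i) : ℂ) := by
        intro i
        have hi : Measurable fun z : (ℕ → UnitAddCircle) × (ι → UnitAddCircle) => (z.1, z.2 i) :=
          measurable_fst.prodMk ((measurable_pi_apply i).comp measurable_snd)
        have := (measurable_partialDensity_uncurry ℓ s).comp hi
        exact Complex.measurable_ofReal.comp this
      have h2 : ∀ i, Measurable fun z : (ℕ → UnitAddCircle) × (ι → UnitAddCircle) =>
          fourier (a i) (z.2 i) := fun i =>
        (measurable_fourier (a i)).comp ((measurable_pi_apply i).comp measurable_snd)
      have h3 : ∀ i, Measurable fun z : (ℕ → UnitAddCircle) × (ι → UnitAddCircle) =>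
          (partialDensity ℓ s z.1 (z.2 i) : ℂ) * fourier (a i) (z.2 i) := by
        intro i
        have h1 := h1 i
        have h2 := h2 i
        fun_prop
      have h4 : Measurable fun z : (ℕ → UnitAddCircle) × (ι → UnitAddCircle) =>
          ∏ i, ((partialDensity ℓ s z.1 (z.2 i) : ℂ) * fourier (a i) (z.2 i)) :=
        Finset.measurable_prod _ fun i _ => h3 i
      exact h4.aestronglyMeasurable
    · simp only [Function.uncurry, norm_prod, norm_mul, fourier_apply, Circle.norm_coe, mul_one]
      refine Finset.prod_le_prod (fun _ _ => norm_nonneg _) fun i _ => ?_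
      rw [Complex.norm_real, Real.norm_of_nonneg (partialDensity_nonneg h s _ _)]
      exact partialDensity_le h s _ _

/-- The product of the correlation functions. -/
def corrProd (ℓ : ℕ → ℝ) (s : Finset ℕ) (t : UnitAddCircle) : ℝ := ∏ k ∈ s, corr (ℓ k) t

theorem continuous_corrProd (ℓ : ℕ → ℝ) (s : Finset ℕ) : Continuous (corrProd ℓ s) :=
  continuous_finsetProd s fun k _ => continuous_corr (ℓ k)

theorem corrProd_pos {ℓ : ℕ → ℝ} {s : Finset ℕ} (h : ∀ k ∈ s, ℓ k < 1 / 2) (t : UnitAddCircle) :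
    0 < corrProd ℓ s t :=
  Finset.prod_pos fun k hk => corr_pos (h k hk) t

/-- The Fourier coefficients of the product of the correlation functions. -/
def corrCoeff (ℓ : ℕ → ℝ) (s : Finset ℕ) (n : ℤ) : ℝ :=
  ∫ x, ‖∫ t, (partialDensity ℓ s x t : ℂ) * fourier n t‖ ^ 2 ∂unifSeq

theorem corrCoeff_nonneg (ℓ : ℕ → ℝ) (s : Finset ℕ) (n : ℤ) : 0 ≤ corrCoeff ℓ s n :=
  integral_nonneg fun _ => sq_nonneg _

theorem integral_partialDensity_mul_fourier_neg (ℓ : ℕ → ℝ) (s : Finset ℕ) (x : ℕ → UnitAddCircle)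
    (n : ℤ) : ∫ t, (partialDensity ℓ s x t : ℂ) * fourier (-n) t =
      starRingEnd ℂ (∫ t, (partialDensity ℓ s x t : ℂ) * fourier n t) := by
  rw [← integral_conj]
  refine integral_congr_ae (ae_of_all _ fun t => ?_)
  simp only [fourier_neg, map_mul, Complex.conj_ofReal]

/-- The two-point moment is a function of the difference of the points, and its Fourier coefficients
are the second moments of the random coefficients. In particular they are nonnegative, which the
summability argument needs. -/
theorem integral_corrProd_mul_fourier {ℓ : ℕ → ℝ} (h0 : ∀ n, 0 ≤ ℓ n) (h : ∀ n, ℓ n < 1)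
    {s : Finset ℕ} (hs : ∀ k ∈ s, ℓ k ≤ 1 / 2) (n : ℤ) :
    ∫ u, (corrProd ℓ s u : ℂ) * fourier n u = corrCoeff ℓ s n := by
  have e := integral_prod_fourier_partialDensity h s ![-n, n]
  have hm : Measurable fun u => (corrProd ℓ s u : ℂ) :=
    Complex.measurable_ofReal.comp (continuous_corrProd ℓ s).measurable
  have e2 := integral_prod_increments (N := 1) hm ![-n, n] (by simp)
  have e3 : ∀ t : Fin 2 → UnitAddCircle, (∏ k ∈ s, mixedMoment (ℓ k) t) =
      corrProd ℓ s (t 1 - t 0) := fun t => Finset.prod_congr rfl fun k hk => by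
    rw [← mixedMoment_two (h0 k) (hs k hk)]
    congr 1
    ext i; fin_cases i <;> rfl
  have e4 : Finset.Ici (1 : Fin 2) = {1} := by decide
  simp only [Finset.univ_unique, Fin.default_eq_zero, Finset.prod_singleton, Fin.succ_zero_eq_one,
    Fin.castSucc_zero, e4, Finset.sum_singleton, Matrix.cons_val_one, Matrix.cons_val_fin_one] at e2
  simp_rw [e3] at e
  rw [← e2, ← e, corrCoeff, ← integral_complex_ofReal]
  refine integral_congr_ae (ae_of_all _ fun x => ?_)
  simp only [Fin.prod_univ_two, Matrix.cons_val_zero, Matrix.cons_val_one]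
  rw [integral_partialDensity_mul_fourier_neg, Complex.conj_mul']
  push_cast
  rfl

end

/-! ### Fejér averages, and summation of powers of the correlation coefficients. -/

section

/-- An unnormalized Fejér kernel. -/
def fejer (L : ℕ) (t : UnitAddCircle) : ℝ := ‖∑ p ∈ Finset.range L, fourier (p : ℤ) t‖ ^ 2

theorem fejer_nonneg (L : ℕ) (t : UnitAddCircle) : 0 ≤ fejer L t := sq_nonneg _

theorem fejer_eq_sum (L : ℕ) (t : UnitAddCircle) : (fejer L t : ℂ) =
    ∑ p ∈ Finset.range L, ∑ q ∈ Finset.range L, fourier ((p : ℤ) - q) t := by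
  rw [fejer]
  push_cast
  rw [← Complex.mul_conj', map_sum, Finset.sum_mul_sum]
  refine Finset.sum_congr rfl fun p _ => Finset.sum_congr rfl fun q _ => ?_
  rw [sub_eq_add_neg, fourier_add, fourier_neg]

theorem continuous_fejer (L : ℕ) : Continuous (fejer L) := by
  unfold fejer
  have : Continuous fun t : UnitAddCircle => ∑ p ∈ Finset.range L, fourier (p : ℤ) t :=
    continuous_finsetSum _ fun p _ => (fourier (p : ℤ)).continuous
  exact this.norm.pow 2

theorem integral_fourier (n : ℤ) : ∫ t : UnitAddCircle, fourier n t = if n = 0 then 1 else 0 := by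
  have h := integral_prod_increments (N := 0) (h := fun _ => 0) measurable_const
    (fun _ : Fin 1 => n)
  split_ifs with hn
  · subst hn; simp
  · have := fourierCoeff_fourier (T := (1 : ℝ)) n
    have h2 := congrFun this 0
    rw [fourierCoeff] at h2
    simp only [neg_zero, fourier_zero, one_smul, Pi.single_apply] at h2
    rw [if_neg (Ne.symm hn)] at h2
    rw [AddCircle.volume_eq_smul_haarAddCircle]
    simpa using h2

theorem integral_fejer (L : ℕ) : ∫ t, fejer L t = L := by
  have : ((∫ t, fejer L t : ℝ) : ℂ) = (L : ℂ) := by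
    rw [← integral_complex_ofReal]
    simp_rw [fejer_eq_sum]
    have hi : ∀ n : ℤ, Integrable (fun t : UnitAddCircle => fourier n t) volume := fun n =>
      integrable_continuousMap volume (fourier n)
    rw [integral_finsetSum _ fun p _ => integrable_finsetSum _ fun q _ => hi _]
    simp_rw [integral_finsetSum _ fun q _ => hi _, integral_fourier, sub_eq_zero, Nat.cast_inj]
    simp only [Finset.sum_ite_eq, Finset.sum_ite, Finset.sum_const_zero, add_zero,
      Finset.sum_const, nsmul_eq_mul, mul_one]
    rw [Finset.filter_true_of_mem fun x hx => hx, Finset.card_range]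
  exact_mod_cast this

/-- A sum over a symmetric interval is controlled by the average over a square of the values at
the differences. -/
theorem mul_sum_Icc_le {b : ℤ → ℝ} (hb : ∀ k, 0 ≤ b k) (K : ℕ) :
    K * ∑ k ∈ Finset.Icc (-(K : ℤ)) K, b k ≤
      ∑ p ∈ Finset.range (3 * K), ∑ q ∈ Finset.range (3 * K), b ((p : ℤ) - q) := by
  -- Only the `K` values `q ∈ [K, 2K)` are kept; for these every `k` with `|k| ≤ K` is `p - q` for
  -- some `p ∈ [0, 3K)`.
  rw [Finset.sum_comm]
  calc (K : ℝ) * ∑ k ∈ Finset.Icc (-(K : ℤ)) K, b k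
      = ∑ q ∈ Finset.Ico K (2 * K), ∑ k ∈ Finset.Icc (-(K : ℤ)) K, b k := by
        rw [Finset.sum_const, Nat.card_Ico, nsmul_eq_mul]
        congr 2
        omega
    _ ≤ ∑ q ∈ Finset.Ico K (2 * K), ∑ p ∈ Finset.range (3 * K), b ((p : ℤ) - q) := by
        refine Finset.sum_le_sum fun q hq => ?_
        rw [Finset.mem_Ico] at hq
        have hinj : Set.InjOn (fun p : ℕ => (p : ℤ) - q) (Finset.range (3 * K)) :=
          fun p _ p' _ h => by simpa using h
        rw [← Finset.sum_image hinj]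
        refine Finset.sum_le_sum_of_subset_of_nonneg (fun k hk => ?_) fun k _ _ => hb k
        rw [Finset.mem_Icc] at hk
        rw [Finset.mem_image]
        by_cases h3 : k + q < 3 * K
        · exact ⟨(k + q).toNat, by rw [Finset.mem_range]; omega, by omega⟩
        · omega
    _ ≤ _ := by
        refine Finset.sum_le_sum_of_subset_of_nonneg (fun q hq => ?_)
          fun q _ _ => Finset.sum_nonneg fun p _ => hb _
        rw [Finset.mem_Ico] at hq
        rw [Finset.mem_range]
        omega

/-- For fixed `p` the map `q ↦ (p - q) τ` is injective, so each row of the double sum is at most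
`S`. It serves with `τ` a nonzero tail of the alternating signs. -/
theorem sum_sum_sub_mul_le {b : ℤ → ℝ} {S : ℝ} (hS : ∀ F : Finset ℤ, ∑ k ∈ F, b k ≤ S)
    {τ : ℤ} (hτ : τ ≠ 0) (L : ℕ) :
    ∑ p ∈ Finset.range L, ∑ q ∈ Finset.range L, b (((p : ℤ) - q) * τ) ≤ L * S := by
  calc _ ≤ ∑ p ∈ Finset.range L, S := by
        refine Finset.sum_le_sum fun p _ => ?_
        have hinj : Set.InjOn (fun q : ℕ => ((p : ℤ) - q) * τ) (Finset.range L) :=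
          fun q _ q' _ h => by
            have := mul_right_cancel₀ hτ h
            omega
        rw [← Finset.sum_image (f := b) hinj]
        exact hS _
    _ = _ := by simp

variable {ℓ : ℕ → ℝ} {s : Finset ℕ}

theorem abs_corrProd_le_norm (ℓ : ℕ → ℝ) (s : Finset ℕ) (t : UnitAddCircle) :
    |corrProd ℓ s t| ≤ ‖(⟨corrProd ℓ s, continuous_corrProd ℓ s⟩ : C(UnitAddCircle, ℝ))‖ :=
  (⟨corrProd ℓ s, continuous_corrProd ℓ s⟩ : C(UnitAddCircle, ℝ)).norm_coe_le_norm t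

/-- A continuous function with nonnegative Fourier coefficients has a summable Fourier series: its
integrals against Fejér kernels are at most its sup norm times `L`, and positivity passes this bound
to the partial sums. -/
theorem summable_corrCoeff (h0 : ∀ n, 0 ≤ ℓ n) (h : ∀ n, ℓ n < 1) (hs : ∀ k ∈ s, ℓ k ≤ 1 / 2) :
    Summable (corrCoeff ℓ s) := by
  set C := ‖(⟨corrProd ℓ s, continuous_corrProd ℓ s⟩ : C(UnitAddCircle, ℝ))‖
  have hi : ∀ n : ℤ, Integrable (fun t => (corrProd ℓ s t : ℂ) * fourier n t) volume := fun n =>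
    ((Complex.continuous_ofReal.comp (continuous_corrProd ℓ s)).mul
      (fourier n).continuous).integrable_of_hasCompactSupport (HasCompactSupport.of_compactSpace _)
  have key : ∀ L : ℕ, ∑ p ∈ Finset.range L, ∑ q ∈ Finset.range L, corrCoeff ℓ s ((p : ℤ) - q) ≤
      C * L := by
    intro L
    have e : ((∑ p ∈ Finset.range L, ∑ q ∈ Finset.range L, corrCoeff ℓ s ((p : ℤ) - q) : ℝ) : ℂ) =
        ((∫ t, corrProd ℓ s t * fejer L t : ℝ) : ℂ) := by
      rw [← integral_complex_ofReal]
      push_cast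
      simp_rw [← integral_corrProd_mul_fourier h0 h hs, fejer_eq_sum, Finset.mul_sum]
      rw [integral_finsetSum _ fun p _ => integrable_finsetSum _ fun q _ => hi _]
      simp_rw [integral_finsetSum _ fun q _ => hi _]
    rw [Complex.ofReal_inj.1 e, ← integral_fejer, ← integral_const_mul]
    have hf : Integrable (fejer L) volume :=
      (continuous_fejer L).integrable_of_hasCompactSupport (HasCompactSupport.of_compactSpace _)
    refine integral_mono ?_ (hf.const_mul C) fun t => ?_
    · exact ((continuous_corrProd ℓ s).mul (continuous_fejer L)).integrable_of_hasCompactSupport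
        (HasCompactSupport.of_compactSpace _)
    · exact mul_le_mul_of_nonneg_right ((le_abs_self _).trans (abs_corrProd_le_norm ℓ s t))
        (fejer_nonneg L t)
  have hC : 0 ≤ C := norm_nonneg _
  refine summable_of_sum_le (corrCoeff_nonneg ℓ s) (c := 3 * C) fun F => ?_
  obtain ⟨K, hK⟩ : ∃ K : ℕ, ∀ k ∈ F, k.natAbs ≤ K := by
    refine ⟨F.sup Int.natAbs, fun k hk => Finset.le_sup (f := Int.natAbs) hk⟩
  have hsub : F ⊆ Finset.Icc (-((K + 1 : ℕ) : ℤ)) ((K + 1 : ℕ) : ℤ) := fun k hk => by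
    have := hK k hk
    rw [Finset.mem_Icc]
    omega
  refine (Finset.sum_le_sum_of_subset_of_nonneg hsub fun k _ _ => corrCoeff_nonneg ℓ s k).trans ?_
  have h1 := (mul_sum_Icc_le (corrCoeff_nonneg ℓ s) (K + 1)).trans (key (3 * (K + 1)))
  have hpos : (0 : ℝ) < ((K + 1 : ℕ) : ℝ) := by positivity
  refine le_of_mul_le_mul_left (h1.trans_eq ?_) hpos
  push_cast
  ring

theorem corrCoeff_neg (ℓ : ℕ → ℝ) (s : Finset ℕ) (n : ℤ) :
    corrCoeff ℓ s (-n) = corrCoeff ℓ s n := by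
  simp only [corrCoeff, integral_partialDensity_mul_fourier_neg, RCLike.norm_conj]

theorem hasSum_corrProd (h0 : ∀ n, 0 ≤ ℓ n) (h : ∀ n, ℓ n < 1) (hs : ∀ k ∈ s, ℓ k ≤ 1 / 2)
    (t : UnitAddCircle) :
    HasSum (fun n : ℤ => (corrCoeff ℓ s n : ℂ) * fourier n t) (corrProd ℓ s t : ℂ) := by
  let f : C(UnitAddCircle, ℂ) := ⟨fun t => (corrProd ℓ s t : ℂ),
    Complex.continuous_ofReal.comp (continuous_corrProd ℓ s)⟩
  have hc : ∀ n, fourierCoeff f n = (corrCoeff ℓ s n : ℂ) := by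
    intro n
    rw [← corrCoeff_neg, ← integral_corrProd_mul_fourier h0 h hs, fourierCoeff,
      AddCircle.volume_eq_smul_haarAddCircle]
    simp only [ENNReal.ofReal_one, one_smul, smul_eq_mul]
    refine integral_congr_ae (ae_of_all _ fun u => mul_comm _ _)
  have hsum : Summable (fourierCoeff f) := by
    have : fourierCoeff f = fun n => (corrCoeff ℓ s n : ℂ) := funext hc
    rw [this]
    exact Complex.ofRealCLM.summable (summable_corrCoeff h0 h hs)
  have := has_pointwise_sum_fourier_series_of_summable hsum t
  simp_rw [hc, smul_eq_mul] at this
  exact this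

theorem fourier_neg_arg (n : ℤ) (t : UnitAddCircle) : fourier n (-t) = fourier (-n) t := by
  simp only [fourier_apply, smul_neg, neg_smul]

/-- The sum of the powers of the Fourier coefficients, as a convolution at `0`. -/
theorem hasSum_corrCoeff_pow (h0 : ∀ n, 0 ≤ ℓ n) (h : ∀ n, ℓ n < 1)
    (hs : ∀ k ∈ s, ℓ k ≤ 1 / 2) (d : ℕ) :
    HasSum (fun n : ℤ => corrCoeff ℓ s n ^ (d + 1))
      (∫ t : Fin d → UnitAddCircle, (∏ i, corrProd ℓ s (t i)) * corrProd ℓ s (-∑ i, t i)) := by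
  rw [← Complex.hasSum_ofReal, ← integral_complex_ofReal]
  set C := ‖(⟨corrProd ℓ s, continuous_corrProd ℓ s⟩ : C(UnitAddCircle, ℝ))‖ with hC
  have hC0 : 0 ≤ C := norm_nonneg _
  -- Summing `F n t` over `n` rebuilds `corrProd` at `-∑ tᵢ` from its Fourier series; integrating
  -- over `t` gives one further factor `corrCoeff` for each of the `d` variables.
  let F : ℤ → (Fin d → UnitAddCircle) → ℂ := fun n t =>
    (corrCoeff ℓ s n : ℂ) * ∏ i, ((corrProd ℓ s (t i) : ℂ) * fourier (-n) (t i))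
  have hFint : ∀ n, ∫ t, F n t = ((corrCoeff ℓ s n ^ (d + 1) : ℝ) : ℂ) := by
    intro n
    simp only [F]
    rw [integral_const_mul, integral_fintype_prod_volume_eq_prod (fun (_ : Fin d) u =>
      (corrProd ℓ s u : ℂ) * fourier (-n) u)]
    simp_rw [integral_corrProd_mul_fourier h0 h hs, corrCoeff_neg]
    simp [pow_succ']
  have hFb : ∀ n t, ‖F n t‖ ≤ corrCoeff ℓ s n * C ^ d := by
    intro n t
    simp only [F]
    rw [norm_mul, Complex.norm_real, Real.norm_of_nonneg (corrCoeff_nonneg ℓ s n), norm_prod]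
    refine mul_le_mul_of_nonneg_left ?_ (corrCoeff_nonneg ℓ s n)
    calc _ ≤ ∏ _i : Fin d, C := Finset.prod_le_prod (fun _ _ => norm_nonneg _) fun i _ => by
          rw [norm_mul, fourier_apply, Circle.norm_coe, mul_one, Complex.norm_real]
          exact abs_corrProd_le_norm ℓ s (t i)
      _ = _ := by simp
  have hFm : ∀ n, Measurable (F n) := by
    intro n
    have hf1 : ∀ i : Fin d, Measurable fun t : Fin d → UnitAddCircle => (corrProd ℓ s (t i) : ℂ) :=
      fun i => Complex.measurable_ofReal.comp
        ((continuous_corrProd ℓ s).measurable.comp (measurable_pi_apply i))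
    have hf2 : ∀ i : Fin d, Measurable fun t : Fin d → UnitAddCircle => fourier (-n) (t i) :=
      fun i => (measurable_fourier (-n)).comp (measurable_pi_apply i)
    exact (Finset.measurable_prod _ fun i _ => (hf1 i).mul (hf2 i)).const_mul _
  have hFi : ∀ n, Integrable (F n) volume := fun n =>
    Integrable.of_bound (hFm n).aestronglyMeasurable _ (ae_of_all _ (hFb n))
  have hsum : Summable fun n => ∫ t, ‖F n t‖ := by
    refine Summable.of_nonneg_of_le (fun n => integral_nonneg fun t => norm_nonneg _)
      (fun n => ?_) ((summable_corrCoeff h0 h hs).mul_right (C ^ d))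
    calc ∫ t, ‖F n t‖ ≤ ∫ _t : Fin d → UnitAddCircle, corrCoeff ℓ s n * C ^ d :=
          integral_mono (hFi n).norm (integrable_const _) (hFb n)
      _ = _ := by simp
  have key := hasSum_integral_of_summable_integral_norm hFi hsum
  simp_rw [hFint] at key
  refine Eq.subst (motive := fun z => HasSum _ z) ?_ key
  refine integral_congr_ae (ae_of_all _ fun t => ?_)
  simp only
  have e := (hasSum_corrProd h0 h hs (-∑ i, t i)).mul_left (∏ i, (corrProd ℓ s (t i) : ℂ))
  push_cast
  refine Eq.trans ?_ e.tsum_eq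
  refine tsum_congr fun n => ?_
  simp only [F]
  rw [Finset.prod_mul_distrib, fourier_neg_arg, fourier_finset_sum]
  ring

theorem ofReal_exp_sum_le_kernelK (ℓ : ℕ → ℝ) (s : Finset ℕ) (t : UnitAddCircle) :
    ENNReal.ofReal (Real.exp (∑ k ∈ s, max 0 (ℓ k - ‖t‖))) ≤ kernelK ℓ t := by
  rw [kernelK, ← EReal.exp_coe]
  apply EReal.exp_monotone
  have h1 : ENNReal.ofReal (∑ k ∈ s, max 0 (ℓ k - ‖t‖)) ≤ ∑' n, ENNReal.ofReal (ℓ n - ‖t‖) := by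
    rw [ENNReal.ofReal_sum_of_nonneg fun k _ => le_max_left _ _]
    refine le_trans (Finset.sum_le_sum fun k _ => ?_) (ENNReal.sum_le_tsum s)
    rcases le_total 0 (ℓ k - ‖t‖) with h | h
    · rw [max_eq_right h]
    · rw [max_eq_left h, ENNReal.ofReal_zero]; exact zero_le
  have h2 : ((∑ k ∈ s, max 0 (ℓ k - ‖t‖) : ℝ) : EReal) =
      ((ENNReal.ofReal (∑ k ∈ s, max 0 (ℓ k - ‖t‖)) : ℝ≥0∞) : EReal) := by
    rw [EReal.coe_ennreal_ofReal, max_eq_left (Finset.sum_nonneg fun k _ => le_max_left _ _)]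
  rw [h2]
  exact EReal.coe_ennreal_le_coe_ennreal_iff.2 h1

theorem corrProd_le_exp (h0 : ∀ n, 0 ≤ ℓ n) (hs : ∀ k ∈ s, ℓ k ≤ 1 / 4) {S : ℝ}
    (hS : ∑ k ∈ s, ℓ k ^ 2 ≤ S) (t : UnitAddCircle) :
    corrProd ℓ s t ≤ Real.exp (4 * S) * Real.exp (∑ k ∈ s, max 0 (ℓ k - ‖t‖)) := by
  calc corrProd ℓ s t ≤ ∏ k ∈ s, Real.exp (max 0 (ℓ k - ‖t‖) + 4 * ℓ k ^ 2) :=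
        Finset.prod_le_prod (fun k hk => (corr_pos (by linarith [hs k hk]) t).le)
          fun k hk => corr_le (h0 k) (hs k hk) t
    _ = Real.exp (4 * ∑ k ∈ s, ℓ k ^ 2) * Real.exp (∑ k ∈ s, max 0 (ℓ k - ‖t‖)) := by
        rw [← Real.exp_sum, ← Real.exp_add, Finset.sum_add_distrib, Finset.mul_sum, add_comm]
    _ ≤ _ := by gcongr

theorem ofReal_corrProd_le (h0 : ∀ n, 0 ≤ ℓ n) (hs : ∀ k ∈ s, ℓ k ≤ 1 / 4) {S : ℝ}
    (hS : ∑ k ∈ s, ℓ k ^ 2 ≤ S) (t : UnitAddCircle) :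
    ENNReal.ofReal (corrProd ℓ s t) ≤ ENNReal.ofReal (Real.exp (4 * S)) * kernelK ℓ t := by
  refine (ENNReal.ofReal_le_ofReal (corrProd_le_exp h0 hs hS t)).trans ?_
  rw [ENNReal.ofReal_mul (Real.exp_pos _).le]
  gcongr
  exact ofReal_exp_sum_le_kernelK ℓ s t

end

/-! ### Consequences of the hypotheses on the lengths, and combinatorics of alternating signs. -/

section

variable {ℓ : ℕ → ℝ} {s : Finset ℕ}

theorem sum_mul_sub_eq (ℓ : ℕ → ℝ) (N : ℕ) :
    ∑ k ∈ Finset.range N, ℓ k * (ℓ k - ℓ N) =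
      ∑ n ∈ Finset.range N, (ℓ n - ℓ (n + 1)) * ∑ k ∈ Finset.range (n + 1), ℓ k := by
  induction N with
  | zero => simp
  | succ N ih =>
    rw [Finset.sum_range_succ (fun n => (ℓ n - ℓ (n + 1)) * ∑ k ∈ Finset.range (n + 1), ℓ k) N,
      ← ih, Finset.sum_range_succ]
    have : ∑ k ∈ Finset.range N, ℓ k * (ℓ k - ℓ (N + 1)) =
        ∑ k ∈ Finset.range N, ℓ k * (ℓ k - ℓ N) +
          (ℓ N - ℓ (N + 1)) * ∑ k ∈ Finset.range N, ℓ k := by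
      rw [Finset.mul_sum, ← Finset.sum_add_distrib]
      exact Finset.sum_congr rfl fun k _ => by ring
    rw [this, Finset.sum_range_succ (fun k => ℓ k) N]
    ring

namespace Admissible

variable {d : ℕ}

/-- Since `x ≤ exp x`, the hypothesis bounds `∑ (ℓ n - ℓ (n + 1)) * ∑_{k ≤ n} ℓ k`. Abel summation
rewrites the partial sums as `∑_{k < N} ℓ k * (ℓ k - ℓ N)`; then `N → ∞` with `ℓ N → 0`. -/
theorem summable_sq (hadm : Admissible ℓ d) : Summable fun n => ℓ n ^ 2 := by
  refine summable_of_sum_range_le (fun n => sq_nonneg _)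
    (c := ∑' n, (ℓ n - ℓ (n + 1)) * Real.exp (∑ k ∈ Finset.range (n + 1), ℓ k)) fun M => ?_
  have hdiff : ∀ n, 0 ≤ ℓ n - ℓ (n + 1) := fun n => sub_nonneg.2 (hadm.anti (Nat.le_succ n))
  have h1 : ∀ N, M ≤ N → ∑ k ∈ Finset.range M, ℓ k * (ℓ k - ℓ N) ≤
      ∑' n, (ℓ n - ℓ (n + 1)) * Real.exp (∑ k ∈ Finset.range (n + 1), ℓ k) := by
    intro N hN
    calc ∑ k ∈ Finset.range M, ℓ k * (ℓ k - ℓ N)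
        ≤ ∑ k ∈ Finset.range N, ℓ k * (ℓ k - ℓ N) :=
          Finset.sum_le_sum_of_subset_of_nonneg (Finset.range_mono hN) fun k hk _ =>
            mul_nonneg (hadm.pos k).le
              (sub_nonneg.2 (hadm.anti (Finset.mem_range.1 hk).le))
      _ = ∑ n ∈ Finset.range N, (ℓ n - ℓ (n + 1)) * ∑ k ∈ Finset.range (n + 1), ℓ k :=
          sum_mul_sub_eq ℓ N
      _ ≤ ∑ n ∈ Finset.range N, (ℓ n - ℓ (n + 1)) *
            Real.exp (∑ k ∈ Finset.range (n + 1), ℓ k) := by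
          refine Finset.sum_le_sum fun n _ => mul_le_mul_of_nonneg_left ?_ (hdiff n)
          linarith [Real.add_one_le_exp (∑ k ∈ Finset.range (n + 1), ℓ k)]
      _ ≤ _ := hadm.summable_exp.sum_le_tsum _ fun n _ =>
          mul_nonneg (hdiff n) (Real.exp_pos _).le
  have h2 : Tendsto (fun N => ∑ k ∈ Finset.range M, ℓ k * (ℓ k - ℓ N)) atTop
      (𝓝 (∑ k ∈ Finset.range M, ℓ k * (ℓ k - 0))) :=
    tendsto_finsetSum _ fun k _ => (tendsto_const_nhds.sub hadm.tendsto_zero).const_mul _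
  have h3 := le_of_tendsto h2 (eventually_atTop.2 ⟨M, h1⟩)
  simpa [sq] using h3

theorem sum_sq_le (hadm : Admissible ℓ d) (s : Finset ℕ) : ∑ k ∈ s, ℓ k ^ 2 ≤ ∑' n, ℓ n ^ 2 :=
  hadm.summable_sq.sum_le_tsum s fun _ _ => sq_nonneg _

theorem exists_le (hadm : Admissible ℓ d) {δ : ℝ} (hδ : 0 < δ) : ∃ n0, ∀ k, n0 ≤ k → ℓ k ≤ δ := by
  obtain ⟨n0, h⟩ := eventually_atTop.1 (hadm.tendsto_zero.eventually (ge_mem_nhds hδ))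
  exact ⟨n0, h⟩

theorem _root_.Dvoretzky.measurable_kernelK (ℓ : ℕ → ℝ) : Measurable (kernelK ℓ) := by
  unfold kernelK
  refine EReal.measurable_exp.comp (measurable_coe_ennreal_ereal.comp ?_)
  exact Measurable.tsum fun n => (measurable_const.sub measurable_norm).ennreal_ofReal

theorem _root_.Dvoretzky.one_le_kernelK (ℓ : ℕ → ℝ) (t : UnitAddCircle) : 1 ≤ kernelK ℓ t := by
  simpa using ofReal_exp_sum_le_kernelK ℓ ∅ t

/-- As `K ≥ 1`, all factors but one of the integrand in the hypothesis can be dropped; this uses `1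
≤ d`. -/
theorem lintegral_kernelK_lt_top (hadm : Admissible ℓ d) : ∫⁻ t, kernelK ℓ t < ∞ := by
  have hd := hadm.one_le
  let i0 : Fin d := ⟨0, hd⟩
  have hmp := measurePreserving_eval (fun _ : Fin d => (volume : Measure UnitAddCircle)) i0
  have := hmp.lintegral_comp (measurable_kernelK ℓ)
  rw [← this]
  refine lt_of_le_of_lt (lintegral_mono fun t => ?_) hadm.lintegral_lt_top
  calc kernelK ℓ (t i0) ≤ ∏ i, kernelK ℓ (t i) :=
        Finset.single_le_prod' (f := fun i => kernelK ℓ (t i))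
          (fun i _ => one_le_kernelK ℓ (t i)) (Finset.mem_univ i0)
    _ ≤ _ := le_mul_of_one_le_right' (one_le_kernelK ℓ _)

/-- Uniform bounds for the Fourier coefficients of the correlation functions. -/
theorem exists_corrCoeff_bounds (hadm : Admissible ℓ d) : ∃ h1 S2 : ℝ, 1 ≤ h1 ∧ 0 ≤ S2 ∧ ∀ s : Finset ℕ,
    (∀ k ∈ s, ℓ k ≤ 1 / 4) → (∀ n, corrCoeff ℓ s n ≤ h1) ∧
      ∀ F : Finset ℤ, ∑ n ∈ F, corrCoeff ℓ s n ^ (d + 1) ≤ S2 := by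
  -- This constant satisfies `corrProd ≤ c K` for every finite set of short arcs, by the summability
  -- of the squares.
  set c := ENNReal.ofReal (Real.exp (4 * ∑' n, ℓ n ^ 2)) with hc
  have hcT : c ≠ ∞ := ENNReal.ofReal_ne_top
  set I1 := c * ∫⁻ t, kernelK ℓ t with hI1
  set I2 := c ^ (d + 1) * ∫⁻ t : Fin d → UnitAddCircle, (∏ i, kernelK ℓ (t i)) *
    kernelK ℓ (-∑ i, t i) with hI2
  have hI1T : I1 ≠ ∞ := ENNReal.mul_ne_top hcT hadm.lintegral_kernelK_lt_top.ne
  have hI2T : I2 ≠ ∞ := ENNReal.mul_ne_top (ENNReal.pow_ne_top hcT) hadm.lintegral_lt_top.ne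
  refine ⟨max 1 I1.toReal, I2.toReal, le_max_left _ _, ENNReal.toReal_nonneg, fun s hs => ?_⟩
  have hs2 : ∀ k ∈ s, ℓ k ≤ 1 / 2 := fun k hk => (hs k hk).trans (by norm_num)
  have hpos : ∀ t, 0 ≤ corrProd ℓ s t := fun t =>
    (corrProd_pos (fun k hk => by linarith [hs k hk]) t).le
  have hle : ∀ t, ENNReal.ofReal (corrProd ℓ s t) ≤ c * kernelK ℓ t := fun t =>
    ofReal_corrProd_le (fun n => (hadm.pos n).le) hs (hadm.sum_sq_le s) t
  have hm : Measurable (corrProd ℓ s) := (continuous_corrProd ℓ s).measurable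
  constructor
  · intro n
    refine le_trans ?_ (le_max_right _ _)
    have e := integral_corrProd_mul_fourier (fun n => (hadm.pos n).le) hadm.lt_one hs2 n
    calc corrCoeff ℓ s n = ‖(corrCoeff ℓ s n : ℂ)‖ := by
          rw [Complex.norm_real, Real.norm_of_nonneg (corrCoeff_nonneg ℓ s n)]
      _ ≤ ∫ u, corrProd ℓ s u := by
          rw [← e]
          refine (norm_integral_le_integral_norm _).trans_eq ?_
          refine integral_congr_ae (ae_of_all _ fun u => ?_)
          simp only
          rw [norm_mul, fourier_apply, Circle.norm_coe, mul_one, Complex.norm_real,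
            Real.norm_of_nonneg (hpos u)]
      _ = (∫⁻ u, ENNReal.ofReal (corrProd ℓ s u)).toReal :=
          integral_eq_lintegral_of_nonneg_ae (ae_of_all _ hpos) hm.aestronglyMeasurable
      _ ≤ I1.toReal := by
          refine ENNReal.toReal_mono hI1T ?_
          rw [hI1, ← lintegral_const_mul _ (measurable_kernelK ℓ)]
          exact lintegral_mono hle
  · intro F
    have hsum := hasSum_corrCoeff_pow (fun n => (hadm.pos n).le) hadm.lt_one hs2 d
    refine (sum_le_hasSum F (fun n _ => pow_nonneg (corrCoeff_nonneg ℓ s n) _) hsum).trans ?_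
    have h1 : ∀ i : Fin d, Measurable fun t : Fin d → UnitAddCircle => corrProd ℓ s (t i) :=
      fun i => hm.comp (measurable_pi_apply i)
    have h2 : Measurable fun t : Fin d → UnitAddCircle => -∑ i, t i :=
      (Finset.measurable_sum _ fun i _ => measurable_pi_apply i).neg
    rw [integral_eq_lintegral_of_nonneg_ae (ae_of_all _ fun t =>
      mul_nonneg (Finset.prod_nonneg fun i _ => hpos _) (hpos _))
      ((Finset.measurable_prod _ fun i _ => h1 i).mul (hm.comp h2)).aestronglyMeasurable]
    refine ENNReal.toReal_mono hI2T ?_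
    have hKm : Measurable fun t : Fin d → UnitAddCircle =>
        (∏ i, kernelK ℓ (t i)) * kernelK ℓ (-∑ i, t i) :=
      (Finset.measurable_prod _ fun i _ =>
        (measurable_kernelK ℓ).comp (measurable_pi_apply i)).mul ((measurable_kernelK ℓ).comp h2)
    rw [hI2, ← lintegral_const_mul _ hKm]
    refine lintegral_mono fun t => ?_
    rw [ENNReal.ofReal_mul (Finset.prod_nonneg fun i _ => hpos _),
      ENNReal.ofReal_prod_of_nonneg fun i _ => hpos _]
    calc _ ≤ (∏ i, (c * kernelK ℓ (t i))) * (c * kernelK ℓ (-∑ i, t i)) :=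
          mul_le_mul' (Finset.prod_le_prod' fun i _ => hle _) (hle _)
      _ = _ := by
          rw [Finset.prod_mul_distrib, Finset.prod_const, Finset.card_univ, Fintype.card_fin]
          ring

end Admissible

theorem prod_le_sum_pow {ι : Type*} {J : Finset ι} (hJ : J.Nonempty) {x : ι → ℝ}
    (hx : ∀ j ∈ J, 0 ≤ x j) : ∏ j ∈ J, x j ≤ ∑ j ∈ J, x j ^ J.card := by
  obtain ⟨i, hi, him⟩ := Finset.exists_max_image J x hJ
  calc ∏ j ∈ J, x j ≤ ∏ _j ∈ J, x i := Finset.prod_le_prod hx him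
    _ = x i ^ J.card := by rw [Finset.prod_const]
    _ ≤ _ := Finset.single_le_sum (f := fun j => x j ^ J.card)
        (fun j hj => pow_nonneg (hx j hj) _) hi

/-- Opposite signs pair up; applied to Fourier coefficients at opposite frequencies, which are
conjugate, this produces an even power of a modulus. -/
theorem prod_alternating (g : ℤ → ℂ) (d : ℕ) :
    ∏ i : Fin (2 * d + 1 + 1), g ((-1) ^ (i : ℕ)) = (g 1 * g (-1)) ^ (d + 1) := by
  rw [Fin.prod_univ_eq_prod_range (fun i => g ((-1) ^ i))]
  induction d with
  | zero => simp [Finset.prod_range_succ]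
  | succ d ih =>
    rw [show 2 * (d + 1) + 1 + 1 = 2 * d + 1 + 1 + 1 + 1 by ring, Finset.prod_range_succ,
      Finset.prod_range_succ, ih]
    have e1 : (-1 : ℤ) ^ (2 * d + 1 + 1) = 1 := by
      rw [show 2 * d + 1 + 1 = 2 * (d + 1) by ring, pow_mul]; simp
    rw [pow_succ (-1 : ℤ) (2 * d + 1 + 1), e1, one_mul, pow_succ _ (d + 1), mul_assoc]

theorem sum_alternating (d : ℕ) : ∑ i : Fin (2 * d + 1 + 1), (-1 : ℤ) ^ (i : ℕ) = 0 := by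
  rw [Fin.sum_univ_eq_sum_range (fun i => (-1 : ℤ) ^ i), neg_one_geom_sum, if_pos]
  exact ⟨d + 1, by ring⟩

/-- Parity: the tail has `2 d + 1 - j` terms `±1`, an odd number when `j` is even, whatever the
permutation. -/
theorem sum_Ici_alternating_ne_zero {d : ℕ} (σ : Equiv.Perm (Fin (2 * d + 1 + 1)))
    {j : Fin (2 * d + 1)} (hj : Even (j : ℕ)) :
    ∑ i ∈ Finset.Ici j.succ, (-1 : ℤ) ^ (σ i : ℕ) ≠ 0 := by
  intro h
  have h2 := congrArg (Int.cast : ℤ → ZMod 2) h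
  have e : (-1 : ZMod 2) = 1 := by decide
  push_cast at h2
  simp only [e, one_pow, Finset.sum_const, Fin.card_Ici, Fin.val_succ, nsmul_eq_mul,
    mul_one] at h2
  rw [ZMod.natCast_eq_zero_iff] at h2
  obtain ⟨m, hm⟩ := hj
  have := j.2
  omega

/-- The indices at which the alternating sum has an odd number of remaining terms. -/
def evenIndices (d : ℕ) : Finset (Fin (2 * d + 1)) := Finset.univ.filter fun j => Even (j : ℕ)

theorem card_evenIndices (d : ℕ) : (evenIndices d).card = d + 1 := by
  have : (evenIndices d) = (Finset.univ : Finset (Fin (d + 1))).map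
      ⟨fun i : Fin (d + 1) => (⟨2 * (i : ℕ), by omega⟩ : Fin (2 * d + 1)), fun i j h => by
        simp only [Fin.mk.injEq] at h; exact Fin.ext (by omega)⟩ := by
    ext j
    simp only [evenIndices, Finset.mem_filter, Finset.mem_univ, true_and, Finset.mem_map]
    constructor
    · rintro ⟨m, hm⟩
      exact ⟨⟨m, by omega⟩, Fin.ext (by change 2 * m = (j : ℕ); omega)⟩
    · rintro ⟨i, rfl⟩
      exact ⟨i, by change 2 * (i : ℕ) = i + i; ring⟩
  rw [this, Finset.card_map, Finset.card_univ, Fintype.card_fin]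

theorem measurePreserving_comp_perm {N : ℕ} (σ : Equiv.Perm (Fin (N + 1))) :
    MeasurePreserving (fun t : Fin (N + 1) → UnitAddCircle => fun i => t (σ i)) volume volume := by
  let f : (Fin (N + 1) → UnitAddCircle) →+ (Fin (N + 1) → UnitAddCircle) :=
    { toFun := fun t i => t (σ i), map_zero' := rfl, map_add' := fun _ _ => rfl }
  refine AddMonoidHom.measurePreserving (f := f) ?_ ?_ rfl
  · exact continuous_pi fun i => continuous_apply (σ i)
  · intro x
    exact ⟨fun i => x (σ.symm i), funext fun i => by simp [f]⟩

end

/-! ### Moments of the Fourier coefficients, summed over the frequencies. -/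

section

variable {ℓ : ℕ → ℝ} {s : Finset ℕ} {d : ℕ}

/-- The alternating sum `t₀ - t₁ + t₂ - ⋯`. -/
def altSum (d : ℕ) (t : Fin (2 * d + 1 + 1) → UnitAddCircle) : UnitAddCircle :=
  ∑ i : Fin (2 * d + 1 + 1), ((-1 : ℤ) ^ (i : ℕ)) • t i

theorem continuous_altSum (d : ℕ) : Continuous (altSum d) :=
  continuous_finsetSum _ fun i _ => (continuous_apply i).zsmul _

theorem fourier_zsmul (n m : ℤ) (t : UnitAddCircle) : fourier n (m • t) = fourier (n * m) t := by
  simp only [fourier_apply, mul_smul]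

theorem fourier_altSum (n : ℤ) (t : Fin (2 * d + 1 + 1) → UnitAddCircle) :
    fourier n (altSum d t) = ∏ i : Fin (2 * d + 1 + 1), fourier (n * (-1) ^ (i : ℕ)) (t i) := by
  rw [altSum, fourier_finset_sum]
  exact Finset.prod_congr rfl fun i _ => fourier_zsmul _ _ _

theorem fourier_altSum_perm (σ : Equiv.Perm (Fin (2 * d + 1 + 1))) (n : ℤ)
    (t : Fin (2 * d + 1 + 1) → UnitAddCircle) :
    fourier n (altSum d t) = ∏ i, fourier (n * (-1) ^ (σ i : ℕ)) (t (σ i)) := by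
  rw [fourier_altSum]
  exact (Equiv.prod_comp σ fun i : Fin (2 * d + 1 + 1) =>
    (fourier (n * (-1) ^ (i : ℕ)) (t i) : ℂ)).symm

/-- The moment of order `2 (d + 1)` of a Fourier coefficient of the random density. -/
def fourierMoment (ℓ : ℕ → ℝ) (s : Finset ℕ) (d : ℕ) (n : ℤ) : ℝ :=
  ∫ x, ‖∫ t, (partialDensity ℓ s x t : ℂ) * fourier n t‖ ^ (2 * (d + 1)) ∂unifSeq

theorem fourierMoment_nonneg (n : ℤ) : 0 ≤ fourierMoment ℓ s d n :=
  integral_nonneg fun _ => pow_nonneg (norm_nonneg _) _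

theorem fourierMoment_eq (h : ∀ n, ℓ n < 1) (n : ℤ) :
    (fourierMoment ℓ s d n : ℂ) = ∫ t : Fin (2 * d + 1 + 1) → UnitAddCircle,
      ((∏ k ∈ s, mixedMoment (ℓ k) t : ℝ) : ℂ) * fourier n (altSum d t) := by
  have e := integral_prod_fourier_partialDensity h s
    (fun i : Fin (2 * d + 1 + 1) => n * (-1) ^ (i : ℕ))
  simp only [fourier_altSum]
  rw [← e, fourierMoment, ← integral_complex_ofReal]
  refine integral_congr_ae (ae_of_all _ fun x => ?_)
  simp only
  rw [prod_alternating (fun z => ∫ t, (partialDensity ℓ s x t : ℂ) * fourier (n * z) t),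
    mul_one, mul_neg_one, integral_partialDensity_mul_fourier_neg, Complex.mul_conj', pow_mul]
  push_cast
  rfl

theorem measurable_mixedMoment {ι : Type*} [Fintype ι] (r : ℝ) :
    Measurable fun t : ι → UnitAddCircle => mixedMoment r t := by
  have : Measurable fun z : (ι → UnitAddCircle) × UnitAddCircle => ∏ i, pf r (z.1 i - z.2) :=
    Finset.measurable_prod _ fun i _ => (measurable_pf r).comp
      (((measurable_pi_apply i).comp measurable_fst).sub measurable_snd)
  exact (this.stronglyMeasurable.integral_prod_right').measurable

theorem integrable_prod_mixedMoment_mul {ι : Type*} [Fintype ι] {E : Type*} [NormedField E]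
    [NormedSpace ℝ E] [MeasurableSpace E] [BorelSpace E] [SecondCountableTopology E]
    (h : ∀ n, ℓ n < 1) (s : Finset ℕ) {g : (ι → UnitAddCircle) → E} (hg : Continuous g) :
    Integrable (fun t : ι → UnitAddCircle => (∏ k ∈ s, mixedMoment (ℓ k) t) • g t) volume := by
  have hgi : Integrable g volume :=
    hg.integrable_of_hasCompactSupport (HasCompactSupport.of_compactSpace _)
  refine Integrable.bdd_smul hgi (C := ∏ k ∈ s, (1 / (1 - ℓ k)) ^ Fintype.card ι)
    (Finset.measurable_prod s fun k _ => measurable_mixedMoment (ℓ k)).aestronglyMeasurable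
    (ae_of_all _ fun t => ?_)
  rw [Real.norm_of_nonneg (Finset.prod_nonneg fun k _ => mixedMoment_nonneg (h k) t)]
  exact Finset.prod_le_prod (fun k _ => mixedMoment_nonneg (h k) t) fun k _ => mixedMoment_le (h k) t

/-- Averaging over the differences `p - q` replaces the oscillating characters by the nonnegative
Fejér kernel; only then can the mixed moments be majorised pointwise. -/
theorem sum_sum_fourierMoment (h : ∀ n, ℓ n < 1) (L : ℕ) :
    ∑ p ∈ Finset.range L, ∑ q ∈ Finset.range L, fourierMoment ℓ s d ((p : ℤ) - q) =
      ∫ t : Fin (2 * d + 1 + 1) → UnitAddCircle,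
        (∏ k ∈ s, mixedMoment (ℓ k) t) * fejer L (altSum d t) := by
  apply Complex.ofReal_injective
  have hi : ∀ n : ℤ, Integrable (fun t : Fin (2 * d + 1 + 1) → UnitAddCircle =>
      ((∏ k ∈ s, mixedMoment (ℓ k) t : ℝ) : ℂ) * fourier n (altSum d t)) volume := fun n =>
    integrable_prod_mixedMoment_mul h s
      ((fourier n).continuous.comp (continuous_altSum d))
  push_cast
  simp only [fourierMoment_eq h]
  have e : ∀ t : Fin (2 * d + 1 + 1) → UnitAddCircle,
      (((∏ k ∈ s, mixedMoment (ℓ k) t) * fejer L (altSum d t) : ℝ) : ℂ) =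
      ∑ p ∈ Finset.range L, ∑ q ∈ Finset.range L,
        ((∏ k ∈ s, mixedMoment (ℓ k) t : ℝ) : ℂ) * fourier ((p : ℤ) - q) (altSum d t) := by
    intro t
    rw [Complex.ofReal_mul, fejer_eq_sum, Finset.mul_sum]
    exact Finset.sum_congr rfl fun p _ => Finset.mul_sum _ _ _
  rw [← integral_complex_ofReal]
  simp only [e]
  rw [integral_finsetSum _ fun p _ => integrable_finsetSum _ fun q _ => hi _]
  exact Finset.sum_congr rfl fun p _ => (integral_finsetSum _ fun q _ => hi _).symm

/-- The product of the correlation functions of the successive increments along `σ`. -/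
def chainProd (ℓ : ℕ → ℝ) (s : Finset ℕ) {N : ℕ} (σ : Equiv.Perm (Fin (N + 1)))
    (t : Fin (N + 1) → UnitAddCircle) : ℝ :=
  ∏ j : Fin N, corrProd ℓ s (t (σ j.succ) - t (σ j.castSucc))

theorem continuous_chainProd {N : ℕ} (σ : Equiv.Perm (Fin (N + 1))) :
    Continuous (chainProd ℓ s σ) :=
  continuous_finsetProd _ fun _ _ => (continuous_corrProd ℓ s).comp
    ((continuous_apply _).sub (continuous_apply _))

/-- After relabelling the points by `σ` the chain is a product of functions of the increments. The
signs sum to `0`, so the integral splits into coefficients at `n` times the tails of the permuted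
signs. -/
theorem integral_chainProd_mul_fourier (h0 : ∀ n, 0 ≤ ℓ n) (h : ∀ n, ℓ n < 1)
    (hs : ∀ k ∈ s, ℓ k ≤ 1 / 2) (σ : Equiv.Perm (Fin (2 * d + 1 + 1))) (n : ℤ) :
    ∫ t : Fin (2 * d + 1 + 1) → UnitAddCircle,
      (chainProd ℓ s σ t : ℂ) * fourier n (altSum d t) =
      ((∏ j : Fin (2 * d + 1),
        corrCoeff ℓ s (n * ∑ i ∈ Finset.Ici j.succ, (-1) ^ (σ i : ℕ)) : ℝ) : ℂ) := by
  have hm : Measurable fun u => (corrProd ℓ s u : ℂ) :=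
    Complex.measurable_ofReal.comp (continuous_corrProd ℓ s).measurable
  have ha : ∑ i : Fin (2 * d + 1 + 1), n * (-1) ^ (σ i : ℕ) = 0 := by
    rw [← Finset.mul_sum, Equiv.sum_comp σ fun i : Fin (2 * d + 1 + 1) => (-1 : ℤ) ^ (i : ℕ),
      sum_alternating, mul_zero]
  have e := integral_prod_increments hm (fun i => n * (-1) ^ (σ i : ℕ)) ha
  have hc : Continuous fun t : Fin (2 * d + 1 + 1) → UnitAddCircle =>
      (∏ j : Fin (2 * d + 1), (corrProd ℓ s (t j.succ - t j.castSucc) : ℂ)) *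
        ∏ i, fourier (n * (-1) ^ (σ i : ℕ)) (t i) := by
    refine (continuous_finsetProd _ fun j _ => ?_).mul (continuous_finsetProd _ fun i _ => ?_)
    · exact Complex.continuous_ofReal.comp ((continuous_corrProd ℓ s).comp
        ((continuous_apply _).sub (continuous_apply _)))
    · exact (fourier _).continuous.comp (continuous_apply i)
  have hmp := measurePreserving_comp_perm σ
  have e2 := integral_map (μ := volume) (f := fun t : Fin (2 * d + 1 + 1) → UnitAddCircle =>
      (∏ j : Fin (2 * d + 1), (corrProd ℓ s (t j.succ - t j.castSucc) : ℂ)) *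
        ∏ i, fourier (n * (-1) ^ (σ i : ℕ)) (t i)) hmp.measurable.aemeasurable
      hc.aestronglyMeasurable
  rw [hmp.map_eq, e] at e2
  push_cast
  simp only [chainProd, fourier_altSum_perm σ, ← integral_corrProd_mul_fourier h0 h hs,
    Finset.mul_sum] at e2 ⊢
  push_cast
  rw [e2]

theorem integral_chainProd_mul_fejer (h0 : ∀ n, 0 ≤ ℓ n) (h : ∀ n, ℓ n < 1)
    (hs : ∀ k ∈ s, ℓ k ≤ 1 / 2) (σ : Equiv.Perm (Fin (2 * d + 1 + 1))) (L : ℕ) :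
    ∫ t : Fin (2 * d + 1 + 1) → UnitAddCircle, chainProd ℓ s σ t * fejer L (altSum d t) =
      ∑ p ∈ Finset.range L, ∑ q ∈ Finset.range L, ∏ j : Fin (2 * d + 1),
        corrCoeff ℓ s (((p : ℤ) - q) * ∑ i ∈ Finset.Ici j.succ, (-1) ^ (σ i : ℕ)) := by
  apply Complex.ofReal_injective
  have hi : ∀ n : ℤ, Integrable (fun t : Fin (2 * d + 1 + 1) → UnitAddCircle =>
      (chainProd ℓ s σ t : ℂ) * fourier n (altSum d t)) volume := fun n =>
    ((Complex.continuous_ofReal.comp (continuous_chainProd σ)).mul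
      ((fourier n).continuous.comp (continuous_altSum d))).integrable_of_hasCompactSupport
      (HasCompactSupport.of_compactSpace _)
  have e : ∀ t : Fin (2 * d + 1 + 1) → UnitAddCircle,
      ((chainProd ℓ s σ t * fejer L (altSum d t) : ℝ) : ℂ) =
      ∑ p ∈ Finset.range L, ∑ q ∈ Finset.range L,
        (chainProd ℓ s σ t : ℂ) * fourier ((p : ℤ) - q) (altSum d t) := by
    intro t
    rw [Complex.ofReal_mul, fejer_eq_sum, Finset.mul_sum]
    exact Finset.sum_congr rfl fun p _ => Finset.mul_sum _ _ _
  rw [← integral_complex_ofReal]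
  simp only [e]
  rw [integral_finsetSum _ fun p _ => integrable_finsetSum _ fun q _ => hi _]
  rw [Complex.ofReal_sum]
  refine Finset.sum_congr rfl fun p _ => ?_
  rw [integral_finsetSum _ fun q _ => hi _, Complex.ofReal_sum]
  exact Finset.sum_congr rfl fun q _ => integral_chainProd_mul_fourier h0 h hs σ _

/-- The `d + 1` factors of even index are kept, since their frequency multipliers will be nonzero,
and their product is at most the sum of their powers of order `d + 1`. The other factors are bounded
by `h1`, with a generous exponent. -/
theorem prod_corrCoeff_le {h1 : ℝ} (hh : 1 ≤ h1) (hb : ∀ n, corrCoeff ℓ s n ≤ h1)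
    (a : Fin (2 * d + 1) → ℤ) :
    ∏ j, corrCoeff ℓ s (a j) ≤
      h1 ^ (2 * d + 1) * ∑ j ∈ evenIndices d, corrCoeff ℓ s (a j) ^ (d + 1) := by
  have hJ : (evenIndices d).Nonempty := Finset.card_pos.1 (by rw [card_evenIndices]; omega)
  have hn : ∀ j, 0 ≤ corrCoeff ℓ s (a j) := fun j => corrCoeff_nonneg ℓ s _
  rw [← Finset.prod_mul_prod_compl (evenIndices d), mul_comm]
  refine mul_le_mul ?_ ?_ (Finset.prod_nonneg fun j _ => hn j) (by positivity)
  · calc ∏ j ∈ (evenIndices d)ᶜ, corrCoeff ℓ s (a j) ≤ ∏ _j ∈ (evenIndices d)ᶜ, h1 :=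
          Finset.prod_le_prod (fun j _ => hn j) fun j _ => hb _
      _ = h1 ^ ((evenIndices d)ᶜ).card := Finset.prod_const _
      _ ≤ _ := pow_le_pow_right₀ hh ((Finset.card_le_univ _).trans_eq (Fintype.card_fin _))
  · simpa only [card_evenIndices] using prod_le_sum_pow hJ fun j _ => hn j

/-- The finitely many long arcs are bounded by their sup norm. For the short ones the permutation
depends on `t` but not on the arc, so the bounds multiply to a single chain; summing over all
permutations removes the dependence on `t`. -/
theorem prod_mixedMoment_le (h0 : ∀ n, 0 ≤ ℓ n) (h : ∀ n, ℓ n < 1) {N n0 : ℕ}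
    (hn0 : ∀ k, n0 ≤ k → ℓ k ≤ 1 / (4 * ((N : ℝ) + 2))) {S : ℝ} (hS : ∀ s : Finset ℕ,
      ∑ k ∈ s, ℓ k ^ 2 ≤ S) (n : ℕ) (t : Fin (N + 1) → UnitAddCircle) :
    ∏ k ∈ Finset.range n, mixedMoment (ℓ k) t ≤
      (∏ k ∈ Finset.range n0, (1 / (1 - ℓ k)) ^ (N + 1)) * Real.exp (6 * ((N : ℝ) + 1) * S) *
        ∑ σ : Equiv.Perm (Fin (N + 1)),
          chainProd ℓ ((Finset.range n).filter fun k => n0 ≤ k) σ t := by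
  have hN : 1 / (4 * ((N : ℝ) + 2)) ≤ 1 / 8 := by
    apply one_div_le_one_div_of_le <;> [norm_num; (have := N.cast_nonneg (α := ℝ); linarith)]
  set s0 := (Finset.range n).filter fun k => n0 ≤ k with hs0
  set s1 := (Finset.range n).filter fun k => ¬ n0 ≤ k with hs1
  have hpos : ∀ u, 0 < corrProd ℓ s0 u := fun u => corrProd_pos (fun k hk => by
    linarith [hn0 k (Finset.mem_filter.1 hk).2]) u
  have hmm : ∀ k, 0 ≤ mixedMoment (ℓ k) t := fun k => mixedMoment_nonneg (h k) t
  have hone : ∀ k, 1 ≤ (1 / (1 - ℓ k)) ^ (N + 1) := fun k =>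
    one_le_pow₀ (one_le_one_div (by linarith [h k]) (by linarith [h0 k]))
  obtain ⟨σ, hσ⟩ := exists_perm_mixedMoment_le t
  have hA : ∏ k ∈ s1, mixedMoment (ℓ k) t ≤
      ∏ k ∈ Finset.range n0, (1 / (1 - ℓ k)) ^ (N + 1) := by
    calc ∏ k ∈ s1, mixedMoment (ℓ k) t ≤ ∏ k ∈ s1, (1 / (1 - ℓ k)) ^ (N + 1) :=
          Finset.prod_le_prod (fun k _ => hmm k) fun k _ => by
            simpa using mixedMoment_le (h k) t
      _ ≤ _ := Finset.prod_le_prod_of_subset_of_one_le (fun k hk => by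
            have := (Finset.mem_filter.1 hk).2
            exact Finset.mem_range.2 (by omega)) (fun k _ => zero_le_one.trans (hone k))
            fun k _ _ => hone k
  have hB : ∏ k ∈ s0, mixedMoment (ℓ k) t ≤
      Real.exp (6 * ((N : ℝ) + 1) * S) * chainProd ℓ s0 σ t := by
    calc ∏ k ∈ s0, mixedMoment (ℓ k) t
        ≤ ∏ k ∈ s0, (Real.exp (6 * ((N : ℝ) + 1) * ℓ k ^ 2) *
          ∏ j : Fin N, corr (ℓ k) (t (σ j.succ) - t (σ j.castSucc))) :=
          Finset.prod_le_prod (fun k _ => hmm k) fun k hk =>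
            hσ _ (h0 k) (hn0 k (Finset.mem_filter.1 hk).2)
      _ = Real.exp (6 * ((N : ℝ) + 1) * ∑ k ∈ s0, ℓ k ^ 2) * chainProd ℓ s0 σ t := by
          rw [Finset.prod_mul_distrib, ← Real.exp_sum, Finset.prod_comm, Finset.mul_sum]
          rfl
      _ ≤ _ := by
          refine mul_le_mul_of_nonneg_right (Real.exp_le_exp.2 ?_)
            (Finset.prod_nonneg fun j _ => (hpos _).le)
          exact mul_le_mul_of_nonneg_left (hS _) (by positivity)
  calc ∏ k ∈ Finset.range n, mixedMoment (ℓ k) t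
      = (∏ k ∈ s1, mixedMoment (ℓ k) t) * ∏ k ∈ s0, mixedMoment (ℓ k) t := by
        rw [mul_comm, hs0, hs1, Finset.prod_filter_mul_prod_filter_not]
    _ ≤ (∏ k ∈ Finset.range n0, (1 / (1 - ℓ k)) ^ (N + 1)) *
          (Real.exp (6 * ((N : ℝ) + 1) * S) * chainProd ℓ s0 σ t) :=
        mul_le_mul hA hB (Finset.prod_nonneg fun k _ => hmm k)
          (Finset.prod_nonneg fun k _ => zero_le_one.trans (hone k))
    _ ≤ _ := by
        rw [mul_assoc (∏ k ∈ Finset.range n0, (1 / (1 - ℓ k)) ^ (N + 1))]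
        refine mul_le_mul_of_nonneg_left (mul_le_mul_of_nonneg_left ?_ (Real.exp_pos _).le)
          (Finset.prod_nonneg fun k _ => zero_le_one.trans (hone k))
        exact Finset.single_le_sum (f := fun σ => chainProd ℓ s0 σ t)
          (fun τ _ => Finset.prod_nonneg fun j _ => (hpos _).le) (Finset.mem_univ σ)

/-- The moments of the Fourier coefficients are summable, uniformly in the number of factors. -/
theorem Admissible.exists_sum_fourierMoment_le (hadm : Admissible ℓ d) : ∃ C : ℝ,
    ∀ n K : ℕ, ∑ k ∈ Finset.Icc (-(K : ℤ)) K, fourierMoment ℓ (Finset.range n) d k ≤ C := by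
  have h0 : ∀ n, 0 ≤ ℓ n := fun n => (hadm.pos n).le
  obtain ⟨h1, S2, hh1, hS2, hbd⟩ := hadm.exists_corrCoeff_bounds
  have hδ : (0 : ℝ) < 1 / (4 * (((2 * d + 1 : ℕ) : ℝ) + 2)) := by positivity
  have hδ' : 1 / (4 * (((2 * d + 1 : ℕ) : ℝ) + 2)) ≤ 1 / 8 := by
    apply one_div_le_one_div_of_le <;>
      [norm_num; (have := (2 * d + 1).cast_nonneg (α := ℝ); linarith)]
  obtain ⟨n0, hn0⟩ := hadm.exists_le hδ
  -- `B` is the constant of `prod_mixedMoment_le` for `2 d + 2` points. `R` is the number of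
  -- orderings times the bound for one ordering, in which `d + 1` tails contribute at most `S2`
  -- each.
  set B := (∏ k ∈ Finset.range n0, (1 / (1 - ℓ k)) ^ (2 * d + 1 + 1)) *
    Real.exp (6 * (((2 * d + 1 : ℕ) : ℝ) + 1) * ∑' n, ℓ n ^ 2) with hB
  have hB0 : 0 ≤ B := mul_nonneg (Finset.prod_nonneg fun k _ =>
    pow_nonneg (one_div_nonneg.2 (by linarith [hadm.lt_one k])) _) (Real.exp_pos _).le
  set R := (Fintype.card (Equiv.Perm (Fin (2 * d + 1 + 1))) : ℝ) *
    (h1 ^ (2 * d + 1) * ((d + 1 : ℕ) * S2)) with hR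
  have hR0 : 0 ≤ R := by positivity
  have main : ∀ n L : ℕ, ∑ p ∈ Finset.range L, ∑ q ∈ Finset.range L,
      fourierMoment ℓ (Finset.range n) d ((p : ℤ) - q) ≤ L * (B * R) := by
    intro n L
    set s0 := (Finset.range n).filter fun k => n0 ≤ k with hs0
    have hs4 : ∀ k ∈ s0, ℓ k ≤ 1 / 4 := fun k hk => by
      linarith [hn0 k (Finset.mem_filter.1 hk).2]
    have hs2 : ∀ k ∈ s0, ℓ k ≤ 1 / 2 := fun k hk => by linarith [hs4 k hk]
    obtain ⟨hb1, hb2⟩ := hbd s0 hs4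
    have hfc : Continuous fun t : Fin (2 * d + 1 + 1) → UnitAddCircle => fejer L (altSum d t) :=
      (continuous_fejer L).comp (continuous_altSum d)
    have hσi : ∀ σ : Equiv.Perm (Fin (2 * d + 1 + 1)),
        Integrable (fun t => chainProd ℓ s0 σ t * fejer L (altSum d t)) volume := fun σ =>
      ((continuous_chainProd σ).mul hfc).integrable_of_hasCompactSupport
        (HasCompactSupport.of_compactSpace _)
    have hσ : ∀ σ : Equiv.Perm (Fin (2 * d + 1 + 1)),
        ∫ t, chainProd ℓ s0 σ t * fejer L (altSum d t) ≤
          L * (h1 ^ (2 * d + 1) * ((d + 1 : ℕ) * S2)) := by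
      intro σ
      rw [integral_chainProd_mul_fejer h0 hadm.lt_one hs2 σ L]
      calc _ ≤ ∑ p ∈ Finset.range L, ∑ q ∈ Finset.range L, h1 ^ (2 * d + 1) *
            ∑ j ∈ evenIndices d, corrCoeff ℓ s0
              (((p : ℤ) - q) * ∑ i ∈ Finset.Ici j.succ, (-1) ^ (σ i : ℕ)) ^ (d + 1) :=
            Finset.sum_le_sum fun p _ => Finset.sum_le_sum fun q _ => prod_corrCoeff_le hh1 hb1 _
        _ = h1 ^ (2 * d + 1) * ∑ j ∈ evenIndices d, ∑ p ∈ Finset.range L, ∑ q ∈ Finset.range L,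
              corrCoeff ℓ s0
                (((p : ℤ) - q) * ∑ i ∈ Finset.Ici j.succ, (-1) ^ (σ i : ℕ)) ^ (d + 1) := by
            simp only [← Finset.mul_sum]
            congr 1
            rw [Finset.sum_comm]
            conv_lhs =>
              enter [2, p]
              rw [Finset.sum_comm]
            rw [Finset.sum_comm]
            conv_rhs =>
              enter [2, p]
              rw [Finset.sum_comm]
        _ ≤ h1 ^ (2 * d + 1) * ∑ _j ∈ evenIndices d, L * S2 := by
            refine mul_le_mul_of_nonneg_left (Finset.sum_le_sum fun j hj => ?_) (by positivity)
            exact sum_sum_sub_mul_le (b := fun n => corrCoeff ℓ s0 n ^ (d + 1)) hb2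
              (sum_Ici_alternating_ne_zero σ (Finset.mem_filter.1 hj).2) L
        _ = _ := by
            rw [Finset.sum_const, card_evenIndices, nsmul_eq_mul]; ring
    rw [sum_sum_fourierMoment hadm.lt_one L]
    have hi1 : Integrable (fun t : Fin (2 * d + 1 + 1) → UnitAddCircle =>
        (∏ k ∈ Finset.range n, mixedMoment (ℓ k) t) * fejer L (altSum d t)) volume :=
      integrable_prod_mixedMoment_mul hadm.lt_one _ hfc
    have hi2 : Integrable (fun t : Fin (2 * d + 1 + 1) → UnitAddCircle =>
        B * ∑ σ, chainProd ℓ s0 σ t * fejer L (altSum d t)) volume :=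
      (integrable_finsetSum _ fun σ _ => hσi σ).const_mul B
    calc _ ≤ ∫ t : Fin (2 * d + 1 + 1) → UnitAddCircle,
          B * ∑ σ, chainProd ℓ s0 σ t * fejer L (altSum d t) := by
          refine integral_mono hi1 hi2 fun t => ?_
          simp only
          rw [← Finset.sum_mul, ← mul_assoc]
          exact mul_le_mul_of_nonneg_right
            (prod_mixedMoment_le h0 hadm.lt_one hn0 hadm.sum_sq_le n t) (fejer_nonneg L _)
      _ = B * ∑ σ, ∫ t, chainProd ℓ s0 σ t * fejer L (altSum d t) := by
          rw [integral_const_mul, integral_finsetSum _ fun σ _ => hσi σ]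
      _ ≤ B * ∑ _σ : Equiv.Perm (Fin (2 * d + 1 + 1)),
            L * (h1 ^ (2 * d + 1) * ((d + 1 : ℕ) * S2)) :=
          mul_le_mul_of_nonneg_left (Finset.sum_le_sum fun σ _ => hσ σ) hB0
      _ = _ := by
          rw [Finset.sum_const, Finset.card_univ, nsmul_eq_mul, hR]; ring
  have key : ∀ n K : ℕ, 0 < K →
      ∑ k ∈ Finset.Icc (-(K : ℤ)) K, fourierMoment ℓ (Finset.range n) d k ≤ 3 * (B * R) := by
    intro n K hK
    have h3 := (mul_sum_Icc_le (b := fourierMoment ℓ (Finset.range n) d)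
      (fun k => fourierMoment_nonneg k) K).trans (main n (3 * K))
    have hK' : (0 : ℝ) < K := by exact_mod_cast hK
    push_cast at h3
    refine le_of_mul_le_mul_left (h3.trans_eq (by ring)) hK'
  refine ⟨3 * (B * R), fun n K => ?_⟩
  refine le_trans (Finset.sum_le_sum_of_subset_of_nonneg ?_ fun k _ _ => fourierMoment_nonneg k)
    (key n (K + 1) K.succ_pos)
  exact Finset.Icc_subset_Icc (by push_cast; linarith) (by push_cast; linarith)

end

/-! ### Almost sure decay of the Fourier coefficients of the limit. -/

section

variable {ℓ : ℕ → ℝ} {d : ℕ}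

/-- The Fourier coefficients of the random densities are measurable functions of the sequence of
endpoints. -/
theorem measurable_integral_partialDensity_mul_fourier (ℓ : ℕ → ℝ) (s : Finset ℕ) (n : ℤ) :
    Measurable fun x => ∫ t, (partialDensity ℓ s x t : ℂ) * fourier n t := by
  have : Measurable fun z : (ℕ → UnitAddCircle) × UnitAddCircle =>
      (partialDensity ℓ s z.1 z.2 : ℂ) * fourier n z.2 :=
    (Complex.measurable_ofReal.comp (measurable_partialDensity_uncurry ℓ s)).mul
      ((measurable_fourier n).comp measurable_snd)
  exact (this.stronglyMeasurable.integral_prod_right').measurable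

theorem norm_integral_partialDensity_mul_fourier_le (h : ∀ n, ℓ n < 1) (s : Finset ℕ)
    (x : ℕ → UnitAddCircle) (n : ℤ) :
    ‖∫ t, (partialDensity ℓ s x t : ℂ) * fourier n t‖ ≤ ∏ k ∈ s, (1 / (1 - ℓ k)) := by
  refine (norm_integral_le_of_norm_le_const (C := ∏ k ∈ s, (1 / (1 - ℓ k)))
    (ae_of_all _ fun t => ?_)).trans_eq (by simp)
  rw [norm_mul, fourier_apply, Circle.norm_coe, mul_one, Complex.norm_real,
    Real.norm_of_nonneg (partialDensity_nonneg h s x t)]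
  exact partialDensity_le h s x t

theorem lintegral_enorm_pow_eq (h : ∀ n, ℓ n < 1) (s : Finset ℕ) (n : ℤ) :
    ∫⁻ x, ‖∫ t, (partialDensity ℓ s x t : ℂ) * fourier n t‖ₑ ^ (2 * (d + 1)) ∂unifSeq =
      ENNReal.ofReal (fourierMoment ℓ s d n) := by
  have hm : Measurable fun x =>
      ‖∫ t, (partialDensity ℓ s x t : ℂ) * fourier n t‖ ^ (2 * (d + 1)) :=
    (measurable_integral_partialDensity_mul_fourier ℓ s n).norm.pow_const _
  rw [fourierMoment, ofReal_integral_eq_lintegral_ofReal]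
  · refine lintegral_congr fun x => ?_
    rw [ENNReal.ofReal_pow (norm_nonneg _), ofReal_norm]
  · refine Integrable.of_bound hm.aestronglyMeasurable
      ((∏ k ∈ s, (1 / (1 - ℓ k))) ^ (2 * (d + 1))) (ae_of_all _ fun x => ?_)
    rw [Real.norm_of_nonneg (by positivity)]
    exact pow_le_pow_left₀ (norm_nonneg _)
      (norm_integral_partialDensity_mul_fourier_le h s x n) _
  · exact ae_of_all _ fun x => by positivity

theorem isRajchman_of_tsum_ne_top (μ : Measure UnitAddCircle) {m : ℕ} (hm : m ≠ 0)
    (h : ∑' k : ℤ, ‖∫ t, fourier k t ∂μ‖ₑ ^ m ≠ ∞) : IsRajchman μ := by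
  have h1 := ENNReal.tendsto_cofinite_zero_of_tsum_ne_top h
  have h2 : Tendsto (fun k : ℤ => ‖∫ t, fourier k t ∂μ‖ₑ) cofinite (𝓝 0) := by
    have h3 := (ENNReal.continuous_rpow_const (y := (m : ℝ)⁻¹)).tendsto 0 |>.comp h1
    rw [ENNReal.zero_rpow_of_pos (by positivity)] at h3
    refine h3.congr fun k => ?_
    simp only [Function.comp_apply]
    rw [← ENNReal.rpow_natCast, ← ENNReal.rpow_mul, mul_inv_cancel₀ (by exact_mod_cast hm),
      ENNReal.rpow_one]
  have h4 : Tendsto (fun k : ℤ => ∫ t, fourier k t ∂μ) cofinite (𝓝 0) :=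
    tendsto_zero_iff_enorm_tendsto_zero.2 h2
  exact h4.comp (neg_injective.tendsto_cofinite)

theorem tendsto_integral_partialDensity_mul_fourier (h : ∀ n, ℓ n < 1) {x : ℕ → UnitAddCircle}
    {ν : FiniteMeasure UnitAddCircle} (hν : Tendsto (approxMeasure ℓ x) atTop (𝓝 ν)) (k : ℤ) :
    Tendsto (fun n => ∫ t, (partialDensity ℓ (Finset.range n) x t : ℂ) * fourier k t) atTop
      (𝓝 (∫ t, fourier k t ∂(ν : Measure UnitAddCircle))) := by
  have h1 := (FiniteMeasure.tendsto_iff_forall_integral_rclike_tendsto ℂ).1 hν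
    (BoundedContinuousFunction.mkOfCompact (fourier k))
  refine h1.congr fun n => ?_
  simp only [BoundedContinuousFunction.mkOfCompact_apply]
  rw [integral_approxMeasure h]
  rfl

/-- Almost surely, every weak limit has Fourier coefficients tending to zero. -/
theorem Admissible.ae_isRajchman (hadm : Admissible ℓ d) : ∀ᵐ x ∂unifSeq,
    ∀ ν : FiniteMeasure UnitAddCircle, Tendsto (approxMeasure ℓ x) atTop (𝓝 ν) →
      IsRajchman (ν : Measure UnitAddCircle) := by
  obtain ⟨C, hC⟩ := hadm.exists_sum_fourierMoment_le
  set c : ℕ → ℤ → (ℕ → UnitAddCircle) → ℝ≥0∞ := fun n k x =>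
    ‖∫ t, (partialDensity ℓ (Finset.range n) x t : ℂ) * fourier k t‖ₑ ^ (2 * (d + 1)) with hc
  have hcm : ∀ n k, Measurable (c n k) := fun n k =>
    (measurable_integral_partialDensity_mul_fourier ℓ _ k).enorm.pow_const _
  -- Fatou in `n` for finitely many frequencies, followed by monotone convergence in `K`. The lower
  -- limit makes sense without any convergence, and equals the sum for the limit measure where one
  -- exists.
  set G : ℕ → (ℕ → UnitAddCircle) → ℝ≥0∞ := fun K x =>
    liminf (fun n => ∑ k ∈ Finset.Icc (-(K : ℤ)) K, c n k x) atTop with hG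
  have hsm : ∀ K n, Measurable fun x => ∑ k ∈ Finset.Icc (-(K : ℤ)) K, c n k x := fun K n =>
    Finset.measurable_sum _ fun k _ => hcm n k
  have hGm : ∀ K, Measurable (G K) := fun K => Measurable.liminf fun n => hsm K n
  have hGmono : Monotone G := by
    intro K K' hKK' x
    refine liminf_le_liminf (Eventually.of_forall fun n => ?_)
    refine Finset.sum_le_sum_of_subset (Finset.Icc_subset_Icc ?_ ?_) <;> simpa using hKK'
  have hint : ∫⁻ x, ⨆ K, G K x ∂unifSeq ≤ ENNReal.ofReal C := by
    rw [lintegral_iSup hGm hGmono]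
    refine iSup_le fun K => (lintegral_liminf_le (hsm K)).trans ?_
    refine liminf_le_of_le (by isBoundedDefault) fun b hb => ?_
    obtain ⟨n, hn⟩ := hb.exists
    refine hn.trans ?_
    rw [lintegral_finsetSum _ fun k _ => hcm n k]
    simp only [hc, lintegral_enorm_pow_eq hadm.lt_one]
    rw [← ENNReal.ofReal_sum_of_nonneg fun k _ => fourierMoment_nonneg k]
    exact ENNReal.ofReal_le_ofReal (hC n K)
  filter_upwards [ae_lt_top (Measurable.iSup hGm) (hint.trans_lt ENNReal.ofReal_lt_top).ne]
    with x hx ν hν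
  refine isRajchman_of_tsum_ne_top _ (m := 2 * (d + 1)) (by omega) (ne_of_lt ?_)
  refine lt_of_le_of_lt ?_ hx
  rw [ENNReal.tsum_eq_iSup_sum]
  refine iSup_le fun F => ?_
  obtain ⟨K, hK⟩ : ∃ K : ℕ, F ⊆ Finset.Icc (-(K : ℤ)) K := by
    refine ⟨F.sup Int.natAbs, fun k hk => ?_⟩
    have := Finset.le_sup (f := Int.natAbs) hk
    rw [Finset.mem_Icc]
    omega
  refine (Finset.sum_le_sum_of_subset hK).trans (le_trans (le_of_eq ?_) (le_iSup (fun K => G K x) K))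
  have ht : Tendsto (fun n => ∑ k ∈ Finset.Icc (-(K : ℤ)) K, c n k x) atTop
      (𝓝 (∑ k ∈ Finset.Icc (-(K : ℤ)) K,
        ‖∫ t, fourier k t ∂(ν : Measure UnitAddCircle)‖ₑ ^ (2 * (d + 1)))) := by
    refine tendsto_finsetSum _ fun k _ => ?_
    have h1 := (tendsto_integral_partialDensity_mul_fourier hadm.lt_one hν k).enorm
    exact ((ENNReal.continuous_pow (2 * (d + 1))).tendsto _).comp h1
  exact ht.liminf_eq.symm

end

/-! ### The second moment method, and survival with positive probability. -/

section

variable {ℓ : ℕ → ℝ} {d : ℕ}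

/-- A second moment bound keeps a random variable away from zero on a large part of the set that
carries it. -/
theorem measure_le_mul_measure_half_le {α : Type*} [MeasurableSpace α] {μ : Measure α}
    {D : Set α} (hD : MeasurableSet D) (hfin : μ D ≠ ∞) {X : α → ℝ≥0∞} (hX : Measurable X)
    (hXD : ∀ x ∉ D, X x = 0) (h1 : ∫⁻ x, X x ∂μ = μ D) {C : ℝ≥0∞} (hC0 : C ≠ 0) (hC : C ≠ ∞)
    (h2 : ∫⁻ x, X x ^ 2 ∂μ ≤ C * μ D) : μ D ≤ 16 * C * μ {x | 2⁻¹ ≤ X x} := by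
  set H := {x | 2⁻¹ ≤ X x} with hH
  have hHm : MeasurableSet H := measurableSet_le measurable_const hX
  have hR0 : 4 * C ≠ 0 := mul_ne_zero (by norm_num) hC0
  have hRT : 4 * C ≠ ∞ := ENNReal.mul_ne_top (by norm_num) hC
  -- Three cases: `X < 1 / 2`, or `X ≤ 4 C` on `H`, or `X ≤ X² / (4 C)`. Integration gives `μ D ≤ μ
  -- D / 2 + 4 C μ H + μ D / 4`, whence the constant `16`.
  have hpt : ∀ x, X x ≤ D.indicator (fun _ => 2⁻¹) x + H.indicator (fun _ => 4 * C) x +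
      (4 * C)⁻¹ * X x ^ 2 := by
    intro x
    by_cases hxH : x ∈ H
    · rcases le_total (X x) (4 * C) with hle | hle
      · rw [Set.indicator_of_mem hxH]
        exact le_add_right (le_add_left hle)
      · refine le_add_left ?_
        calc X x = (4 * C)⁻¹ * (4 * C) * X x := by rw [ENNReal.inv_mul_cancel hR0 hRT, one_mul]
          _ ≤ (4 * C)⁻¹ * X x * X x := by gcongr
          _ = _ := by rw [sq, mul_assoc]
    · by_cases hxD : x ∈ D
      · rw [Set.indicator_of_mem hxD]
        exact le_add_right (le_add_right (not_le.1 hxH).le)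
      · rw [hXD x hxD]; exact zero_le
  have hi := lintegral_mono (μ := μ) hpt
  have hm12 : Measurable fun x => D.indicator (fun _ => (2⁻¹ : ℝ≥0∞)) x +
      H.indicator (fun _ => 4 * C) x :=
    (measurable_const.indicator hD).add (measurable_const.indicator hHm)
  rw [h1, lintegral_add_left hm12, lintegral_add_left (measurable_const.indicator hD),
    lintegral_indicator_const hD, lintegral_indicator_const hHm,
    lintegral_const_mul _ (hX.pow_const 2)] at hi
  have h3 : (4 * C)⁻¹ * ∫⁻ x, X x ^ 2 ∂μ ≤ 4⁻¹ * μ D := by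
    calc _ ≤ (4 * C)⁻¹ * (C * μ D) := by gcongr
      _ = 4⁻¹ * (C⁻¹ * C) * μ D := by
        rw [ENNReal.mul_inv (Or.inl (by norm_num)) (Or.inl (by norm_num))]; ring
      _ = _ := by rw [ENNReal.inv_mul_cancel hC0 hC, mul_one]
  have h4 := hi.trans (add_le_add_right h3 _)
  have hHfin : 4 * C * μ H ≠ ∞ ∨ 4 * C * μ H = ∞ := (em _).symm
  rcases hHfin with hHf | hHf
  · lift μ D to NNReal using hfin with a
    lift (4 * C * μ H) to NNReal using hHf with b hb
    have e : 16 * C * μ H = 4 * (4 * C * μ H) := by ring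
    rw [e, ← hb]
    have e2 : (2⁻¹ : ℝ≥0∞) = ((2⁻¹ : NNReal) : ℝ≥0∞) := by simp
    have e4 : (4⁻¹ : ℝ≥0∞) = ((4⁻¹ : NNReal) : ℝ≥0∞) := by simp
    rw [e2, e4] at h4
    norm_cast at h4 ⊢
    have h5 : (a : ℝ) ≤ 2⁻¹ * a + b + 4⁻¹ * a := by exact_mod_cast h4
    have : (a : ℝ) ≤ 4 * b := by linarith
    exact_mod_cast this
  · have e : 16 * C * μ H = 4 * (4 * C * μ H) := by ring
    rw [e, hHf]
    simp

/-- The mass of the random density with respect to a weight independent of the factors. -/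
theorem lintegral_weight_mul_partialDensity (h0 : ∀ n, 0 ≤ ℓ n) (h : ∀ n, ℓ n < 1) (s : Finset ℕ)
    {w : (ℕ → UnitAddCircle) → UnitAddCircle → ℝ≥0∞} (hw : Measurable (Function.uncurry w))
    (hws : ∀ k ∈ s, ∀ x u, w (Function.update x k u) = w x) :
    ∫⁻ x, (∫⁻ t, w x t * ENNReal.ofReal (partialDensity ℓ s x t)) ∂unifSeq =
      ∫⁻ x, (∫⁻ t, w x t) ∂unifSeq := by
  have hM := (measurable_partialDensity_uncurry ℓ s).ennreal_ofReal
  have hm : Measurable (Function.uncurry fun (x : ℕ → UnitAddCircle) t =>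
    w x t * ENNReal.ofReal (partialDensity ℓ s x t)) := hw.mul hM
  rw [lintegral_lintegral_swap hm.aemeasurable, lintegral_lintegral_swap hw.aemeasurable]
  refine lintegral_congr fun t => ?_
  have hZ : Measurable fun x => w x t := hw.comp measurable_prodMk_right
  exact lintegral_mul_partialDensity h0 h s (fun x => w x t) hZ
    (fun k hk x u => congrFun (hws k hk x u) t) t

/-- The square is a double integral; only the arcs in `s` are averaged, which leaves their two-point
moments against the weight. -/
theorem lintegral_weight_mul_partialDensity_sq (h : ∀ n, ℓ n < 1) (s : Finset ℕ)
    {w : (ℕ → UnitAddCircle) → UnitAddCircle → ℝ≥0∞} (hw : Measurable (Function.uncurry w))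
    (hws : ∀ k ∈ s, ∀ x u, w (Function.update x k u) = w x) :
    ∫⁻ x, (∫⁻ t, w x t * ENNReal.ofReal (partialDensity ℓ s x t)) ^ 2 ∂unifSeq =
      ∫⁻ x, (∫⁻ z : UnitAddCircle × UnitAddCircle, w x z.1 * w x z.2 *
        ENNReal.ofReal (∏ k ∈ s, mixedMoment (ℓ k) ![z.1, z.2])) ∂unifSeq := by
  have hM := (measurable_partialDensity_uncurry ℓ s).ennreal_ofReal
  have hm : Measurable (Function.uncurry fun (x : ℕ → UnitAddCircle) t =>
    w x t * ENNReal.ofReal (partialDensity ℓ s x t)) := hw.mul hM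
  have hx : ∀ x, Measurable fun t => w x t * ENNReal.ofReal (partialDensity ℓ s x t) := fun x =>
    hm.comp measurable_prodMk_left
  have hp1 : Measurable fun p : (ℕ → UnitAddCircle) × (UnitAddCircle × UnitAddCircle) =>
    (p.1, p.2.1) := measurable_fst.prodMk (measurable_fst.comp measurable_snd)
  have hp2 : Measurable fun p : (ℕ → UnitAddCircle) × (UnitAddCircle × UnitAddCircle) =>
    (p.1, p.2.2) := measurable_fst.prodMk (measurable_snd.comp measurable_snd)
  have e1 : ∀ x, (∫⁻ t, w x t * ENNReal.ofReal (partialDensity ℓ s x t)) ^ 2 =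
      ∫⁻ z : UnitAddCircle × UnitAddCircle, (w x z.1 * w x z.2) *
        ENNReal.ofReal (partialDensity ℓ s x z.1 * partialDensity ℓ s x z.2) := by
    intro x
    rw [sq, ← lintegral_prod_mul (hx x).aemeasurable (hx x).aemeasurable]
    refine lintegral_congr fun z => ?_
    rw [ENNReal.ofReal_mul (partialDensity_nonneg h s x _)]
    ring
  simp only [e1]
  have hw2 : Measurable fun p : (ℕ → UnitAddCircle) × (UnitAddCircle × UnitAddCircle) =>
      w p.1 p.2.1 * w p.1 p.2.2 := (hw.comp hp1).mul (hw.comp hp2)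
  have hM2 : Measurable fun p : (ℕ → UnitAddCircle) × (UnitAddCircle × UnitAddCircle) =>
      ENNReal.ofReal (partialDensity ℓ s p.1 p.2.1 * partialDensity ℓ s p.1 p.2.2) :=
    (((measurable_partialDensity_uncurry ℓ s).comp hp1).mul
      ((measurable_partialDensity_uncurry ℓ s).comp hp2)).ennreal_ofReal
  have hpair : Measurable fun z : UnitAddCircle × UnitAddCircle => ![z.1, z.2] :=
    measurable_pi_iff.2 fun i => by
      fin_cases i
      · exact measurable_fst
      · exact measurable_snd
  have hmm : Measurable fun p : (ℕ → UnitAddCircle) × (UnitAddCircle × UnitAddCircle) =>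
      ENNReal.ofReal (∏ k ∈ s, mixedMoment (ℓ k) ![p.2.1, p.2.2]) :=
    (Finset.measurable_prod s fun k _ =>
      (measurable_mixedMoment (ℓ k)).comp (hpair.comp measurable_snd)).ennreal_ofReal
  rw [lintegral_lintegral_swap (f := fun x (z : UnitAddCircle × UnitAddCircle) =>
    w x z.1 * w x z.2 * ENNReal.ofReal (partialDensity ℓ s x z.1 * partialDensity ℓ s x z.2))
    (hw2.mul hM2).aemeasurable, lintegral_lintegral_swap
    (f := fun x (z : UnitAddCircle × UnitAddCircle) =>
    w x z.1 * w x z.2 * ENNReal.ofReal (∏ k ∈ s, mixedMoment (ℓ k) ![z.1, z.2]))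
    (hw2.mul hmm).aemeasurable]
  refine lintegral_congr fun z => ?_
  have hZ : Measurable fun x => w x z.1 * w x z.2 := hw2.comp measurable_prodMk_right
  rw [lintegral_mul_partialDensity_mul h s (fun x => w x z.1 * w x z.2) hZ
    (fun k hk x u => by rw [hws k hk x u]), lintegral_mul_const _ hZ]

/-- The total mass of the random density. -/
def mass (ℓ : ℕ → ℝ) (n : ℕ) (x : ℕ → UnitAddCircle) : ℝ≥0∞ :=
  ∫⁻ t, ENNReal.ofReal (partialDensity ℓ (Finset.range n) x t)

theorem measurable_mass (ℓ : ℕ → ℝ) (n : ℕ) : Measurable (mass ℓ n) :=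
  (measurable_partialDensity_uncurry ℓ _).ennreal_ofReal.lintegral_prod_right'

/-- The event that the total masses do not tend to zero. -/
def survives (ℓ : ℕ → ℝ) : Set (ℕ → UnitAddCircle) := {x | 0 < limsup (fun n => mass ℓ n x) atTop}

theorem measurableSet_survives (ℓ : ℕ → ℝ) : MeasurableSet (survives ℓ) :=
  measurableSet_lt measurable_const (Measurable.limsup fun n => measurable_mass ℓ n)

theorem mem_survives_of_frequently {x : ℕ → UnitAddCircle} {δ : ℝ≥0∞} (hδ : 0 < δ)
    (h : ∃ᶠ n in atTop, δ ≤ mass ℓ n x) : x ∈ survives ℓ :=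
  hδ.trans_le (le_limsup_of_frequently_le h (by isBoundedDefault))

/-- Reverse Fatou for sets: continuity from above along the decreasing unions `⋃ k, H (n + k)`. -/
theorem le_measure_limsup_of_forall_le {α : Type*} [MeasurableSpace α] {μ : Measure α}
    [IsFiniteMeasure μ] {H : ℕ → Set α} (hH : ∀ n, MeasurableSet (H n)) {c : ℝ≥0∞} {n0 : ℕ}
    (h : ∀ n, n0 ≤ n → c ≤ μ (H n)) : c ≤ μ {x | ∃ᶠ n in atTop, x ∈ H n} := by
  have e : {x | ∃ᶠ n in atTop, x ∈ H n} = ⋂ n, ⋃ k, H (n + k) := by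
    ext x
    simp only [Set.mem_ofPred_eq, Set.mem_iInter, Set.mem_iUnion, frequently_atTop]
    refine forall_congr' fun n => ⟨fun ⟨b, hb, hx⟩ => ⟨b - n, by rwa [Nat.add_sub_cancel' hb]⟩,
      fun ⟨k, hk⟩ => ⟨n + k, by omega, hk⟩⟩
  rw [e]
  have ht := tendsto_measure_iInter_atTop (μ := μ) (s := fun n => ⋃ k, H (n + k))
    (fun n => (MeasurableSet.iUnion fun k => hH _).nullMeasurableSet)
    (fun n m hnm => Set.iUnion_subset fun k => by
      have : H (m + k) = H (n + (m - n + k)) := by congr 1; omega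
      rw [this]
      exact Set.subset_iUnion (fun k => H (n + k)) (m - n + k)) ⟨0, measure_ne_top _ _⟩
  refine ge_of_tendsto ht (eventually_atTop.2 ⟨n0, fun n hn => ?_⟩)
  exact (h n hn).trans (measure_mono (Set.subset_iUnion (fun k => H (n + k)) 0))

/-- The finitely many arcs longer than `1 / 4` are absorbed into the constant; for the others the
two-point moment is `corrProd`. -/
theorem Admissible.exists_prod_mixedMoment_two_le (hadm : Admissible ℓ d) :
    ∃ C : ℝ, 0 < C ∧ ∀ (n : ℕ) (s t : UnitAddCircle),
      ENNReal.ofReal (∏ k ∈ Finset.range n, mixedMoment (ℓ k) ![s, t]) ≤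
        ENNReal.ofReal C * kernelK ℓ (t - s) := by
  have h0 : ∀ n, 0 ≤ ℓ n := fun n => (hadm.pos n).le
  obtain ⟨n0, hn0⟩ := hadm.exists_le (δ := 1 / 4) (by norm_num)
  have hone : ∀ k, 1 ≤ (1 / (1 - ℓ k)) ^ 2 := fun k =>
    one_le_pow₀ (one_le_one_div (by linarith [hadm.lt_one k]) (by linarith [h0 k]))
  have hApos : 0 < ∏ k ∈ Finset.range n0, (1 / (1 - ℓ k)) ^ 2 :=
    Finset.prod_pos fun k _ => zero_lt_one.trans_le (hone k)
  refine ⟨(∏ k ∈ Finset.range n0, (1 / (1 - ℓ k)) ^ 2) * Real.exp (4 * ∑' n, ℓ n ^ 2),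
    mul_pos hApos (Real.exp_pos _), fun n u t => ?_⟩
  have hmm : ∀ k, 0 ≤ mixedMoment (ℓ k) ![u, t] := fun k => mixedMoment_nonneg (hadm.lt_one k) _
  set s0 := (Finset.range n).filter fun k => n0 ≤ k with hs0
  set s1 := (Finset.range n).filter fun k => ¬ n0 ≤ k with hs1
  have hs4 : ∀ k ∈ s0, ℓ k ≤ 1 / 4 := fun k hk => hn0 k (Finset.mem_filter.1 hk).2
  have hA : ∏ k ∈ s1, mixedMoment (ℓ k) ![u, t] ≤
      ∏ k ∈ Finset.range n0, (1 / (1 - ℓ k)) ^ 2 := by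
    calc ∏ k ∈ s1, mixedMoment (ℓ k) ![u, t] ≤ ∏ k ∈ s1, (1 / (1 - ℓ k)) ^ 2 :=
          Finset.prod_le_prod (fun k _ => hmm k) fun k _ => by
            simpa using mixedMoment_le (hadm.lt_one k) ![u, t]
      _ ≤ _ := Finset.prod_le_prod_of_subset_of_one_le (fun k hk => by
            have := (Finset.mem_filter.1 hk).2
            exact Finset.mem_range.2 (by omega)) (fun k _ => zero_le_one.trans (hone k))
            fun k _ _ => hone k
  have hB : ∏ k ∈ s0, mixedMoment (ℓ k) ![u, t] = corrProd ℓ s0 (t - u) :=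
    Finset.prod_congr rfl fun k hk => mixedMoment_two (h0 k) (by linarith [hs4 k hk]) u t
  rw [← Finset.prod_filter_mul_prod_filter_not (Finset.range n) fun k => n0 ≤ k, hB, mul_comm,
    ENNReal.ofReal_mul (Finset.prod_nonneg fun k _ => hmm k), ENNReal.ofReal_mul hApos.le, mul_assoc]
  exact mul_le_mul' (ENNReal.ofReal_le_ofReal hA) (ofReal_corrProd_le h0 hs4 (hadm.sum_sq_le s0) _)

theorem lintegral_prod_sub (f : UnitAddCircle → ℝ≥0∞) (hf : Measurable f) :
    ∫⁻ z : UnitAddCircle × UnitAddCircle, f (z.2 - z.1) = ∫⁻ v, f v := by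
  have hm : Measurable fun z : UnitAddCircle × UnitAddCircle => f (z.2 - z.1) :=
    hf.comp (measurable_snd.sub measurable_fst)
  rw [Measure.volume_eq_prod, lintegral_prod _ hm.aemeasurable]
  simp [lintegral_sub_right_eq_self f]

/-- The total masses stay away from zero with positive probability. -/
theorem Admissible.measure_survives_pos (hadm : Admissible ℓ d) : 0 < unifSeq (survives ℓ) := by
  have h0 : ∀ n, 0 ≤ ℓ n := fun n => (hadm.pos n).le
  obtain ⟨C, hC0, hC⟩ := hadm.exists_prod_mixedMoment_two_le
  set c := ENNReal.ofReal C * ∫⁻ v, kernelK ℓ v with hc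
  have hcT : c ≠ ∞ := ENNReal.mul_ne_top ENNReal.ofReal_ne_top hadm.lintegral_kernelK_lt_top.ne
  have hc0 : c ≠ 0 := by
    refine mul_ne_zero (by simpa using hC0) (ne_of_gt (zero_lt_one.trans_le ?_))
    calc (1 : ℝ≥0∞) = ∫⁻ _v : UnitAddCircle, 1 := by simp
      _ ≤ _ := lintegral_mono fun v => one_le_kernelK ℓ v
  -- The mass has mean `1` and second moment at most `c`, so it is at least `1 / 2` with probability
  -- at least `1 / (16 c)`, uniformly in `n`.
  have hn : ∀ n, 1 ≤ 16 * c * unifSeq {x | 2⁻¹ ≤ mass ℓ n x} := by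
    intro n
    have e1 := lintegral_lintegral_partialDensity h0 hadm.lt_one (Finset.range n)
    have e2 := lintegral_weight_mul_partialDensity_sq hadm.lt_one (Finset.range n)
      (w := fun _ _ => 1) measurable_const (fun _ _ _ _ => rfl)
    simp only [one_mul] at e2
    have h2 : ∫⁻ x, mass ℓ n x ^ 2 ∂unifSeq ≤ c * unifSeq Set.univ := by
      simp only [mass, e2, lintegral_const]
      refine mul_le_mul_left ?_ _
      calc _ ≤ ∫⁻ z : UnitAddCircle × UnitAddCircle,
            ENNReal.ofReal C * kernelK ℓ (z.2 - z.1) := lintegral_mono fun z => hC n _ _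
        _ = c := by
          rw [lintegral_prod_sub (fun v => ENNReal.ofReal C * kernelK ℓ v)
            ((measurable_kernelK ℓ).const_mul _), lintegral_const_mul _ (measurable_kernelK ℓ)]
    have := measure_le_mul_measure_half_le (μ := unifSeq) MeasurableSet.univ
      (measure_ne_top _ _) (measurable_mass ℓ n) (fun x hx => (hx trivial).elim)
      (by simpa [mass] using e1) hc0 hcT h2
    simpa using this
  have hcc : 16 * c ≠ 0 := mul_ne_zero (by norm_num) hc0
  have hccT : 16 * c ≠ ∞ := ENNReal.mul_ne_top (by norm_num) hcT
  have hlow : (16 * c)⁻¹ ≤ unifSeq {x | ∃ᶠ n in atTop, x ∈ {x | 2⁻¹ ≤ mass ℓ n x}} := by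
    refine le_measure_limsup_of_forall_le
      (fun n => measurableSet_le measurable_const (measurable_mass ℓ n)) (n0 := 0) fun n _ => ?_
    rw [ENNReal.inv_le_iff_le_mul (fun _ => hcc) (fun h => (hccT h).elim)]
    exact hn n
  refine (ENNReal.inv_pos.2 hccT).trans_le (hlow.trans (measure_mono fun x hx => ?_))
  exact mem_survives_of_frequently (by norm_num) hx

end

/-! ### Growth of the kernel, and the choice of good scales. -/

section

variable {ℓ : ℕ → ℝ} {d : ℕ}

/-- The value of the kernel at distance `r` from the origin. -/
def radialK (ℓ : ℕ → ℝ) (r : ℝ) : ℝ := Real.exp (∑' k, max 0 (ℓ k - r))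

theorem radialK_eq {r : ℝ} {N : ℕ} (h : ∀ k, N ≤ k → ℓ k ≤ r) :
    radialK ℓ r = Real.exp (∑ k ∈ Finset.range N, max 0 (ℓ k - r)) := by
  rw [radialK, tsum_eq_sum fun k hk => ?_]
  rw [max_eq_left]
  linarith [h k (by simpa using hk)]

theorem radialK_pos (r : ℝ) : 0 < radialK ℓ r := Real.exp_pos _

theorem Admissible.summable_max (hadm : Admissible ℓ d) {r : ℝ} (hr : 0 < r) :
    Summable fun k => max 0 (ℓ k - r) := by
  obtain ⟨N, hN⟩ := hadm.exists_le hr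
  refine summable_of_ne_finset_zero (s := Finset.range N) fun k hk => ?_
  rw [max_eq_left]
  linarith [hN k (by simpa using hk)]

theorem exp_tsum_ofReal_eq {r : ℝ} (hs : Summable fun k => max 0 (ℓ k - r)) :
    EReal.exp ((∑' n, ENNReal.ofReal (ℓ n - r) : ℝ≥0∞) : EReal) =
      ENNReal.ofReal (radialK ℓ r) := by
  have e : ∑' n, ENNReal.ofReal (ℓ n - r) = ENNReal.ofReal (∑' k, max 0 (ℓ k - r)) := by
    rw [ENNReal.ofReal_tsum_of_nonneg (fun k => le_max_left _ _) hs]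
    refine tsum_congr fun k => ?_
    rcases le_total 0 (ℓ k - r) with h | h
    · rw [max_eq_right h]
    · rw [max_eq_left h, ENNReal.ofReal_of_nonpos h, ENNReal.ofReal_zero]
  rw [e, EReal.coe_ennreal_ofReal, max_eq_left (tsum_nonneg fun k => le_max_left _ _),
    EReal.exp_coe, radialK]

theorem kernelK_le_radialK {r : ℝ} (hs : Summable fun k => max 0 (ℓ k - r)) {t : UnitAddCircle}
    (ht : r ≤ ‖t‖) : kernelK ℓ t ≤ ENNReal.ofReal (radialK ℓ r) := by
  rw [← exp_tsum_ofReal_eq hs, kernelK]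
  refine EReal.exp_monotone (EReal.coe_ennreal_le_coe_ennreal_iff.2 (ENNReal.tsum_le_tsum fun k => ?_))
  exact ENNReal.ofReal_le_ofReal (by linarith)

theorem radialK_le_kernelK {r : ℝ} (hs : Summable fun k => max 0 (ℓ k - r)) {t : UnitAddCircle}
    (ht : ‖t‖ ≤ r) : ENNReal.ofReal (radialK ℓ r) ≤ kernelK ℓ t := by
  rw [← exp_tsum_ofReal_eq hs, kernelK]
  refine EReal.exp_monotone (EReal.coe_ennreal_le_coe_ennreal_iff.2 (ENNReal.tsum_le_tsum fun k => ?_))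
  exact ENNReal.ofReal_le_ofReal (by linarith)

theorem volume_closedBall_eq {r : ℝ} (hr : r ≤ 1 / 2) :
    volume (Metric.closedBall (0 : UnitAddCircle) r) = ENNReal.ofReal (2 * r) := by
  rw [AddCircle.volume_closedBall, min_eq_right (by linarith)]

theorem volume_closedBall_le (r : ℝ) :
    volume (Metric.closedBall (0 : UnitAddCircle) r) ≤ ENNReal.ofReal (2 * r) := by
  rw [AddCircle.volume_closedBall]
  exact ENNReal.ofReal_le_ofReal (min_le_right _ _)

/-- The polynomial growth bound for the kernel given by the integrability hypothesis. -/
theorem Admissible.exists_radialK_pow_le (hadm : Admissible ℓ d) :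
    ∃ C : ℝ, ∀ r : ℝ, 0 < r → r ≤ 1 / 2 → radialK ℓ r ^ (d + 1) * r ^ d ≤ C := by
  have hd : (1 : ℝ) ≤ d := by exact_mod_cast hadm.one_le
  have hd0 : (0 : ℝ) < d := by linarith
  set I := ∫⁻ t : Fin d → UnitAddCircle, (∏ i, kernelK ℓ (t i)) * kernelK ℓ (-∑ i, t i) with hI
  refine ⟨I.toReal * (d / 2) ^ d, fun r hr hr2 => ?_⟩
  have hs := hadm.summable_max hr
  have hrd : r / d ≤ r := div_le_self hr.le hd
  -- With radius `r / d` for each coordinate the sum stays within `r`, so all `d + 1` kernel factors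
  -- are at least `radialK ℓ r` on the box.
  set box : Set (Fin d → UnitAddCircle) :=
    Set.univ.pi fun _ => Metric.closedBall (0 : UnitAddCircle) (r / d) with hbox
  have hvol : volume box = ENNReal.ofReal (2 * (r / d)) ^ d := by
    rw [hbox, volume_pi_pi]
    simp only [volume_closedBall_eq (hrd.trans hr2)]
    rw [Finset.prod_const, Finset.card_univ, Fintype.card_fin]
  have hboxm : MeasurableSet box :=
    MeasurableSet.univ_pi fun _ => Metric.isClosed_closedBall.measurableSet
  have h1 : ENNReal.ofReal (radialK ℓ r) ^ (d + 1) * ENNReal.ofReal (2 * (r / d)) ^ d ≤ I := by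
    rw [← hvol, ← setLIntegral_const]
    refine (setLIntegral_mono' hboxm fun t ht => ?_).trans (setLIntegral_le_lintegral box _)
    have hti : ∀ i, ‖t i‖ ≤ r / d := fun i => by simpa using ht i trivial
    have hsum : ‖-∑ i, t i‖ ≤ r := by
      rw [norm_neg]
      refine (norm_sum_le _ _).trans ((Finset.sum_le_sum fun i _ => hti i).trans_eq ?_)
      rw [Finset.sum_const, Finset.card_univ, Fintype.card_fin, nsmul_eq_mul]
      field_simp
    calc ENNReal.ofReal (radialK ℓ r) ^ (d + 1)
        = (∏ _i : Fin d, ENNReal.ofReal (radialK ℓ r)) * ENNReal.ofReal (radialK ℓ r) := by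
          rw [Finset.prod_const, Finset.card_univ, Fintype.card_fin, pow_succ]
      _ ≤ _ := mul_le_mul' (Finset.prod_le_prod' fun i _ =>
          radialK_le_kernelK hs ((hti i).trans hrd)) (radialK_le_kernelK hs hsum)
  have h2 := ENNReal.toReal_mono hadm.lintegral_lt_top.ne h1
  rw [ENNReal.toReal_mul, ENNReal.toReal_pow, ENNReal.toReal_pow,
    ENNReal.toReal_ofReal (radialK_pos r).le, ENNReal.toReal_ofReal (by positivity)] at h2
  calc radialK ℓ r ^ (d + 1) * r ^ d
      = radialK ℓ r ^ (d + 1) * (2 * (r / d)) ^ d * (d / 2) ^ d := by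
        rw [mul_assoc, ← mul_pow]
        congr 2
        field_simp
    _ ≤ _ := mul_le_mul_of_nonneg_right h2 (by positivity)

theorem exists_max_of_tendsto_zero {b : ℕ → ℝ} (hb : ∀ j, 0 < b j) (ht : Tendsto b atTop (𝓝 0))
    (i0 : ℕ) : ∃ i, i0 ≤ i ∧ ∀ j, i0 ≤ j → b j ≤ b i := by
  obtain ⟨J, hJ⟩ := eventually_atTop.1 (ht.eventually (gt_mem_nhds (hb i0)))
  obtain ⟨i, hi, him⟩ := Finset.exists_max_image (Finset.Icc i0 (max i0 J)) b
    ⟨i0, by simp⟩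
  refine ⟨i, (Finset.mem_Icc.1 hi).1, fun j hj => ?_⟩
  rcases le_total j (max i0 J) with h | h
  · exact him j (Finset.mem_Icc.2 ⟨hj, h⟩)
  · exact (hJ j ((le_max_right _ _).trans h)).le.trans (him i0 (by simp))

/-- There are arbitrarily small dyadic scales below which `r * radialK ℓ r` decays
geometrically. -/
theorem Admissible.exists_geometric_decay (hadm : Admissible ℓ d) :
    ∃ q : ℝ, 0 < q ∧ q < 1 ∧ ∀ i0 : ℕ, ∃ i, i0 ≤ i ∧ ∀ j,
      (1 / 2) ^ (i + j) * radialK ℓ ((1 / 2) ^ (i + j)) ≤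
        (1 / 2) ^ i * radialK ℓ ((1 / 2) ^ i) * q ^ j := by
  obtain ⟨C, hC⟩ := hadm.exists_radialK_pow_le
  -- By Bernoulli `q ^ (d + 1) ≥ 3 / 4`, while `a j ^ (d + 1) ≤ C (1 / 2) ^ j`. Hence `(a j / q ^ j)
  -- ^ (d + 1) ≤ C (2 / 3) ^ j`, and `a j / q ^ j` tends to `0`.
  set q : ℝ := 1 - 1 / (4 * (d + 1)) with hq
  have hd : (0 : ℝ) ≤ d := d.cast_nonneg
  have h4 : 1 / (4 * ((d : ℝ) + 1)) ≤ 1 / 4 := by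
    apply one_div_le_one_div_of_le <;> linarith
  have h4' : 0 < 1 / (4 * ((d : ℝ) + 1)) := by positivity
  have hq0 : 0 < q := by rw [hq]; linarith
  have hq1 : q < 1 := by rw [hq]; linarith
  have hqd : 3 / 4 ≤ q ^ (d + 1) := by
    have := one_add_mul_le_pow (a := -(1 / (4 * ((d : ℝ) + 1)))) (by linarith) (d + 1)
    rw [← sub_eq_add_neg, ← hq] at this
    refine le_trans (le_of_eq ?_) this
    push_cast
    field_simp
    ring
  set a : ℕ → ℝ := fun j => (1 / 2) ^ j * radialK ℓ ((1 / 2) ^ j) with ha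
  have hapos : ∀ j, 0 < a j := fun j => mul_pos (by positivity) (radialK_pos _)
  have hb : Tendsto (fun j => a j / q ^ j) atTop (𝓝 0) := by
    have h1 : Tendsto (fun j => (a j / q ^ j) ^ (d + 1)) atTop (𝓝 0) := by
      have hlim : Tendsto (fun j : ℕ => C * (2 / 3 : ℝ) ^ j) atTop (𝓝 0) := by
        simpa using (tendsto_pow_atTop_nhds_zero_of_lt_one (r := (2 / 3 : ℝ)) (by norm_num)
          (by norm_num)).const_mul C
      refine squeeze_zero' (Eventually.of_forall fun j => by have := hapos j; positivity)
        (eventually_atTop.2 ⟨1, fun j hj => ?_⟩) hlim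
      have hr : ((1 : ℝ) / 2) ^ j ≤ 1 / 2 := by
        calc ((1 : ℝ) / 2) ^ j ≤ (1 / 2) ^ 1 :=
              pow_le_pow_of_le_one (by norm_num) (by norm_num) hj
          _ = _ := pow_one _
      have h2 := hC ((1 / 2) ^ j) (by positivity) hr
      have hC0 : 0 ≤ C := le_trans (by have := radialK_pos (ℓ := ℓ) ((1 / 2) ^ j); positivity) h2
      rw [div_pow, div_le_iff₀ (by positivity)]
      calc a j ^ (d + 1)
          = (radialK ℓ ((1 / 2) ^ j) ^ (d + 1) * ((1 / 2) ^ j) ^ d) * (1 / 2) ^ j := by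
            simp only [ha]; ring
        _ ≤ C * (1 / 2) ^ j := mul_le_mul_of_nonneg_right h2 (by positivity)
        _ = C * ((2 / 3) ^ j * (3 / 4) ^ j) := by rw [← mul_pow]; norm_num
        _ ≤ C * ((2 / 3) ^ j * (q ^ (d + 1)) ^ j) := by gcongr
        _ = _ := by rw [pow_right_comm, mul_assoc]
    have h5 : Tendsto (fun j => ((a j / q ^ j) ^ (d + 1)) ^ ((((d + 1 : ℕ) : ℝ))⁻¹)) atTop
        (𝓝 ((0 : ℝ) ^ ((((d + 1 : ℕ) : ℝ))⁻¹))) :=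
      h1.rpow_const (Or.inr (by positivity))
    rw [Real.zero_rpow (by positivity)] at h5
    refine h5.congr fun j => ?_
    rw [Real.pow_rpow_inv_natCast (by have := hapos j; positivity) (by omega)]
  refine ⟨q, hq0, hq1, fun i0 => ?_⟩
  -- At an index `i` maximising `a j / q ^ j` over `j ≥ i0`, all later terms satisfy `a (i + j) ≤ a
  -- i * q ^ j`.
  obtain ⟨i, hi, him⟩ := exists_max_of_tendsto_zero
    (fun j => div_pos (hapos j) (pow_pos hq0 j)) hb i0
  refine ⟨i, hi, fun j => ?_⟩
  have := him (i + j) (by omega)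
  rw [div_le_div_iff₀ (by positivity) (by positivity), pow_add q] at this
  exact le_of_mul_le_mul_right (this.trans_eq (by ring)) (pow_pos hq0 i)

/-- At a scale of geometric decay, one dyadic step gives the doubling bound, and the dyadic annuli
contribute a geometric series to the integral of the kernel. -/
theorem Admissible.exists_small_scales (hadm : Admissible ℓ d) :
    ∃ C : ℝ, 0 < C ∧ ∀ i0 : ℕ, ∃ i, i0 ≤ i ∧
      radialK ℓ ((1 / 2) ^ (i + 1)) ≤ 2 * radialK ℓ ((1 / 2) ^ i) ∧
      ∫⁻ t in Metric.closedBall (0 : UnitAddCircle) ((1 / 2) ^ i), kernelK ℓ t ≤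
        ENNReal.ofReal (C * ((1 / 2) ^ i * radialK ℓ ((1 / 2) ^ i))) := by
  obtain ⟨q, hq0, hq1, hq⟩ := hadm.exists_geometric_decay
  refine ⟨4 * (1 - q)⁻¹, by have : 0 < 1 - q := by linarith
                            positivity, fun i0 => ?_⟩
  obtain ⟨i, hi, hdec⟩ := hq i0
  refine ⟨i, hi, ?_, ?_⟩
  · have h1 := hdec 1
    rw [pow_one, pow_succ] at h1
    have h2 : (1 / 2 : ℝ) ^ i * radialK ℓ ((1 / 2) ^ i) * q ≤
        (1 / 2 : ℝ) ^ i * radialK ℓ ((1 / 2) ^ i) * 1 :=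
      mul_le_mul_of_nonneg_left hq1.le (mul_pos (by positivity) (radialK_pos _)).le
    rw [← pow_succ] at h1
    have h3 : (1 / 2 : ℝ) ^ i * (radialK ℓ ((1 / 2) ^ (i + 1))) ≤
        (1 / 2 : ℝ) ^ i * (2 * radialK ℓ ((1 / 2) ^ i)) := by
      rw [pow_succ] at h1 ⊢
      linarith
    exact le_of_mul_le_mul_left h3 (by positivity)
  · set A : ℕ → Set UnitAddCircle := fun j =>
      Metric.closedBall (0 : UnitAddCircle) ((1 / 2) ^ (i + j)) \
        Metric.closedBall (0 : UnitAddCircle) ((1 / 2) ^ (i + (j + 1))) with hA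
    -- The centre, where the kernel is infinite, lies in no annulus; it is a null set.
    have hsub : Metric.closedBall (0 : UnitAddCircle) ((1 / 2) ^ i) ⊆ {0} ∪ ⋃ j, A j := by
      intro t ht
      by_cases h0 : t = 0
      · exact Or.inl h0
      · right
        have hpos : 0 < ‖t‖ := norm_pos_iff.2 h0
        have hex : ∃ j, ((1 : ℝ) / 2) ^ (i + j) < ‖t‖ := by
          obtain ⟨j, hj⟩ := exists_pow_lt_of_lt_one hpos (y := (1 / 2 : ℝ)) (by norm_num)
          refine ⟨j, lt_of_le_of_lt ?_ hj⟩
          exact pow_le_pow_of_le_one (by norm_num) (by norm_num) (by omega)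
        classical
        have hne : Nat.find hex ≠ 0 := by
          intro he
          have := Nat.find_spec hex
          rw [he, add_zero] at this
          rw [mem_closedBall_zero_iff] at ht
          linarith
        obtain ⟨j, hj⟩ := Nat.exists_eq_succ_of_ne_zero hne
        have hs := Nat.find_spec hex
        rw [hj] at hs
        have hm := Nat.find_min hex (m := j) (by omega)
        refine Set.mem_iUnion.2 ⟨j, ?_, ?_⟩
        · rw [mem_closedBall_zero_iff]; exact not_lt.1 hm
        · rw [mem_closedBall_zero_iff]; exact not_le.2 hs
    set a : ℝ := (1 / 2) ^ i * radialK ℓ ((1 / 2) ^ i) with ha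
    have ha0 : 0 < a := mul_pos (by positivity) (radialK_pos _)
    have hAj : ∀ j, ∫⁻ t in A j, kernelK ℓ t ≤ ENNReal.ofReal (4 * a * q ^ j) := by
      intro j
      have hAm : MeasurableSet (A j) :=
        Metric.isClosed_closedBall.measurableSet.diff Metric.isClosed_closedBall.measurableSet
      calc ∫⁻ t in A j, kernelK ℓ t
          ≤ ∫⁻ _t in A j, ENNReal.ofReal (radialK ℓ ((1 / 2) ^ (i + (j + 1)))) := by
            refine setLIntegral_mono' hAm fun t ht => ?_
            have := ht.2
            rw [mem_closedBall_zero_iff, not_le] at this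
            exact kernelK_le_radialK (hadm.summable_max (by positivity)) this.le
        _ ≤ ENNReal.ofReal (radialK ℓ ((1 / 2) ^ (i + (j + 1)))) *
              ENNReal.ofReal (2 * (1 / 2) ^ (i + j)) := by
            rw [setLIntegral_const]
            gcongr
            exact (measure_mono Set.sdiff_subset).trans (volume_closedBall_le _)
        _ ≤ _ := by
            rw [← ENNReal.ofReal_mul (radialK_pos _).le]
            refine ENNReal.ofReal_le_ofReal ?_
            have h1 := hdec (j + 1)
            have h2 : a * q ^ (j + 1) ≤ a * q ^ j := by
              refine mul_le_mul_of_nonneg_left ?_ ha0.le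
              exact pow_le_pow_of_le_one hq0.le hq1.le (by omega)
            have h3 : (1 / 2 : ℝ) ^ (i + j) = 2 * (1 / 2) ^ (i + (j + 1)) := by
              rw [← add_assoc, pow_succ]; ring
            rw [h3]
            linarith
    calc _ ≤ ∫⁻ t in {0} ∪ ⋃ j, A j, kernelK ℓ t := lintegral_mono_set hsub
      _ ≤ (∫⁻ t in {0}, kernelK ℓ t) + ∫⁻ t in ⋃ j, A j, kernelK ℓ t := lintegral_union_le _ _ _
      _ ≤ 0 + ∑' j, ∫⁻ t in A j, kernelK ℓ t := by
          refine add_le_add (le_of_eq ?_) (lintegral_iUnion_le _ _)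
          exact setLIntegral_measure_zero _ _ (by
            have h1 := volume_closedBall_le 0
            rw [Metric.closedBall_zero, mul_zero, ENNReal.ofReal_zero] at h1
            exact le_antisymm h1 zero_le)
      _ ≤ ∑' j, ENNReal.ofReal (4 * a * q ^ j) := by
          rw [zero_add]; exact ENNReal.tsum_le_tsum hAj
      _ = _ := by
          rw [← ENNReal.ofReal_tsum_of_nonneg (fun j => by positivity)
            ((summable_geometric_of_lt_one hq0.le hq1).mul_left _), tsum_mul_left,
            tsum_geometric_of_lt_one hq0.le hq1]
          congr 1
          ring

/-- Scales `r = 1 / (4 p)` at which the number `n` of lengths exceeding `r` is at most of order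
`1 / r` and at which the kernel of the remaining lengths is integrable uniformly. -/
theorem Admissible.exists_good_scale (hadm : Admissible ℓ d) :
    ∃ C : ℝ, 0 < C ∧ ∀ ε : ℝ, 0 < ε → ∀ n1 : ℕ, ∃ p n : ℕ, 2 ≤ p ∧ n1 ≤ n ∧
      1 / (4 * (p : ℝ)) < ε ∧ n * (1 / (4 * (p : ℝ))) ≤ 2 ∧
      ∀ s : Finset ℕ, (∀ k ∈ s, n ≤ k) →
        ∫⁻ t in Metric.closedBall (0 : UnitAddCircle) (1 / (4 * (p : ℝ))),
          ENNReal.ofReal (Real.exp (∑ k ∈ s, max 0 (ℓ k - ‖t‖))) ≤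
            ENNReal.ofReal (C * (1 / (4 * (p : ℝ)))) := by
  obtain ⟨C, hC0, hC⟩ := hadm.exists_small_scales
  refine ⟨C, hC0, fun ε hε n1 => ?_⟩
  obtain ⟨j, hj⟩ := exists_pow_lt_of_lt_one (lt_min hε (hadm.pos n1)) (y := (1 / 2 : ℝ))
    (by norm_num)
  obtain ⟨i, hi, hdouble, hint⟩ := hC (max j 3)
  have hi3 : 3 ≤ i := (le_max_right _ _).trans hi
  have hij : j ≤ i := (le_max_left _ _).trans hi
  set r : ℝ := (1 / 2) ^ i with hr
  have hr0 : 0 < r := by positivity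
  have hrlt : r < min ε (ℓ n1) :=
    (pow_le_pow_of_le_one (by norm_num) (by norm_num) hij).trans_lt hj
  -- So `p = 2 ^ (i - 2)`, and `i ≥ 3` ensures `p ≥ 2`.
  have hp : 1 / (4 * ((2 ^ (i - 2) : ℕ) : ℝ)) = r := by
    obtain ⟨i', rfl⟩ : ∃ i', i = i' + 2 := ⟨i - 2, by omega⟩
    rw [hr, Nat.add_sub_cancel, pow_add]
    push_cast
    rw [one_div_pow]
    field_simp
    norm_num
  obtain ⟨n0, hn0⟩ := hadm.exists_le hr0
  classical
  have hex : ∃ n, ℓ n ≤ r := ⟨n0, hn0 n0 le_rfl⟩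
  -- By monotonicity `n` is exactly the number of lengths exceeding `r`.
  set n := Nat.find hex with hn
  have hlt : ∀ k, k < n → r < ℓ k := fun k hk => not_le.1 (Nat.find_min hex hk)
  have hge : ∀ k, n ≤ k → ℓ k ≤ r := fun k hk => (hadm.anti hk).trans (Nat.find_spec hex)
  refine ⟨2 ^ (i - 2), n, ?_, ?_, ?_, ?_, ?_⟩
  · calc 2 = 2 ^ 1 := rfl
      _ ≤ _ := Nat.pow_le_pow_right (by norm_num) (by omega)
  · by_contra! hcon
    linarith [hge n1 hcon.le, hrlt.trans_le (min_le_right _ _)]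
  · rw [hp]; exact hrlt.trans_le (min_le_left _ _)
  · rw [hp]
    obtain ⟨N, hN⟩ := hadm.exists_le (δ := r / 2) (by positivity)
    have hr2 : (1 / 2 : ℝ) ^ (i + 1) = r / 2 := by rw [pow_succ]; ring
    have hnN : n ≤ max n N := le_max_left _ _
    rw [hr2, radialK_eq (r := r / 2) (N := max n N) fun k hk => hN k ((le_max_right _ _).trans hk),
      radialK_eq (r := r) (N := max n N) fun k hk => hge k (hnN.trans hk)] at hdouble
    -- Each of the `n` long arcs adds `r / 2` to the exponent of the kernel between the distances
    -- `r` and `r / 2`. Doubling thus gives `exp (n r / 2) ≤ 2`, hence `n r ≤ 2`.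
    have h1 : ∑ k ∈ Finset.range n, r / 2 ≤ ∑ k ∈ Finset.range (max n N),
        (max 0 (ℓ k - r / 2) - max 0 (ℓ k - r)) := by
      calc ∑ k ∈ Finset.range n, r / 2
          = ∑ k ∈ Finset.range n, (max 0 (ℓ k - r / 2) - max 0 (ℓ k - r)) := by
            refine Finset.sum_congr rfl fun k hk => ?_
            have := hlt k (Finset.mem_range.1 hk)
            rw [max_eq_right (by linarith), max_eq_right (by linarith)]
            ring
        _ ≤ _ := Finset.sum_le_sum_of_subset_of_nonneg (Finset.range_mono hnN) fun k _ _ => by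
            rw [sub_nonneg]
            exact max_le_max le_rfl (by linarith)
    rw [Finset.sum_const, Finset.card_range, nsmul_eq_mul, Finset.sum_sub_distrib] at h1
    have h2 := Real.exp_le_exp.2 h1
    rw [Real.exp_sub, le_div_iff₀ (Real.exp_pos _)] at h2
    have h3 : Real.exp (n * (r / 2)) ≤ 2 :=
      le_of_mul_le_mul_right (h2.trans hdouble) (Real.exp_pos _)
    have h4 := Real.add_one_le_exp (n * (r / 2))
    linarith
  · intro s hs
    rw [hp]
    have hκ : radialK ℓ r = Real.exp (∑ k ∈ Finset.range n, max 0 (ℓ k - r)) := radialK_eq hge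
    have hdisj : Disjoint s (Finset.range n) := by
      rw [Finset.disjoint_left]
      intro k hk hk'
      have := hs k hk
      have := Finset.mem_range.1 hk'
      omega
    have hpt : ∀ t ∈ Metric.closedBall (0 : UnitAddCircle) r,
        ENNReal.ofReal (radialK ℓ r) *
          ENNReal.ofReal (Real.exp (∑ k ∈ s, max 0 (ℓ k - ‖t‖))) ≤ kernelK ℓ t := by
      intro t ht
      rw [mem_closedBall_zero_iff] at ht
      refine le_trans ?_ (ofReal_exp_sum_le_kernelK ℓ (s ∪ Finset.range n) t)
      rw [← ENNReal.ofReal_mul (radialK_pos r).le, hκ, ← Real.exp_add,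
        Finset.sum_union hdisj, add_comm]
      gcongr
    have hm : Measurable fun t : UnitAddCircle =>
        ENNReal.ofReal (Real.exp (∑ k ∈ s, max 0 (ℓ k - ‖t‖))) := by
      refine (Real.measurable_exp.comp (Finset.measurable_sum s fun k _ => ?_)).ennreal_ofReal
      exact measurable_const.max (measurable_const.sub measurable_norm)
    have h1 : ENNReal.ofReal (radialK ℓ r) *
        ∫⁻ t in Metric.closedBall (0 : UnitAddCircle) r,
          ENNReal.ofReal (Real.exp (∑ k ∈ s, max 0 (ℓ k - ‖t‖))) ≤
        ENNReal.ofReal (radialK ℓ r) * ENNReal.ofReal (C * r) := by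
      rw [← lintegral_const_mul _ hm, ← ENNReal.ofReal_mul (radialK_pos r).le]
      refine (setLIntegral_mono' Metric.isClosed_closedBall.measurableSet hpt).trans
        (hint.trans_eq ?_)
      congr 1
      ring
    exact (ENNReal.mul_le_mul_iff_right (by simpa using radialK_pos r) ENNReal.ofReal_ne_top).1 h1

end

/-! ### The first uncovered right endpoint, and its stability when other arcs move. -/

section

variable {ℓ : ℕ → ℝ} {d : ℕ}

/-- The set left uncovered by the first `n` arcs. -/
def uncoveredUpTo (ℓ : ℕ → ℝ) (n : ℕ) (x : ℕ → UnitAddCircle) : Set UnitAddCircle :=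
  {t | ∀ j < n, t ∉ arc (x j) (ℓ j)}

/-- The right endpoint of an arc. -/
def rightEnd (ℓ : ℕ → ℝ) (x : ℕ → UnitAddCircle) (k : ℕ) : UnitAddCircle :=
  x k + (ℓ k : UnitAddCircle)

theorem measurable_rightEnd (ℓ : ℕ → ℝ) (k : ℕ) : Measurable fun x => rightEnd ℓ x k :=
  (measurable_pi_apply k).add measurable_const

theorem rightEnd_update {i k : ℕ} (h : i ≠ k) (x : ℕ → UnitAddCircle) (u : UnitAddCircle) :
    rightEnd ℓ (Function.update x i u) k = rightEnd ℓ x k := by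
  rw [rightEnd, Function.update_of_ne h.symm, rightEnd]

theorem measurableSet_mem_uncoveredUpTo (h : ∀ n, ℓ n < 1) (n : ℕ)
    {f : (ℕ → UnitAddCircle) → UnitAddCircle} (hf : Measurable f) :
    MeasurableSet {x | f x ∈ uncoveredUpTo ℓ n x} := by
  have e : {x | f x ∈ uncoveredUpTo ℓ n x} =
      ⋂ j, ⋂ (_ : j < n), {x | f x ∈ arc (x j) (ℓ j)}ᶜ := by
    ext x; simp [uncoveredUpTo]
  rw [e]
  refine MeasurableSet.iInter fun j => MeasurableSet.iInter fun _ => MeasurableSet.compl ?_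
  simp only [mem_arc_iff (h j).le]
  have hm : Measurable fun x : ℕ → UnitAddCircle => rep (f x - x j) :=
    measurable_rep.comp (hf.sub (measurable_pi_apply j))
  exact (measurableSet_lt measurable_const hm).inter (measurableSet_lt hm measurable_const)

theorem coe_sub_eq {a z t : UnitAddCircle} : ((rep (t - a) - rep (z - a) : ℝ) : UnitAddCircle) =
    t - z := by
  rw [AddCircle.coe_sub, coe_rep, coe_rep]; abel

/-- If an arc contains `z` but not the point `t` that follows it (counted from `a`), then its right
endpoint lies between `z` and `t`. -/
theorem rep_rightEnd_between {a z t c : UnitAddCircle} {l : ℝ} (hl : l < 1) (hz : z ∈ arc c l)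
    (ht : t ∉ arc c l) (hzt : rep (z - a) ≤ rep (t - a)) :
    rep (z - a) < rep (c + (l : UnitAddCircle) - a) ∧
      rep (c + (l : UnitAddCircle) - a) ≤ rep (t - a) := by
  rw [mem_arc_iff hl.le] at hz ht
  set σ := rep (z - a)
  set s := rep (t - a)
  set α := rep (z - c)
  have hle : l - α ≤ s - σ := by
    by_contra! hcon
    have e : (((s - σ) + α : ℝ) : UnitAddCircle) = t - c := by
      rw [AddCircle.coe_add, coe_sub_eq, coe_rep]; abel
    have := rep_eq_of_coe_eq e (by linarith [hz.1]) (by linarith)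
    exact ht ⟨by linarith [hz.1], by linarith⟩
  have hσ : 0 ≤ σ := rep_nonneg _
  have hs : s < 1 := rep_lt_one _
  have e : ((σ + (l - α) : ℝ) : UnitAddCircle) = c + (l : UnitAddCircle) - a := by
    rw [AddCircle.coe_add, AddCircle.coe_sub, coe_rep, coe_rep]; abel
  rw [rep_eq_of_coe_eq e (by linarith [hz.2]) (by linarith)]
  exact ⟨by linarith [hz.2], by linarith⟩

/-- Among the right endpoints met between `a` and `t`, the last one is uncovered: an arc covering it
would miss `t`, and so would end strictly later but still before or at `t`. -/
theorem exists_rightEnd_mem (h : ∀ n, ℓ n < 1) {n : ℕ} {x : ℕ → UnitAddCircle}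
    {a t : UnitAddCircle} (ht : t ∈ uncoveredUpTo ℓ n x) (ha : a ∉ uncoveredUpTo ℓ n x) :
    ∃ j < n, rightEnd ℓ x j ∈ uncoveredUpTo ℓ n x ∧ rep (rightEnd ℓ x j - a) ≤ rep (t - a) := by
  classical
  set R := (Finset.range n).filter fun j => rep (rightEnd ℓ x j - a) ≤ rep (t - a) with hR
  have hRne : R.Nonempty := by
    simp only [uncoveredUpTo, Set.mem_ofPred_eq, not_forall, not_not] at ha
    obtain ⟨i, hi, hai⟩ := ha
    have := rep_rightEnd_between (a := a) (h i) hai (ht i hi)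
      (by rw [sub_self, rep_zero]; exact rep_nonneg _)
    exact ⟨i, Finset.mem_filter.2 ⟨Finset.mem_range.2 hi, this.2⟩⟩
  obtain ⟨j, hj, hmax⟩ := Finset.exists_max_image R (fun j => rep (rightEnd ℓ x j - a)) hRne
  obtain ⟨hjn, hjt⟩ := Finset.mem_filter.1 hj
  refine ⟨j, Finset.mem_range.1 hjn, fun i hi hcon => ?_, hjt⟩
  have := rep_rightEnd_between (a := a) (h i) hcon (ht i hi) hjt
  have h2 := hmax i (Finset.mem_filter.2 ⟨Finset.mem_range.2 hi, this.2⟩)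
  exact absurd this.1 (not_lt.2 h2)

/-- The event that the right endpoint of the arc with index `k` is the first uncovered right
endpoint after `a`, among the arcs with index in `[m, n)`, and that it is close to `a`. -/
def firstEnd (ℓ : ℕ → ℝ) (a : UnitAddCircle) (m n k : ℕ) : Set (ℕ → UnitAddCircle) :=
  {x | rep (rightEnd ℓ x k - a) ≤ 1 / 4 ∧ rightEnd ℓ x k ∈ uncoveredUpTo ℓ n x ∧
    ∀ j, m ≤ j → j < n → rep (rightEnd ℓ x j - a) ≤ rep (rightEnd ℓ x k - a) →
      (rep (rightEnd ℓ x j - a) = rep (rightEnd ℓ x k - a) → j < k) →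
      rightEnd ℓ x j ∉ uncoveredUpTo ℓ n x}

theorem measurableSet_firstEnd (h : ∀ n, ℓ n < 1) (a : UnitAddCircle) (m n k : ℕ) :
    MeasurableSet (firstEnd ℓ a m n k) := by
  have hy : ∀ j, Measurable fun x : ℕ → UnitAddCircle => rep (rightEnd ℓ x j - a) := fun j =>
    measurable_rep.comp ((measurable_rightEnd ℓ j).sub measurable_const)
  have hu := fun j => measurableSet_mem_uncoveredUpTo h n (measurable_rightEnd ℓ j)
  have e : {x : ℕ → UnitAddCircle |
      ∀ j, m ≤ j → j < n → rep (rightEnd ℓ x j - a) ≤ rep (rightEnd ℓ x k - a) →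
      (rep (rightEnd ℓ x j - a) = rep (rightEnd ℓ x k - a) → j < k) →
      rightEnd ℓ x j ∉ uncoveredUpTo ℓ n x} = ⋂ j, ⋂ (_ : m ≤ j), ⋂ (_ : j < n),
      ({x | rep (rightEnd ℓ x j - a) ≤ rep (rightEnd ℓ x k - a)} ∩
        ({x | rep (rightEnd ℓ x j - a) = rep (rightEnd ℓ x k - a)}ᶜ ∪ {_x | j < k}) ∩
        {x | rightEnd ℓ x j ∈ uncoveredUpTo ℓ n x})ᶜ := by
    ext x
    simp only [Set.mem_ofPred_eq, Set.mem_iInter, Set.mem_compl_iff, Set.mem_inter_iff,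
      Set.mem_union, not_and, and_imp]
    refine forall_congr' fun j => forall_congr' fun _ => forall_congr' fun _ =>
      forall_congr' fun _ => ?_
    tauto
  refine (measurableSet_le (hy k) measurable_const).inter ((hu k).inter
    ((congrArg MeasurableSet e).mpr ?_))
  refine MeasurableSet.iInter fun j => MeasurableSet.iInter fun _ => MeasurableSet.iInter fun _ =>
    MeasurableSet.compl ?_
  exact ((measurableSet_le (hy j) (hy k)).inter
    ((measurableSet_eq_fun (hy j) (hy k)).compl.union (MeasurableSet.const _))).inter (hu j)

/-- The index minimises the pair (position, index) lexicographically, in accordance with the tie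
rule of `firstEnd`. -/
theorem exists_mem_firstEnd (h : ∀ n, ℓ n < 1) {m n : ℕ} {x : ℕ → UnitAddCircle}
    {a t : UnitAddCircle} (ht : t ∈ uncoveredUpTo ℓ n x) (hta : rep (t - a) ≤ 1 / 4)
    (ha : a ∉ uncoveredUpTo ℓ n x) (hm : ∀ j < m, rightEnd ℓ x j ∉ uncoveredUpTo ℓ n x) :
    ∃ k, m ≤ k ∧ k < n ∧ x ∈ firstEnd ℓ a m n k := by
  classical
  obtain ⟨j, hjn, hju, hjt⟩ := exists_rightEnd_mem h ht ha
  have hjm : m ≤ j := by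
    by_contra! hcon
    exact hm j hcon hju
  set R := (Finset.Ico m n).filter fun j => rightEnd ℓ x j ∈ uncoveredUpTo ℓ n x with hR
  have hjR : j ∈ R := Finset.mem_filter.2 ⟨Finset.mem_Ico.2 ⟨hjm, hjn⟩, hju⟩
  obtain ⟨k, hk, hmin⟩ := Finset.exists_min_image R
    (fun j => toLex (rep (rightEnd ℓ x j - a), j)) ⟨j, hjR⟩
  obtain ⟨hk1, hku⟩ := Finset.mem_filter.1 hk
  obtain ⟨hkm, hkn⟩ := Finset.mem_Ico.1 hk1
  refine ⟨k, hkm, hkn, ?_, hku, fun i him hin hle heq hiu => ?_⟩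
  · have := hmin j hjR
    rw [Prod.Lex.toLex_le_toLex] at this
    have : rep (rightEnd ℓ x k - a) ≤ rep (rightEnd ℓ x j - a) := by
      rcases this with h1 | h1
      · exact h1.le
      · exact h1.1.le
    linarith
  · have := hmin i (Finset.mem_filter.2 ⟨Finset.mem_Ico.2 ⟨him, hin⟩, hiu⟩)
    rw [Prod.Lex.toLex_le_toLex] at this
    rcases this with h1 | h1
    · exact absurd h1 (not_lt.2 hle)
    · have := heq h1.1.symm
      have := h1.2
      simp only at *
      omega

/-- Coinciding endpoints are attributed to the smallest index. Disjointness lets the estimates for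
the individual `k` be added without loss. -/
theorem firstEnd_disjoint (ℓ : ℕ → ℝ) (a : UnitAddCircle) {m n k k' : ℕ} (hk : m ≤ k) (hkn : k < n)
    (hk' : m ≤ k') (hkn' : k' < n) (hne : k ≠ k') :
    Disjoint (firstEnd ℓ a m n k) (firstEnd ℓ a m n k') := by
  rw [Set.disjoint_left]
  rintro x ⟨-, h1, h2⟩ ⟨-, h1', h2'⟩
  rcases lt_trichotomy (rep (rightEnd ℓ x k - a)) (rep (rightEnd ℓ x k' - a)) with h | h | h
  · exact h2' k hk hkn h.le (fun e => absurd e h.ne) h1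
  · rcases hne.lt_or_gt with hlt | hlt
    · exact h2' k hk hkn h.le (fun _ => hlt) h1
    · exact h2 k' hk' hkn' h.ge (fun _ => hlt) h1'
  · exact h2 k' hk' hkn' h.le (fun e => absurd e h.ne) h1'

theorem notMem_arc_of_rep_sub_lt {e u : UnitAddCircle} {l : ℝ} (hl : l < 1 / 4)
    (hu : rep (u - e) < 1 / 4) : e ∉ arc u l := by
  rw [mem_arc_iff (by linarith)]
  rintro ⟨h1, h2⟩
  have e1 : ((1 - rep (e - u) : ℝ) : UnitAddCircle) = u - e := by
    rw [AddCircle.coe_sub, coe_rep, coe_one_eq]; abel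
  rw [rep_eq_of_coe_eq e1 (by linarith) (by linarith)] at hu
  linarith

/-- Moving another arc whose left endpoint is shortly after the first uncovered endpoint does not
change the latter. -/
theorem update_mem_firstEnd (h0 : ∀ n, 0 < ℓ n) (h : ∀ n, ℓ n < 1) {a : UnitAddCircle}
    {m n k i : ℕ} (hik : i ≠ k) (hi : ℓ i < 1 / 4)
    {x : ℕ → UnitAddCircle} (hx : x ∈ firstEnd ℓ a m n k)
    (hxi : rep (x i - rightEnd ℓ x k) < 1 / 4) {u : UnitAddCircle}
    (hu : rep (u - rightEnd ℓ x k) < 1 / 4) : Function.update x i u ∈ firstEnd ℓ a m n k := by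
  obtain ⟨h1, h2, h3⟩ := hx
  set e := rightEnd ℓ x k with he
  have hek : rightEnd ℓ (Function.update x i u) k = e := rightEnd_update hik x u
  have hey : 0 ≤ rep (e - a) := rep_nonneg _
  refine ⟨by rwa [hek], ?_, ?_⟩
  · rw [hek]
    intro j hj
    by_cases hji : j = i
    · subst hji
      rw [Function.update_self]
      exact notMem_arc_of_rep_sub_lt hi hu
    · rw [Function.update_of_ne hji]
      exact h2 j hj
  · intro j hjm hjn hle heq
    rw [hek] at hle heq
    -- The moved arc ends strictly after `e`, so it is not a competitor. The three displacements
    -- from `a` total less than `3 / 4`, hence nothing wraps around.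
    by_cases hji : j = i
    · subst hji
      exfalso
      have e1 : ((rep (e - a) + rep (u - e) + ℓ j : ℝ) : UnitAddCircle) =
          rightEnd ℓ (Function.update x j u) j - a := by
        rw [rightEnd, Function.update_self, AddCircle.coe_add, AddCircle.coe_add, coe_rep, coe_rep]
        abel
      have hun := rep_nonneg (u - e)
      rw [rep_eq_of_coe_eq e1 (by linarith [h0 j]) (by linarith)] at hle
      linarith [h0 j]
    · rw [rightEnd_update (Ne.symm hji)] at hle heq ⊢
      have h4 := h3 j hjm hjn hle heq
      simp only [uncoveredUpTo, Set.mem_ofPred_eq, not_forall, not_not] at h4 ⊢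
      obtain ⟨l, hl, hjl⟩ := h4
      refine ⟨l, hl, ?_⟩
      -- In its old position the arc `l` starts at or after `e`, so everything it covers before
      -- wrapping lies after `e`; it cannot cover an endpoint that precedes `e`.
      by_cases hli : l = i
      · subst hli
        exfalso
        rw [mem_arc_iff (h l).le] at hjl
        have e1 : ((rep (e - a) + rep (x l - e) + rep (rightEnd ℓ x j - x l) : ℝ) :
            UnitAddCircle) = rightEnd ℓ x j - a := by
          rw [AddCircle.coe_add, AddCircle.coe_add, coe_rep, coe_rep, coe_rep]
          abel
        have hun := rep_nonneg (x l - e)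
        rw [rep_eq_of_coe_eq e1 (by linarith [hjl.1]) (by linarith [hjl.2])] at hle
        linarith [hjl.1]
      · rwa [Function.update_of_ne hli]

/-- A short arc to the right of an uncovered point is uncovered if no arc starts there. -/
theorem mem_uncoveredUpTo_of_rep_lt (h : ∀ n, ℓ n < 1) {n : ℕ} {x : ℕ → UnitAddCircle}
    {e t : UnitAddCircle} {r : ℝ} (he : e ∈ uncoveredUpTo ℓ n x) (hx : ∀ j < n, r ≤ rep (x j - e))
    (ht : rep (t - e) < r) : t ∈ uncoveredUpTo ℓ n x := by
  intro j hj hcon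
  rw [mem_arc_iff (h j).le] at hcon
  set β := rep (t - x j) with hβ
  set s := rep (t - e) with hs
  have hs0 : 0 ≤ s := rep_nonneg _
  have hs1 : s < 1 := rep_lt_one _
  have e1 : ((s - β : ℝ) : UnitAddCircle) = x j - e := by
    rw [AddCircle.coe_sub, coe_rep, coe_rep]; abel
  have e2 : ((β - s : ℝ) : UnitAddCircle) = e - x j := by
    rw [AddCircle.coe_sub, coe_rep, coe_rep]; abel
  -- An arc covering `t` starts either between `e` and `t`, against `hx`, or before `e`, and then it
  -- covers `e`.
  rcases le_or_gt β s with hle | hlt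
  · have h1 := rep_eq_of_coe_eq e1 (by linarith) (by linarith [hcon.1])
    linarith [hx j hj]
  · have h1 := rep_eq_of_coe_eq e2 (by linarith) (by linarith [hcon.2, h j])
    refine he j hj ((mem_arc_iff (h j).le).2 ⟨by linarith, by linarith [hcon.2]⟩)

/-- An event that is stable under moving the coordinate `i` within an arc of length `1 / 4` gives
little weight to the first `p`-th of this arc. -/
theorem mul_measure_inter_le {Q : Set (ℕ → UnitAddCircle)} (hQ : MeasurableSet Q) {i : ℕ}
    {c : (ℕ → UnitAddCircle) → UnitAddCircle} (hc : Measurable c)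
    (hci : ∀ x u, c (Function.update x i u) = c x)
    (hQi : ∀ x ∈ Q, rep (x i - c x) < 1 / 4 → ∀ u, rep (u - c x) < 1 / 4 →
      Function.update x i u ∈ Q) {p : ℕ} (hp : 0 < p) :
    p * unifSeq (Q ∩ {x | rep (x i - c x) < 1 / (4 * (p : ℝ))}) ≤ unifSeq Q := by
  have hp' : (0 : ℝ) < p := by exact_mod_cast hp
  set r : ℝ := 1 / (4 * (p : ℝ)) with hr
  have hr0 : 0 < r := by positivity
  have hpr : p * r = 1 / 4 := by rw [hr]; field_simp
  have hm : Measurable fun x : ℕ → UnitAddCircle => rep (x i - c x) :=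
    measurable_rep.comp ((measurable_pi_apply i).sub hc)
  -- The quarter circle after `c` is divided into `p` slots of length `r`. Rotating the arc `i` by
  -- `q r` carries the first slot into the slot `q` without leaving `Q`, so each of the disjoint
  -- slots has at least the probability of the first.
  set A : ℕ → Set (ℕ → UnitAddCircle) := fun q =>
    Q ∩ {x | q * r ≤ rep (x i - c x) ∧ rep (x i - c x) < (q + 1) * r} with hA
  have hAm : ∀ q, MeasurableSet (A q) := fun q => hQ.inter
    ((measurableSet_le measurable_const hm).inter (measurableSet_lt hm measurable_const))
  have hdisj : Set.PairwiseDisjoint (↑(Finset.range p)) A := by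
    intro q _ q' _ hne
    rw [Function.onFun, Set.disjoint_left]
    rintro x ⟨-, h1, h2⟩ ⟨-, h3, h4⟩
    have h5 : (q : ℝ) < q' + 1 := by nlinarith
    have h6 : (q' : ℝ) < q + 1 := by nlinarith
    have h5' : q < q' + 1 := by exact_mod_cast h5
    have h6' : q' < q + 1 := by exact_mod_cast h6
    omega
  have hle : ∀ q ∈ Finset.range p, unifSeq (Q ∩ {x | rep (x i - c x) < r}) ≤ unifSeq (A q) := by
    intro q hq
    have hq1 : ((q : ℝ) + 1) ≤ p := by exact_mod_cast Finset.mem_range.1 hq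
    have hqr : (q + 1) * r ≤ 1 / 4 := by rw [← hpr]; gcongr
    have hq0 : 0 ≤ q * r := by positivity
    rw [← (measurePreserving_shift i ((q * r : ℝ) : UnitAddCircle)).measure_preimage
      (hAm q).nullMeasurableSet]
    refine measure_mono fun x ⟨hxQ, hx⟩ => ?_
    have hx' : rep (x i - c x) < r := hx
    have hx0 := rep_nonneg (x i - c x)
    have e : ((rep (x i - c x) + q * r : ℝ) : UnitAddCircle) =
        x i + ((q * r : ℝ) : UnitAddCircle) - c x := by
      rw [AddCircle.coe_add, coe_rep]; abel
    have hrep := rep_eq_of_coe_eq e (by linarith) (by linarith)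
    refine ⟨hQi x hxQ (by nlinarith) _ (by rw [hrep]; linarith), ?_⟩
    simp only [Set.mem_ofPred_eq, Function.update_self, hci, hrep]
    exact ⟨by linarith, by linarith⟩
  calc _ = ∑ _q ∈ Finset.range p, unifSeq (Q ∩ {x | rep (x i - c x) < r}) := by
        rw [Finset.sum_const, Finset.card_range, nsmul_eq_mul]
    _ ≤ ∑ q ∈ Finset.range p, unifSeq (A q) := Finset.sum_le_sum hle
    _ = unifSeq (⋃ q ∈ Finset.range p, A q) :=
        (measure_biUnion_finset hdisj fun q _ => hAm q).symm
    _ ≤ _ := measure_mono (Set.iUnion₂_subset fun q _ => Set.inter_subset_left)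

/-- Each arc avoids the first slot at the cost of a factor `1 - 1 / p`. The constraints already
imposed on other arcs are unaffected by moving one more, so the induction closes. -/
theorem mul_measureReal_le_inter {Q : Set (ℕ → UnitAddCircle)} (hQ : MeasurableSet Q)
    {I : Finset ℕ} {c : (ℕ → UnitAddCircle) → UnitAddCircle} (hc : Measurable c)
    (hci : ∀ i ∈ I, ∀ x u, c (Function.update x i u) = c x)
    (hQi : ∀ i ∈ I, ∀ x ∈ Q, rep (x i - c x) < 1 / 4 → ∀ u, rep (u - c x) < 1 / 4 →
      Function.update x i u ∈ Q) {p : ℕ} (hp : 0 < p) :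
    (1 - 1 / (p : ℝ)) ^ I.card * unifSeq.real Q ≤
      unifSeq.real (Q ∩ {x | ∀ i ∈ I, 1 / (4 * (p : ℝ)) ≤ rep (x i - c x)}) := by
  classical
  have hp' : (1 : ℝ) ≤ p := by exact_mod_cast hp
  have h1p : 0 ≤ 1 - 1 / (p : ℝ) := by
    rw [sub_nonneg, div_le_one (by linarith)]; exact hp'
  have hm : ∀ i, Measurable fun x : ℕ → UnitAddCircle => rep (x i - c x) := fun i =>
    measurable_rep.comp ((measurable_pi_apply i).sub hc)
  induction I using Finset.induction_on with
  | empty => simp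
  | insert i I hi ih =>
    have ih' := ih (fun j hj => hci j (Finset.mem_insert_of_mem hj))
      fun j hj => hQi j (Finset.mem_insert_of_mem hj)
    set Q' := Q ∩ {x | ∀ j ∈ I, 1 / (4 * (p : ℝ)) ≤ rep (x j - c x)} with hQ'
    have hQ'm : MeasurableSet Q' := by
      have e : {x : ℕ → UnitAddCircle | ∀ j ∈ I, 1 / (4 * (p : ℝ)) ≤ rep (x j - c x)} =
          ⋂ j ∈ I, {x | 1 / (4 * (p : ℝ)) ≤ rep (x j - c x)} := by ext; simp
      rw [hQ', e]
      exact hQ.inter (Finset.measurableSet_biInter I fun j _ =>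
        measurableSet_le measurable_const (hm j))
    have hcii := hci i (Finset.mem_insert_self _ _)
    have key := mul_measure_inter_le hQ'm hc hcii (fun x hx hxi u hu => by
      refine ⟨hQi i (Finset.mem_insert_self _ _) x hx.1 hxi u hu, fun j hj => ?_⟩
      rw [hcii, Function.update_of_ne (ne_of_mem_of_not_mem hj hi)]
      exact hx.2 j hj) hp
    have key' : p * unifSeq.real (Q' ∩ {x | rep (x i - c x) < 1 / (4 * (p : ℝ))}) ≤
        unifSeq.real Q' := by
      have := ENNReal.toReal_mono (measure_ne_top _ _) key
      rwa [ENNReal.toReal_mul, ENNReal.toReal_natCast] at this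
    have hsplit := measureReal_inter_add_sdiff (μ := unifSeq) (s := Q')
      (measurableSet_lt (hm i) (measurable_const (a := 1 / (4 * (p : ℝ)))))
    have hset : Q' \ {x | rep (x i - c x) < 1 / (4 * (p : ℝ))} =
        Q ∩ {x | ∀ j ∈ insert i I, 1 / (4 * (p : ℝ)) ≤ rep (x j - c x)} := by
      ext x
      simp only [hQ', Set.mem_sdiff, Set.mem_inter_iff, Set.mem_ofPred_eq, not_lt,
        Finset.forall_mem_insert]
      tauto
    rw [hset] at hsplit
    rw [Finset.card_insert_of_notMem hi, pow_succ, mul_right_comm]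
    have hle : unifSeq.real (Q' ∩ {x | rep (x i - c x) < 1 / (4 * (p : ℝ))}) ≤
        1 / (p : ℝ) * unifSeq.real Q' := by
      rw [div_mul_eq_mul_div, one_mul, le_div_iff₀ (by linarith)]
      linarith
    calc _ ≤ unifSeq.real Q' * (1 - 1 / (p : ℝ)) := mul_le_mul_of_nonneg_right ih' h1p
      _ ≤ _ := by linarith

end

/-! ### Survival from an uncovered interval, and almost sure covering of given points. -/

section

variable {ℓ : ℕ → ℝ} {d : ℕ}

theorem volume_rep_sub_lt (c : UnitAddCircle) {r : ℝ} (hr : r ≤ 1) :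
    volume {t : UnitAddCircle | rep (t - c) < r} = ENNReal.ofReal r := by
  have h1 := (measurePreserving_sub_right (volume : Measure UnitAddCircle) c).measure_preimage
    (measurable_rep (measurableSet_Iio (a := r))).nullMeasurableSet
  have h2 : {t : UnitAddCircle | rep (t - c) < r} = (fun t => t - c) ⁻¹' (rep ⁻¹' Set.Iio r) := rfl
  rw [h2, h1, volume_rep_preimage measurableSet_Iio]
  have e : Set.Iio r ∩ Set.Ioc 0 1 = Set.Ioo 0 r := by
    ext y
    simp only [Set.mem_inter_iff, Set.mem_Iio, Set.mem_Ioc, Set.mem_Ioo]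
    constructor
    · rintro ⟨h1, h2, h3⟩; exact ⟨h2, h1⟩
    · rintro ⟨h1, h2⟩; exact ⟨h2, h1, by linarith⟩
  rw [e, Real.volume_Ioo, sub_zero]

theorem norm_sub_le_of_rep_lt {c s t : UnitAddCircle} {r : ℝ} (hs : rep (s - c) < r)
    (ht : rep (t - c) < r) : ‖t - s‖ ≤ r := by
  have h1 := rep_nonneg (s - c)
  have h2 := rep_nonneg (t - c)
  rw [← coe_sub_eq (a := c)]
  rw [UnitAddCircle.norm_eq]
  refine (round_le _ 0).trans ?_
  rw [Int.cast_zero, sub_zero, abs_le]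
  constructor <;> linarith

theorem one_le_partialDensity (h0 : ∀ n, 0 ≤ ℓ n) (h : ∀ n, ℓ n < 1) {n : ℕ}
    {x : ℕ → UnitAddCircle} {t : UnitAddCircle} (ht : t ∈ uncoveredUpTo ℓ n x) :
    1 ≤ partialDensity ℓ (Finset.range n) x t := by
  refine Finset.one_le_prod fun k hk => ?_
  have := ht k (Finset.mem_range.1 hk)
  rw [mem_arc_iff (h k).le] at this
  rw [pf, if_neg this]
  exact one_le_one_div (by linarith [h k]) (by linarith [h0 k])

/-- If an interval of length `r` is left uncovered by the first `n` arcs, at a scale `r` at which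
the kernel of the remaining arcs is integrable, then the density survives with a probability that
is bounded below. -/
theorem Admissible.measure_le_mul_survives (hadm : Admissible ℓ d) {n : ℕ}
    (hn : ∀ k, n ≤ k → ℓ k ≤ 1 / 4) {r C : ℝ} (hr0 : 0 < r) (hr : r ≤ 1) (hC0 : 0 < C)
    (hC : ∀ s : Finset ℕ, (∀ k ∈ s, n ≤ k) →
        ∫⁻ t in Metric.closedBall (0 : UnitAddCircle) r,
          ENNReal.ofReal (Real.exp (∑ k ∈ s, max 0 (ℓ k - ‖t‖))) ≤ ENNReal.ofReal (C * r))
    {Q : Set (ℕ → UnitAddCircle)} (hQ : MeasurableSet Q)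
    (hQn : ∀ k, n ≤ k → ∀ x u, Function.update x k u ∈ Q ↔ x ∈ Q)
    {c : (ℕ → UnitAddCircle) → UnitAddCircle} (hc : Measurable c)
    (hcn : ∀ k, n ≤ k → ∀ x u, c (Function.update x k u) = c x)
    (hQc : ∀ x ∈ Q, ∀ t, rep (t - c x) < r → t ∈ uncoveredUpTo ℓ n x) :
    unifSeq Q ≤ 16 * ENNReal.ofReal (Real.exp (4 * ∑' n, ℓ n ^ 2) * C) *
      unifSeq (Q ∩ survives ℓ) := by
  have h0 : ∀ n, 0 ≤ ℓ n := fun n => (hadm.pos n).le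
  have hr0' : ENNReal.ofReal r ≠ 0 := by simpa using hr0
  set E := ENNReal.ofReal (Real.exp (4 * ∑' n, ℓ n ^ 2)) with hE
  have hC' : ENNReal.ofReal (Real.exp (4 * ∑' n, ℓ n ^ 2) * C) = E * ENNReal.ofReal C :=
    ENNReal.ofReal_mul (Real.exp_pos _).le
  rw [hC']
  set C0 := E * ENNReal.ofReal C with hC0'
  have hC00 : C0 ≠ 0 := mul_ne_zero (by simpa [hE] using Real.exp_pos _) (by simpa using hC0)
  have hC0T : C0 ≠ ∞ := ENNReal.mul_ne_top ENNReal.ofReal_ne_top ENNReal.ofReal_ne_top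
  -- The weight `w` below is, on `Q`, the uniform probability density on the interval of length `r`
  -- after `c`. It depends only on the first `n` arcs, hence is independent of the arcs in `[n, N)`.
  set W : Set ((ℕ → UnitAddCircle) × UnitAddCircle) := {z | z.1 ∈ Q ∧ rep (z.2 - c z.1) < r}
    with hW
  have hWm : MeasurableSet W := (measurable_fst hQ).inter
    (measurableSet_lt (measurable_rep.comp (measurable_snd.sub (hc.comp measurable_fst)))
      measurable_const)
  set w : (ℕ → UnitAddCircle) → UnitAddCircle → ℝ≥0∞ := fun x t =>
    W.indicator (fun _ => (ENNReal.ofReal r)⁻¹) (x, t) with hw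
  have hwm : Measurable (Function.uncurry w) := measurable_const.indicator hWm
  have hwn : ∀ k, n ≤ k → ∀ x u, w (Function.update x k u) = w x := by
    intro k hk x u
    funext t
    have : ((Function.update x k u, t) ∈ W) ↔ (x, t) ∈ W := by
      simp only [hW, Set.mem_ofPred_eq, hQn k hk, hcn k hk]
    simp only [hw]
    by_cases hx : (x, t) ∈ W
    · rw [Set.indicator_of_mem hx, Set.indicator_of_mem (this.2 hx)]
    · rw [Set.indicator_of_notMem hx, Set.indicator_of_notMem (fun h => hx (this.1 h))]
  have hwt : ∀ x, Measurable (w x) := fun x => hwm.comp measurable_prodMk_left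
  have hwi : ∀ x, ∫⁻ t, w x t = Q.indicator (fun _ => 1) x := by
    intro x
    by_cases hx : x ∈ Q
    · have e : ∀ t, w x t =
          {t : UnitAddCircle | rep (t - c x) < r}.indicator (fun _ => (ENNReal.ofReal r)⁻¹) t := by
        intro t
        simp only [hw, hW, Set.indicator, Set.mem_ofPred_eq, hx, true_and]
      simp only [e]
      have hrm : Measurable fun t : UnitAddCircle => rep (t - c x) :=
        measurable_rep.comp (measurable_id.sub measurable_const)
      rw [lintegral_indicator_const (measurableSet_lt hrm measurable_const), volume_rep_sub_lt _ hr,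
        ENNReal.inv_mul_cancel hr0' ENNReal.ofReal_ne_top, Set.indicator_of_mem hx]
    · have e : ∀ t, w x t = 0 := fun t => Set.indicator_of_notMem (fun h => hx h.1) _
      simp [e, Set.indicator_of_notMem hx]
  have hsupp : ∀ x s t, w x s * w x t ≤ w x s * ((ENNReal.ofReal r)⁻¹ *
      (Metric.closedBall (0 : UnitAddCircle) r).indicator (fun _ => 1) (t - s)) := by
    intro x s t
    by_cases hs : (x, s) ∈ W
    · by_cases ht : (x, t) ∈ W
      · have hb : t - s ∈ Metric.closedBall (0 : UnitAddCircle) r := by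
          rw [mem_closedBall_zero_iff]; exact norm_sub_le_of_rep_lt hs.2 ht.2
        rw [Set.indicator_of_mem hb, mul_one]
        gcongr
        exact Set.indicator_le_self _ _ _
      · have : w x t = 0 := Set.indicator_of_notMem ht _
        rw [this, mul_zero]; exact zero_le
    · have : w x s = 0 := Set.indicator_of_notMem hs _
      rw [this, zero_mul, zero_mul]
  set X : ℕ → (ℕ → UnitAddCircle) → ℝ≥0∞ := fun N x =>
    ∫⁻ t, w x t * ENNReal.ofReal (partialDensity ℓ (Finset.Ico n N) x t) with hX
  have hXm : ∀ N, Measurable (X N) := fun N =>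
    (hwm.mul (measurable_partialDensity_uncurry ℓ _).ennreal_ofReal).lintegral_prod_right'
  have hXQ : ∀ N, ∀ x ∉ Q, X N x = 0 := by
    intro N x hx
    have e : ∀ t, w x t = 0 := fun t => Set.indicator_of_notMem (fun h => hx h.1) _
    simp [hX, e]
  have hPZ : ∀ N, unifSeq Q ≤ 16 * C0 * unifSeq {x | 2⁻¹ ≤ X N x} := by
    intro N
    set s := Finset.Ico n N with hs
    have hsn : ∀ k ∈ s, n ≤ k := fun k hk => (Finset.mem_Ico.1 hk).1
    have hs4 : ∀ k ∈ s, ℓ k ≤ 1 / 4 := fun k hk => hn k (hsn k hk)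
    refine measure_le_mul_measure_half_le hQ (measure_ne_top _ _) (hXm N) (hXQ N) ?_ hC00 hC0T ?_
    · simp only [hX]
      rw [lintegral_weight_mul_partialDensity h0 hadm.lt_one s hwm fun k hk => hwn k (hsn k hk)]
      simp only [hwi]
      rw [lintegral_indicator_const hQ, one_mul]
    · simp only [hX]
      rw [lintegral_weight_mul_partialDensity_sq hadm.lt_one s hwm fun k hk => hwn k (hsn k hk)]
      have hcorr : ∀ u t : UnitAddCircle, ∏ k ∈ s, mixedMoment (ℓ k) ![u, t] =
          corrProd ℓ s (t - u) := fun u t =>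
        Finset.prod_congr rfl fun k hk => mixedMoment_two (h0 k) (by linarith [hs4 k hk]) u t
      simp only [hcorr]
      -- Two points of the support of `w` differ by at most `r`, so only the ball of radius `r`
      -- enters; there `hC` compensates the normalisation `1 / r`.
      set g : UnitAddCircle → ℝ≥0∞ := fun v => (ENNReal.ofReal r)⁻¹ *
        (Metric.closedBall (0 : UnitAddCircle) r).indicator
          (fun v => ENNReal.ofReal (corrProd ℓ s v)) v with hg
      have hgm : Measurable g := (((continuous_corrProd ℓ s).measurable.ennreal_ofReal).indicator
        Metric.isClosed_closedBall.measurableSet).const_mul _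
      have hgi : ∫⁻ v, g v ≤ C0 := by
        have hmexp : Measurable fun t : UnitAddCircle =>
            ENNReal.ofReal (Real.exp (∑ k ∈ s, max 0 (ℓ k - ‖t‖))) := by
          refine (Real.measurable_exp.comp (Finset.measurable_sum s fun k _ => ?_)).ennreal_ofReal
          exact measurable_const.max (measurable_const.sub measurable_norm)
        rw [hg, lintegral_const_mul _ (((continuous_corrProd ℓ s).measurable.ennreal_ofReal).indicator
          Metric.isClosed_closedBall.measurableSet),
          lintegral_indicator Metric.isClosed_closedBall.measurableSet]
        calc _ ≤ (ENNReal.ofReal r)⁻¹ * ∫⁻ t in Metric.closedBall (0 : UnitAddCircle) r,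
              E * ENNReal.ofReal (Real.exp (∑ k ∈ s, max 0 (ℓ k - ‖t‖))) := by
              gcongr with t
              rw [hE, ← ENNReal.ofReal_mul (Real.exp_pos _).le]
              exact ENNReal.ofReal_le_ofReal (corrProd_le_exp h0 hs4 (hadm.sum_sq_le s) t)
          _ ≤ (ENNReal.ofReal r)⁻¹ * (E * ENNReal.ofReal (C * r)) := by
              rw [lintegral_const_mul _ hmexp]
              gcongr
              exact hC s hsn
          _ = C0 * ((ENNReal.ofReal r)⁻¹ * ENNReal.ofReal r) := by
              rw [ENNReal.ofReal_mul hC0.le, hC0']; ring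
          _ = C0 := by rw [ENNReal.inv_mul_cancel hr0' ENNReal.ofReal_ne_top, mul_one]
      have hx : ∀ x, ∫⁻ z : UnitAddCircle × UnitAddCircle, w x z.1 * w x z.2 *
          ENNReal.ofReal (corrProd ℓ s (z.2 - z.1)) ≤ C0 * Q.indicator (fun _ => 1) x := by
        intro x
        calc _ ≤ ∫⁻ z : UnitAddCircle × UnitAddCircle, w x z.1 * g (z.2 - z.1) := by
              refine lintegral_mono fun z => ?_
              refine (mul_le_mul_left (hsupp x z.1 z.2) _).trans_eq ?_
              simp only [hg]
              rw [mul_assoc, mul_assoc]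
              congr 2
              by_cases hb : z.2 - z.1 ∈ Metric.closedBall (0 : UnitAddCircle) r
              · rw [Set.indicator_of_mem hb, Set.indicator_of_mem hb, one_mul]
              · rw [Set.indicator_of_notMem hb, Set.indicator_of_notMem hb, zero_mul]
          _ = ∫⁻ t, w x t * ∫⁻ v, g v := by
              have hm : Measurable fun z : UnitAddCircle × UnitAddCircle =>
                  w x z.1 * g (z.2 - z.1) :=
                ((hwt x).comp measurable_fst).mul (hgm.comp (measurable_snd.sub measurable_fst))
              rw [Measure.volume_eq_prod, lintegral_prod _ hm.aemeasurable]
              refine lintegral_congr fun t => ?_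
              have hgt : Measurable fun y => g (y - t) :=
                hgm.comp (measurable_id.sub measurable_const)
              simp only
              rw [lintegral_const_mul _ hgt]
              congr 1
              exact lintegral_sub_right_eq_self g t
          _ = (∫⁻ v, g v) * Q.indicator (fun _ => 1) x := by
              rw [lintegral_mul_const _ (hwt x), hwi, mul_comm]
          _ ≤ _ := by gcongr
      refine (lintegral_mono hx).trans_eq ?_
      rw [lintegral_const_mul _ (measurable_const.indicator hQ), lintegral_indicator_const hQ,
        one_mul]
  have h16 : 16 * C0 ≠ 0 := mul_ne_zero (by norm_num) hC00
  have h16T : 16 * C0 ≠ ∞ := ENNReal.mul_ne_top (by norm_num) hC0T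
  have hlow : unifSeq Q / (16 * C0) ≤
      unifSeq {x | ∃ᶠ N in atTop, x ∈ {x | 2⁻¹ ≤ X N x}} := by
    refine le_measure_limsup_of_forall_le
      (fun N => measurableSet_le measurable_const (hXm N)) (n0 := 0) fun N _ => ?_
    exact ENNReal.div_le_of_le_mul' (hPZ N)
  have hsub : {x | ∃ᶠ N in atTop, x ∈ {x | 2⁻¹ ≤ X N x}} ⊆ Q ∩ survives ℓ := by
    intro x hx
    refine ⟨?_, ?_⟩
    · obtain ⟨N, hN⟩ := hx.exists
      by_contra hxQ
      have hN' : 2⁻¹ ≤ X N x := hN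
      rw [hXQ N x hxQ] at hN'
      simp at hN'
    -- The first `n` factors are at least `1` on the support of `w`, and `w` has height `1 / r`;
    -- thus the mass is at least `r X`, hence at least `r / 2` infinitely often.
    · refine mem_survives_of_frequently (δ := ENNReal.ofReal r * 2⁻¹)
        (ENNReal.mul_pos hr0' (by simp)) ?_
      refine (hx.and_eventually (eventually_ge_atTop n)).mono fun N ⟨hN, hnN⟩ => ?_
      have hN' : 2⁻¹ ≤ X N x := hN
      refine (mul_le_mul_right hN' _).trans ?_
      have hmt : Measurable fun t => w x t *
          ENNReal.ofReal (partialDensity ℓ (Finset.Ico n N) x t) :=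
        (hwt x).mul (measurable_partialDensity ℓ _ x).ennreal_ofReal
      rw [hX, mass, ← lintegral_const_mul _ hmt]
      refine lintegral_mono fun t => ?_
      by_cases ht : (x, t) ∈ W
      · have hwx : w x t = (ENNReal.ofReal r)⁻¹ := Set.indicator_of_mem ht _
        simp only
        rw [hwx, ← mul_assoc, ENNReal.mul_inv_cancel hr0' ENNReal.ofReal_ne_top, one_mul]
        refine ENNReal.ofReal_le_ofReal ?_
        have hsplit : partialDensity ℓ (Finset.range N) x t =
            partialDensity ℓ (Finset.range n) x t * partialDensity ℓ (Finset.Ico n N) x t :=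
          (Finset.prod_range_mul_prod_Ico _ hnN).symm
        rw [hsplit]
        exact le_mul_of_one_le_left (partialDensity_nonneg hadm.lt_one _ _ _)
          (one_le_partialDensity h0 hadm.lt_one (hQc x ht.1 t ht.2))
      · have hwx : w x t = 0 := Set.indicator_of_notMem ht _
        simp [hwx]
  have := (ENNReal.div_le_iff_le_mul (Or.inl h16) (Or.inl h16T)).1 (hlow.trans (measure_mono hsub))
  rwa [mul_comm] at this

theorem prod_one_sub_le_exp (h : ∀ n, ℓ n < 1) (s : Finset ℕ) :
    ∏ k ∈ s, (1 - ℓ k) ≤ Real.exp (-∑ k ∈ s, ℓ k) := by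
  rw [← Finset.sum_neg_distrib, Real.exp_sum]
  refine Finset.prod_le_prod (fun k _ => by linarith [h k]) fun k _ => ?_
  linarith [Real.add_one_le_exp (-ℓ k)]

/-- Markov's inequality: at an uncovered point the density takes its maximal value `∏ (1 - ℓ k)⁻¹`,
while its mean is `1`. -/
theorem measure_forall_notMem_arc_le (h : ∀ n, ℓ n < 1) (s : Finset ℕ)
    {f : (ℕ → UnitAddCircle) → UnitAddCircle} (hf : Measurable f)
    (hf1 : ∫⁻ x, ENNReal.ofReal (partialDensity ℓ s x (f x)) ∂unifSeq = 1) :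
    unifSeq {x | ∀ k ∈ s, f x ∉ arc (x k) (ℓ k)} ≤
      ENNReal.ofReal (Real.exp (-∑ k ∈ s, ℓ k)) := by
  have hpos : 0 < ∏ k ∈ s, (1 - ℓ k) := Finset.prod_pos fun k _ => by linarith [h k]
  have hsub : {x | ∀ k ∈ s, f x ∉ arc (x k) (ℓ k)} ⊆
      {x | ENNReal.ofReal (∏ k ∈ s, (1 - ℓ k))⁻¹ ≤
        ENNReal.ofReal (partialDensity ℓ s x (f x))} := by
    intro x hx
    refine ENNReal.ofReal_le_ofReal (le_of_eq ?_)
    rw [← Finset.prod_inv_distrib]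
    refine Finset.prod_congr rfl fun k hk => ?_
    have := hx k hk
    rw [mem_arc_iff (h k).le] at this
    rw [pf, if_neg this, one_div]
  have hne : ENNReal.ofReal (∏ k ∈ s, (1 - ℓ k))⁻¹ ≠ 0 := by
    simpa using hpos
  have hm : Measurable fun x => ENNReal.ofReal (partialDensity ℓ s x (f x)) :=
    ((measurable_partialDensity_uncurry ℓ s).comp (measurable_id.prodMk hf)).ennreal_ofReal
  have hmk := meas_ge_le_lintegral_div (μ := unifSeq) hm.aemeasurable hne ENNReal.ofReal_ne_top
  rw [hf1] at hmk
  calc _ ≤ _ := measure_mono hsub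
    _ ≤ _ := hmk
    _ = ENNReal.ofReal (∏ k ∈ s, (1 - ℓ k)) := by
        rw [ENNReal.ofReal_inv_of_pos hpos, one_div, inv_inv]
    _ ≤ _ := ENNReal.ofReal_le_ofReal (prod_one_sub_le_exp h s)

theorem Admissible.measure_eq_zero_of_le (hadm : Admissible ℓ d) {A : Set (ℕ → UnitAddCircle)}
    {c : ℝ} (hA : ∀ n, unifSeq A ≤ ENNReal.ofReal (Real.exp (c - ∑ k ∈ Finset.range n, ℓ k))) :
    unifSeq A = 0 := by
  have h1 : Tendsto (fun n => ∑ k ∈ Finset.range n, ℓ k) atTop atTop :=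
    (not_summable_iff_tendsto_nat_atTop_of_nonneg fun n => (hadm.pos n).le).1 hadm.diverges
  have h2 : Tendsto (fun n => ENNReal.ofReal (Real.exp (c - ∑ k ∈ Finset.range n, ℓ k))) atTop
      (𝓝 0) := by
    rw [← ENNReal.ofReal_zero]
    refine ENNReal.tendsto_ofReal (Real.tendsto_exp_atBot.comp ?_)
    exact tendsto_atBot_add_const_left _ c (tendsto_neg_atTop_atBot.comp h1)
  exact le_antisymm (ge_of_tendsto h2 (Eventually.of_forall hA)) zero_le

/-- A given point is almost surely covered. -/
theorem Admissible.ae_exists_mem_arc (hadm : Admissible ℓ d) (a : UnitAddCircle) :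
    ∀ᵐ x ∂unifSeq, ∃ k, a ∈ arc (x k) (ℓ k) := by
  have h0 : ∀ n, 0 ≤ ℓ n := fun n => (hadm.pos n).le
  refine hadm.measure_eq_zero_of_le (c := 0) fun n => ?_
  refine (measure_mono ?_).trans ((measure_forall_notMem_arc_le hadm.lt_one (Finset.range n)
    (f := fun _ => a) measurable_const ?_).trans_eq (by rw [zero_sub]))
  · intro x hx k _ hk
    exact hx ⟨k, hk⟩
  · simpa using lintegral_mul_partialDensity h0 hadm.lt_one (Finset.range n) (fun _ => 1)
      measurable_const (fun _ _ _ _ => rfl) a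

/-- A translate of an endpoint is almost surely covered by the other arcs. -/
theorem Admissible.ae_exists_mem_arc_add (hadm : Admissible ℓ d) (j : ℕ) (c : UnitAddCircle) :
    ∀ᵐ x ∂unifSeq, ∃ k, x j + c ∈ arc (x k) (ℓ k) := by
  classical
  have h0 : ∀ n, 0 ≤ ℓ n := fun n => (hadm.pos n).le
  have hf : Measurable fun x : ℕ → UnitAddCircle => x j + c :=
    (measurable_pi_apply j).add measurable_const
  -- The constant `1` makes up for leaving out the arc `j`, as `ℓ j < 1`.
  refine hadm.measure_eq_zero_of_le (c := 1) fun n => ?_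
  have hone : ∫⁻ x, ENNReal.ofReal (partialDensity ℓ ((Finset.range n).erase j) x (x j + c))
      ∂unifSeq = 1 := by
    have hm : Measurable fun x : ℕ → UnitAddCircle =>
        ENNReal.ofReal (partialDensity ℓ ((Finset.range n).erase j) x (x j + c)) :=
      ((measurable_partialDensity_uncurry ℓ _).comp (measurable_id.prodMk hf)).ennreal_ofReal
    -- Resampling the coordinate `j` makes `x j + c` a uniform point independent of the other arcs.
    rw [lintegral_update j hm, ← lintegral_lintegral_partialDensity h0 hadm.lt_one
      ((Finset.range n).erase j)]
    refine lintegral_congr fun x => ?_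
    simp only [Function.update_self, partialDensity_update (Finset.notMem_erase j _)]
    exact lintegral_add_right_eq_self
      (fun t => ENNReal.ofReal (partialDensity ℓ ((Finset.range n).erase j) x t)) c
  refine (measure_mono ?_).trans ((measure_forall_notMem_arc_le hadm.lt_one
    ((Finset.range n).erase j) hf hone).trans (ENNReal.ofReal_le_ofReal (Real.exp_le_exp.2 ?_)))
  · intro x hx k _ hk
    exact hx ⟨k, hk⟩
  · have : ∑ k ∈ Finset.range n, ℓ k ≤ ∑ k ∈ insert j ((Finset.range n).erase j), ℓ k :=
      Finset.sum_le_sum_of_subset_of_nonneg (Finset.insert_erase_subset j _) fun k _ _ => h0 k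
    rw [Finset.sum_insert (Finset.notMem_erase j _)] at this
    linarith [hadm.lt_one j]

end

/-! ### Conditional survival at a good scale, up to an exceptional event. -/

section

variable {ℓ : ℕ → ℝ} {d : ℕ}

theorem uncoveredUpTo_update {n i : ℕ} (h : n ≤ i) (x : ℕ → UnitAddCircle) (u : UnitAddCircle) :
    uncoveredUpTo ℓ n (Function.update x i u) = uncoveredUpTo ℓ n x := by
  ext t
  refine forall_congr' fun j => forall_congr' fun hj => ?_
  rw [Function.update_of_ne (by omega)]

theorem update_mem_firstEnd_iff {a : UnitAddCircle} {m n k i : ℕ} (hk : k < n) (h : n ≤ i)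
    (x : ℕ → UnitAddCircle) (u : UnitAddCircle) :
    Function.update x i u ∈ firstEnd ℓ a m n k ↔ x ∈ firstEnd ℓ a m n k := by
  have e : ∀ j, j < n → rightEnd ℓ (Function.update x i u) j = rightEnd ℓ x j := fun j hj =>
    rightEnd_update (by omega) x u
  simp only [firstEnd, Set.mem_ofPred_eq, uncoveredUpTo_update h, e k hk]
  refine and_congr_right fun _ => and_congr_right fun _ => forall_congr' fun j =>
    forall_congr' fun _ => forall_congr' fun hj => ?_
  rw [e j hj]

/-- The exceptional event: `a` or one of the first `m` right endpoints is uncovered, or one of the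
first `m` arcs starts shortly after an uncovered right endpoint. -/
def exceptional (ℓ : ℕ → ℝ) (a : UnitAddCircle) (m n : ℕ) (r : ℝ) : Set (ℕ → UnitAddCircle) :=
  {x | a ∈ uncoveredUpTo ℓ n x} ∪ ((⋃ j ∈ Finset.range m, {x | rightEnd ℓ x j ∈ uncoveredUpTo ℓ n x}) ∪
    ⋃ i ∈ Finset.range m, ⋃ k ∈ Finset.range n,
      ({x | rightEnd ℓ x k ∈ uncoveredUpTo ℓ n x} ∩ {x | rep (x i - rightEnd ℓ x k) < r}))

theorem measurableSet_exceptional (h : ∀ n, ℓ n < 1) (a : UnitAddCircle) (m n : ℕ) (r : ℝ) :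
    MeasurableSet (exceptional ℓ a m n r) := by
  have hu := fun j => measurableSet_mem_uncoveredUpTo h n (measurable_rightEnd ℓ j)
  refine (measurableSet_mem_uncoveredUpTo h n measurable_const).union
    ((Finset.measurableSet_biUnion _ fun j _ => hu j).union
    (Finset.measurableSet_biUnion _ fun i _ => Finset.measurableSet_biUnion _ fun k _ =>
      (hu k).inter ?_))
  exact measurableSet_lt (measurable_rep.comp
    ((measurable_pi_apply i).sub (measurable_rightEnd ℓ k))) measurable_const

theorem norm_le_rep (t : UnitAddCircle) : ‖t‖ ≤ rep t := by
  rw [norm_eq_min_rep]; exact min_le_left _ _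

/-- Almost surely `a` and the endpoints of the first `m` arcs all lie in the union of the open arcs.
For a given realisation these finitely many points are covered from some stage on, and the
exceptional event eventually fails. -/
theorem Admissible.tendsto_measure_exceptional (hadm : Admissible ℓ d) (a : UnitAddCircle) (m : ℕ)
    {n : ℕ → ℕ} {r : ℕ → ℝ} (hn : Tendsto n atTop atTop) (hr : Tendsto r atTop (𝓝 0)) :
    Tendsto (fun i => unifSeq (exceptional ℓ a m (n i) (r i))) atTop (𝓝 0) := by
  rw [← measure_empty (μ := unifSeq)]
  refine tendsto_measure_of_ae_tendsto_indicator_of_isFiniteMeasure _ MeasurableSet.empty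
    (fun i => measurableSet_exceptional hadm.lt_one a m _ _) ?_
  filter_upwards [hadm.ae_exists_mem_arc a,
    ae_all_iff.2 fun j => hadm.ae_exists_mem_arc_add j (ℓ j : UnitAddCircle),
    ae_all_iff.2 fun j => hadm.ae_exists_mem_arc_add j 0] with x hxa hxe hxs
  have h1 : ∀ᶠ i in atTop, a ∉ uncoveredUpTo ℓ (n i) x := by
    obtain ⟨l, hl⟩ := hxa
    filter_upwards [hn.eventually_gt_atTop l] with i hi hcon
    exact hcon l hi hl
  have h2 : ∀ᶠ i in atTop, ∀ j ∈ Finset.range m, rightEnd ℓ x j ∉ uncoveredUpTo ℓ (n i) x := by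
    rw [Filter.eventually_all_finset]
    intro j _
    obtain ⟨l, hl⟩ := hxe j
    filter_upwards [hn.eventually_gt_atTop l] with i hi hcon
    exact hcon l hi hl
  -- The left endpoint `x j` is interior to some open arc, so a point at distance less than `δ` from
  -- it is covered as well.
  have h3 : ∀ᶠ i in atTop, ∀ j ∈ Finset.range m, ∀ k, rightEnd ℓ x k ∈ uncoveredUpTo ℓ (n i) x →
      ¬ rep (x j - rightEnd ℓ x k) < r i := by
    rw [Filter.eventually_all_finset]
    intro j _
    obtain ⟨l, hl⟩ := hxs j
    rw [add_zero] at hl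
    obtain ⟨δ, hδ, hball⟩ := Metric.isOpen_iff.1 (isOpen_arc (x l) (ℓ l)) _ hl
    filter_upwards [hn.eventually_gt_atTop l, hr.eventually (gt_mem_nhds hδ)] with i hi hri k hk hcon
    refine hk l hi (hball ?_)
    rw [Metric.mem_ball, dist_eq_norm, norm_sub_rev]
    exact ((norm_le_rep _).trans_lt hcon).trans hri
  filter_upwards [h1, h2, h3] with i hi1 hi2 hi3
  simp only [Set.mem_empty_iff_false, iff_false]
  rintro (hx | hx | hx)
  · exact hi1 hx
  · obtain ⟨j, hj, hx⟩ := Set.mem_iUnion₂.1 hx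
    exact hi2 j hj hx
  · obtain ⟨j, hj, hx⟩ := Set.mem_iUnion₂.1 hx
    obtain ⟨k, hk, hx1, hx2⟩ := Set.mem_iUnion₂.1 hx
    exact hi3 j hj k hx1 hx2

theorem sum_measure_le_of_subset_firstEnd (a : UnitAddCircle) (m n : ℕ)
    {U : ℕ → Set (ℕ → UnitAddCircle)} (hU : ∀ k, MeasurableSet (U k)) {S : Set (ℕ → UnitAddCircle)}
    (hUT : ∀ k, U k ⊆ firstEnd ℓ a m n k) (hUS : ∀ k, U k ⊆ S) :
    ∑ k ∈ Finset.Ico m n, unifSeq (U k) ≤ unifSeq S := by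
  rw [← measure_biUnion_finset (fun k hk k' hk' hne => ?_) fun k _ => hU k]
  · exact measure_mono (Set.iUnion₂_subset fun k _ => hUS k)
  · have h1 := Finset.mem_Ico.1 hk
    have h2 := Finset.mem_Ico.1 hk'
    exact (firstEnd_disjoint ℓ a h1.1 h1.2 h2.1 h2.2 hne).mono (hUT k) (hUT k')

/-- Here `n / p ≤ 8` and `1 - 1 / p ≥ exp (-2 / p)`, so moving up to `n` arcs costs at most a
constant factor, independent of the scale. -/
theorem exp_neg_sixteen_le {p n c : ℕ} (hp : 2 ≤ p) (hnp : n * (1 / (4 * (p : ℝ))) ≤ 2)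
    (hc : c ≤ n) : Real.exp (-16) ≤ (1 - 1 / (p : ℝ)) ^ c := by
  have hp' : (2 : ℝ) ≤ p := by exact_mod_cast hp
  have hv : 1 / (p : ℝ) ≤ 1 / 2 := one_div_le_one_div_of_le (by norm_num) hp'
  have hv0 : 0 ≤ 1 / (p : ℝ) := by positivity
  have h1 := exp_neg_le_one_sub hv0 hv
  have h2 : Real.exp (-(2 * (1 / (p : ℝ)))) ≤ 1 - 1 / (p : ℝ) := by
    refine le_trans (Real.exp_le_exp.2 ?_) h1
    nlinarith
  calc Real.exp (-16) ≤ Real.exp (-(2 * (1 / (p : ℝ)))) ^ c := by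
        rw [← Real.exp_nat_mul]
        refine Real.exp_le_exp.2 ?_
        have hcn : (c : ℝ) ≤ n := by exact_mod_cast hc
        have h3 : (n : ℝ) * (1 / (p : ℝ)) ≤ 8 := by
          have : (n : ℝ) * (1 / (4 * (p : ℝ))) = n * (1 / (p : ℝ)) / 4 := by
            field_simp
          linarith
        have h4 : (c : ℝ) * (1 / (p : ℝ)) ≤ n * (1 / (p : ℝ)) :=
          mul_le_mul_of_nonneg_right hcn hv0
        linarith
    _ ≤ _ := pow_le_pow_left₀ (Real.exp_pos _).le h2 c

/-- On the event that some point at distance at most `1 / 4` after `a` is never covered, the density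
survives with a conditional probability bounded below, at a good scale and up to the exceptional
event. -/
theorem Admissible.measure_inter_le (hadm : Admissible ℓ d) {m n p : ℕ}
    (hm : ∀ k, m ≤ k → ℓ k < 1 / 4) (hmn : m ≤ n) (hp : 2 ≤ p)
    (hnp : n * (1 / (4 * (p : ℝ))) ≤ 2) {C : ℝ} (hC0 : 0 < C)
    (hC : ∀ s : Finset ℕ, (∀ k ∈ s, n ≤ k) →
        ∫⁻ t in Metric.closedBall (0 : UnitAddCircle) (1 / (4 * (p : ℝ))),
          ENNReal.ofReal (Real.exp (∑ k ∈ s, max 0 (ℓ k - ‖t‖))) ≤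
            ENNReal.ofReal (C * (1 / (4 * (p : ℝ)))))
    {D : Set (ℕ → UnitAddCircle)} (hD : MeasurableSet D)
    (hDm : ∀ k, m ≤ k → ∀ x u, Function.update x k u ∈ D ↔ x ∈ D) (a : UnitAddCircle) :
    unifSeq (D ∩ {x | ∃ t ∈ uncovered ℓ x, rep (t - a) ≤ 1 / 4}) ≤
      ENNReal.ofReal (Real.exp 16) * (16 * ENNReal.ofReal (Real.exp (4 * ∑' n, ℓ n ^ 2) * C)) *
        unifSeq (D ∩ survives ℓ) + (ENNReal.ofReal (Real.exp 16) + 1) *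
          unifSeq (exceptional ℓ a m n (1 / (4 * (p : ℝ)))) := by
  classical
  have hp' : (2 : ℝ) ≤ p := by exact_mod_cast hp
  set r : ℝ := 1 / (4 * (p : ℝ)) with hr
  have hr0 : 0 < r := by positivity
  have hr8 : r ≤ 1 / 8 := by
    rw [hr]
    exact one_div_le_one_div_of_le (by norm_num) (by linarith)
  set c := ENNReal.ofReal (Real.exp 16) with hc
  set c2 := 16 * ENNReal.ofReal (Real.exp (4 * ∑' n, ℓ n ^ 2) * C) with hc2
  set bad := exceptional ℓ a m n r with hbad
  have hbadm : MeasurableSet bad := measurableSet_exceptional hadm.lt_one a m n r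
  set T := firstEnd ℓ a m n with hT
  have hTm : ∀ k, MeasurableSet (T k) := measurableSet_firstEnd hadm.lt_one a m n
  have hgm : ∀ i k, Measurable fun x : ℕ → UnitAddCircle => rep (x i - rightEnd ℓ x k) := fun i k =>
    measurable_rep.comp ((measurable_pi_apply i).sub (measurable_rightEnd ℓ k))
  -- No arc among the first `n` starts within `r` after the endpoint `k`; together with `T k` this
  -- leaves an interval of length `r` uncovered by them.
  set G : ℕ → Set (ℕ → UnitAddCircle) := fun k =>
    ⋂ i ∈ Finset.range n, {x | r ≤ rep (x i - rightEnd ℓ x k)} with hG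
  have hGm : ∀ k, MeasurableSet (G k) := fun k =>
    Finset.measurableSet_biInter _ fun i _ => measurableSet_le measurable_const (hgm i k)
  set Q : ℕ → Set (ℕ → UnitAddCircle) := fun k => D ∩ T k ∩ G k with hQ
  have hQm : ∀ k, MeasurableSet (Q k) := fun k => (hD.inter (hTm k)).inter (hGm k)
  have hQle : ∀ k ∈ Finset.Ico m n, unifSeq (Q k) ≤ c2 * unifSeq (Q k ∩ survives ℓ) := by
    intro k hk
    obtain ⟨hkm, hkn⟩ := Finset.mem_Ico.1 hk
    refine hadm.measure_le_mul_survives (n := n) (fun k hk => (hm k (hmn.trans hk)).le) hr0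
      (by linarith) hC0 hC (hQm k) (fun i hi x u => ?_) (measurable_rightEnd ℓ k)
      (fun i hi x u => rightEnd_update (by omega) x u) fun x hx t ht => ?_
    · have e : Function.update x i u ∈ G k ↔ x ∈ G k := by
        simp only [hG, Set.mem_iInter]
        refine forall_congr' fun j => forall_congr' fun hj => ?_
        have hjn := Finset.mem_range.1 hj
        simp only [Set.mem_ofPred_eq]
        rw [rightEnd_update (by omega), Function.update_of_ne (by omega)]
      simp only [hQ, Set.mem_inter_iff, hDm i (hmn.trans hi), hT, update_mem_firstEnd_iff hkn hi, e]
    · refine mem_uncoveredUpTo_of_rep_lt hadm.lt_one hx.1.2.2.1 (fun j hj => ?_) ht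
      exact Set.mem_iInter₂.1 hx.2 j (Finset.mem_range.2 hj)
  have hTk : ∀ k ∈ Finset.Ico m n, unifSeq (D ∩ T k) ≤
      c * (unifSeq (Q k) + unifSeq (D ∩ T k ∩ bad)) := by
    intro k hk
    obtain ⟨hkm, hkn⟩ := Finset.mem_Ico.1 hk
    set I := (Finset.Ico m n).erase k with hI
    have hIm : ∀ i ∈ I, i ≠ k ∧ m ≤ i ∧ i < n := fun i hi => by
      obtain ⟨h1, h2⟩ := Finset.mem_erase.1 hi
      exact ⟨h1, Finset.mem_Ico.1 h2⟩
    -- Only the arcs of index in `[m, n)` other than `k` are moved: `D` does not depend on them, and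
    -- they are short enough to leave the first uncovered endpoint unchanged.
    have h1 := mul_measureReal_le_inter (hD.inter (hTm k)) (I := I) (measurable_rightEnd ℓ k)
      (fun i hi x u => rightEnd_update (hIm i hi).1 x u)
      (fun i hi x hx hxi u hu => ⟨(hDm i (hIm i hi).2.1 x u).2 hx.1,
        update_mem_firstEnd hadm.pos hadm.lt_one (hIm i hi).1 (hm i (hIm i hi).2.1) hx.2 hxi hu⟩)
      (p := p) (by omega)
    have hcard : I.card ≤ n := by
      calc I.card ≤ (Finset.range n).card := Finset.card_le_card fun i hi =>
            Finset.mem_range.2 (hIm i hi).2.2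
        _ = n := Finset.card_range n
    have h2 := exp_neg_sixteen_le hp hnp hcard
    set R := D ∩ T k ∩ {x | ∀ i ∈ I, 1 / (4 * (p : ℝ)) ≤ rep (x i - rightEnd ℓ x k)} with hR
    have h3 : unifSeq.real (D ∩ T k) ≤ Real.exp 16 * unifSeq.real R := by
      have h4 : Real.exp (-16) * unifSeq.real (D ∩ T k) ≤ unifSeq.real R :=
        (mul_le_mul_of_nonneg_right h2 measureReal_nonneg).trans h1
      calc unifSeq.real (D ∩ T k) = Real.exp 16 * (Real.exp (-16) * unifSeq.real (D ∩ T k)) := by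
            rw [← mul_assoc, ← Real.exp_add]; simp
        _ ≤ _ := mul_le_mul_of_nonneg_left h4 (Real.exp_pos _).le
    have h4 : unifSeq (D ∩ T k) ≤ c * unifSeq R := by
      rw [← ofReal_measureReal (μ := unifSeq) (s := D ∩ T k), ← ofReal_measureReal (μ := unifSeq) (s := R), hc,
        ← ENNReal.ofReal_mul (Real.exp_pos _).le]
      exact ENNReal.ofReal_le_ofReal h3
    refine h4.trans (mul_le_mul_right ((measure_mono ?_).trans (measure_union_le _ _)) c)
    rintro x ⟨hxDT, hxI⟩
    by_cases hxb : x ∈ bad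
    · exact Or.inr ⟨hxDT, hxb⟩
    · refine Or.inl ⟨hxDT, Set.mem_iInter₂.2 fun i hi => ?_⟩
      have hin := Finset.mem_range.1 hi
      change r ≤ rep (x i - rightEnd ℓ x k)
      -- The arcs that were not moved: those of index below `m` are controlled off the exceptional
      -- event, and the arc `k` itself starts `1 - ℓ k > r` after its right endpoint.
      by_cases him : i < m
      · by_contra! hcon
        refine hxb (Or.inr (Or.inr (Set.mem_iUnion₂.2 ⟨i, Finset.mem_range.2 him,
          Set.mem_iUnion₂.2 ⟨k, Finset.mem_range.2 hkn, hxDT.2.2.1, hcon⟩⟩)))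
      · by_cases hik : i = k
        · subst hik
          have e : ((1 - ℓ i : ℝ) : UnitAddCircle) = x i - rightEnd ℓ x i := by
            rw [rightEnd, AddCircle.coe_sub, coe_one_eq]; abel
          have hi4 := hm i hkm
          rw [rep_eq_of_coe_eq e (by linarith) (by linarith [hadm.pos i])]
          linarith
        · exact hxI i (Finset.mem_erase.2 ⟨hik, Finset.mem_Ico.2 ⟨not_lt.1 him, hin⟩⟩)
  have hsub : D ∩ {x | ∃ t ∈ uncovered ℓ x, rep (t - a) ≤ 1 / 4} ⊆
      bad ∪ ⋃ k ∈ Finset.Ico m n, (D ∩ T k) := by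
    rintro x ⟨hxD, t, ht, hta⟩
    by_cases hxb : x ∈ bad
    · exact Or.inl hxb
    · right
      have htn : t ∈ uncoveredUpTo ℓ n x := fun j _ hcon => ht (Set.mem_iUnion.2 ⟨j, hcon⟩)
      obtain ⟨k, hkm, hkn, hkT⟩ := exists_mem_firstEnd (m := m) hadm.lt_one htn hta
        (fun h => hxb (Or.inl h)) (fun j hj h => hxb (Or.inr (Or.inl
          (Set.mem_iUnion₂.2 ⟨j, Finset.mem_range.2 hj, h⟩))))
      exact Set.mem_iUnion₂.2 ⟨k, Finset.mem_Ico.2 ⟨hkm, hkn⟩, hxD, hkT⟩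
  calc _ ≤ unifSeq bad + ∑ k ∈ Finset.Ico m n, unifSeq (D ∩ T k) :=
        (measure_mono hsub).trans ((measure_union_le _ _).trans
          (add_le_add_right (measure_biUnion_finset_le _ _) _))
    _ ≤ unifSeq bad + ∑ k ∈ Finset.Ico m n,
          c * (c2 * unifSeq (Q k ∩ survives ℓ) + unifSeq (D ∩ T k ∩ bad)) := by
        refine add_le_add_right (Finset.sum_le_sum fun k hk => (hTk k hk).trans ?_) _
        exact mul_le_mul_right (add_le_add_left (hQle k hk) _) c
    _ = unifSeq bad + (c * c2 * ∑ k ∈ Finset.Ico m n, unifSeq (Q k ∩ survives ℓ) +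
          c * ∑ k ∈ Finset.Ico m n, unifSeq (D ∩ T k ∩ bad)) := by
        rw [← Finset.mul_sum, Finset.sum_add_distrib, ← Finset.mul_sum, mul_add, mul_assoc c c2]
    _ ≤ unifSeq bad + (c * c2 * unifSeq (D ∩ survives ℓ) + c * unifSeq bad) := by
        gcongr
        · exact sum_measure_le_of_subset_firstEnd a m n
            (fun k => (hQm k).inter (measurableSet_survives ℓ)) (fun k x hx => hx.1.1.2)
            fun k x hx => ⟨hx.1.1.1, hx.2⟩
        · exact sum_measure_le_of_subset_firstEnd a m n
            (fun k => (hD.inter (hTm k)).inter hbadm) (fun k x hx => hx.1.2) fun k x hx => hx.2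
    _ = _ := by ring

end

/-! ### Survival almost surely when the uncovered set is nonempty. -/

section

variable {ℓ : ℕ → ℝ} {d : ℕ}

/-- Along good scales tending to `0` the exceptional term vanishes. The constant does not depend on
the cylinder, which is what makes the approximation argument possible; raising `m` to `max m m0`
only ensures that the moved arcs are short. -/
theorem Admissible.exists_measure_inter_cylinder_le (hadm : Admissible ℓ d) :
    ∃ c : ℝ≥0∞, c ≠ ∞ ∧ ∀ (a : UnitAddCircle) (m : ℕ) (D : Set (ℕ → UnitAddCircle)),
      MeasurableSet D → (∀ k, m ≤ k → ∀ x u, Function.update x k u ∈ D ↔ x ∈ D) →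
      unifSeq (D ∩ {x | ∃ t ∈ uncovered ℓ x, rep (t - a) ≤ 1 / 4}) ≤
        c * unifSeq (D ∩ survives ℓ) := by
  obtain ⟨C, hC0, hC⟩ := hadm.exists_good_scale
  obtain ⟨m0, hm0⟩ := hadm.exists_le (δ := 1 / 8) (by norm_num)
  set c := ENNReal.ofReal (Real.exp 16) *
    (16 * ENNReal.ofReal (Real.exp (4 * ∑' n, ℓ n ^ 2) * C)) with hc
  refine ⟨c, ENNReal.mul_ne_top ENNReal.ofReal_ne_top
    (ENNReal.mul_ne_top (by norm_num) ENNReal.ofReal_ne_top), fun a m D hD hDm => ?_⟩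
  choose p n hp hn hpε hnp hint using fun i : ℕ =>
    hC (1 / ((i : ℝ) + 1)) (by positivity) (max i (max m m0))
  have hr : Tendsto (fun i => 1 / (4 * (p i : ℝ))) atTop (𝓝 0) :=
    squeeze_zero (fun i => by positivity) (fun i => (hpε i).le)
      tendsto_one_div_add_atTop_nhds_zero_nat
  have hnt : Tendsto n atTop atTop :=
    tendsto_atTop_mono (fun i => (le_max_left _ _).trans (hn i)) tendsto_id
  have ht := hadm.tendsto_measure_exceptional a (max m m0) hnt hr
  have ht2 : Tendsto (fun i => c * unifSeq (D ∩ survives ℓ) + (ENNReal.ofReal (Real.exp 16) + 1) *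
      unifSeq (exceptional ℓ a (max m m0) (n i) (1 / (4 * (p i : ℝ))))) atTop
      (𝓝 (c * unifSeq (D ∩ survives ℓ) + (ENNReal.ofReal (Real.exp 16) + 1) * 0)) :=
    tendsto_const_nhds.add (ENNReal.Tendsto.const_mul ht (Or.inr (by simp)))
  rw [mul_zero, add_zero] at ht2
  refine ge_of_tendsto ht2 (Eventually.of_forall fun i => ?_)
  exact hadm.measure_inter_le
    (fun k hk => (hm0 k ((le_max_right _ _).trans hk)).trans_lt (by norm_num))
    ((le_max_right _ _).trans (hn i)) (hp i) (hnp i) hC0 (hint i) hD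
    (fun k hk => hDm k ((le_max_left _ _).trans hk)) a

theorem exists_cylinder_symmDiff_lt {B : Set (ℕ → UnitAddCircle)} (hB : MeasurableSet B)
    {ε : ℝ≥0∞} (hε : 0 < ε) : ∃ (m : ℕ) (D : Set (ℕ → UnitAddCircle)), MeasurableSet D ∧
      (∀ k, m ≤ k → ∀ x u, Function.update x k u ∈ D ↔ x ∈ D) ∧ unifSeq (symmDiff D B) < ε := by
  obtain ⟨D, hD, hlt⟩ := exists_measure_symmDiff_lt_of_generateFrom_isSetRing (μ := unifSeq)
    (isSetRing_measurableCylinders (α := fun _ : ℕ => UnitAddCircle))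
    ⟨{Set.univ}, Set.countable_singleton _,
      Set.singleton_subset_iff.2 (univ_mem_measurableCylinders _), by simp⟩
    generateFrom_measurableCylinders.symm hB hε
  obtain ⟨s, S, hS, rfl⟩ := (mem_measurableCylinders D).1 hD
  refine ⟨s.sup id + 1, cylinder s S, MeasurableSet.cylinder s hS, fun k hk x u => ?_, hlt⟩
  rw [mem_cylinder, mem_cylinder]
  have : s.restrict (Function.update x k u) = s.restrict x := by
    funext i
    have h1 : (i : ℕ) ≤ s.sup id := Finset.le_sup (f := id) i.2
    simp only [Finset.restrict]
    rw [Function.update_of_ne (by omega)]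
  rw [this]

/-- Almost surely, if some point is never covered then the total masses do not tend to zero. -/
theorem Admissible.ae_mem_survives (hadm : Admissible ℓ d) :
    ∀ᵐ x ∂unifSeq, (uncovered ℓ x).Nonempty → x ∈ survives ℓ := by
  obtain ⟨c, hcT, hc⟩ := hadm.exists_measure_inter_cylinder_le
  have key : ∀ a : UnitAddCircle, ∀ᵐ x ∂unifSeq,
      (∃ t ∈ uncovered ℓ x, rep (t - a) ≤ 1 / 4) → x ∈ survives ℓ := by
    intro a
    set A := {x : ℕ → UnitAddCircle | ∃ t ∈ uncovered ℓ x, rep (t - a) ≤ 1 / 4} with hA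
    -- For a cylinder `D` close to the event of extinction, `D ∩ survives ℓ` is small; the uniform
    -- bound then makes `D ∩ A` small, and with it `A ∩ (survives ℓ)ᶜ`.
    have hle : ∀ i : ℕ, unifSeq (A ∩ (survives ℓ)ᶜ) ≤ (c + 1) * ((i : ℝ≥0∞) + 1)⁻¹ := by
      intro i
      obtain ⟨m, D, hD, hDm, hlt⟩ := exists_cylinder_symmDiff_lt (measurableSet_survives ℓ).compl
        (ε := ((i : ℝ≥0∞) + 1)⁻¹) (by simp)
      have h1 : A ∩ (survives ℓ)ᶜ ⊆ (D ∩ A) ∪ symmDiff D (survives ℓ)ᶜ := by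
        rintro x ⟨hxA, hxB⟩
        by_cases hxD : x ∈ D
        · exact Or.inl ⟨hxD, hxA⟩
        · exact Or.inr (Or.inr ⟨hxB, hxD⟩)
      have h2 : D ∩ survives ℓ ⊆ symmDiff D (survives ℓ)ᶜ := fun x hx =>
        Or.inl ⟨hx.1, fun h => h hx.2⟩
      calc _ ≤ unifSeq (D ∩ A) + unifSeq (symmDiff D (survives ℓ)ᶜ) :=
            (measure_mono h1).trans (measure_union_le _ _)
        _ ≤ c * unifSeq (symmDiff D (survives ℓ)ᶜ) + unifSeq (symmDiff D (survives ℓ)ᶜ) := by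
            gcongr
            exact (hc a m D hD hDm).trans (mul_le_mul_right (measure_mono h2) c)
        _ = (c + 1) * unifSeq (symmDiff D (survives ℓ)ᶜ) := by ring
        _ ≤ _ := by gcongr
    have ht : Tendsto (fun i : ℕ => (c + 1) * ((i : ℝ≥0∞) + 1)⁻¹) atTop (𝓝 ((c + 1) * 0)) := by
      refine ENNReal.Tendsto.const_mul ?_ (Or.inr (by simp [hcT]))
      have := (tendsto_add_atTop_iff_nat 1).2 ENNReal.tendsto_inv_nat_nhds_zero
      simpa using this
    rw [mul_zero] at ht
    have h0 : unifSeq (A ∩ (survives ℓ)ᶜ) = 0 :=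
      le_antisymm (ge_of_tendsto ht (Eventually.of_forall hle)) zero_le
    refine measure_mono_null (fun x hx => ?_) h0
    simp only [Set.mem_compl_iff, Set.mem_ofPred_eq, Classical.not_imp] at hx
    exact hx
  -- Every point lies within `1 / 4` after one of the base points `q / 4`.
  have h4 : ∀ᵐ x ∂unifSeq, ∀ q : ℕ,
      (∃ t ∈ uncovered ℓ x, rep (t - ((q / 4 : ℝ) : UnitAddCircle)) ≤ 1 / 4) → x ∈ survives ℓ :=
    ae_all_iff.2 fun q => key _
  filter_upwards [h4] with x hx ⟨t, ht⟩
  have h0 := rep_nonneg t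
  have hq1 := Nat.floor_le (a := 4 * rep t) (by positivity)
  have hq2 := Nat.lt_floor_add_one (4 * rep t)
  refine hx ⌊4 * rep t⌋₊ ⟨t, ht, ?_⟩
  have e : ((rep t - (⌊4 * rep t⌋₊ / 4 : ℝ) : ℝ) : UnitAddCircle) =
      t - ((⌊4 * rep t⌋₊ / 4 : ℝ) : UnitAddCircle) := by
    rw [AddCircle.coe_sub, coe_rep]
  rw [rep_eq_of_coe_eq e (by linarith) (by linarith)]
  linarith

theorem mass_eq (h : ∀ n, ℓ n < 1) (n : ℕ) (x : ℕ → UnitAddCircle) :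
    mass ℓ n x = ((approxMeasure ℓ x n).mass : ℝ≥0∞) := by
  rw [FiniteMeasure.ennreal_mass, approxMeasure_apply ℓ h, withDensity_apply _ MeasurableSet.univ,
    Measure.restrict_univ, mass]

theorem ne_zero_of_mem_survives (h : ∀ n, ℓ n < 1) {x : ℕ → UnitAddCircle}
    {ν : FiniteMeasure UnitAddCircle} (hν : Tendsto (approxMeasure ℓ x) atTop (𝓝 ν))
    (hx : x ∈ survives ℓ) : ν ≠ 0 := by
  rintro rfl
  have h1 := (FiniteMeasure.continuous_mass.tendsto _).comp hν
  have h2 : Tendsto (fun n => mass ℓ n x) atTop (𝓝 0) := by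
    simp only [mass_eq h]
    have := (ENNReal.continuous_coe.tendsto _).comp h1
    simpa [Function.comp_def] using this
  have h3 : 0 < limsup (fun n => mass ℓ n x) atTop := hx
  rw [h2.limsup_eq] at h3
  exact lt_irrefl _ h3

theorem nonempty_uncovered_of_ne_zero {x : ℕ → UnitAddCircle} {ν : FiniteMeasure UnitAddCircle}
    (hν : ν ≠ 0) (h : (ν : Measure UnitAddCircle) (uncovered ℓ x)ᶜ = 0) :
    (uncovered ℓ x).Nonempty := by
  by_contra hcon
  rw [Set.not_nonempty_iff_eq_empty] at hcon
  rw [hcon, Set.compl_empty, Measure.measure_univ_eq_zero] at h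
  exact hν (Subtype.ext h)

end

/-! ### The lengths `α / n`. -/

section

/-- The linear map that replaces one coordinate by the opposite of the sum. -/
def swapSum {d : ℕ} (j : Fin d) : (Fin d → UnitAddCircle) →+ (Fin d → UnitAddCircle) where
  toFun t := Function.update t j (-∑ i, t i)
  map_zero' := by simp
  map_add' s t := by
    rw [← Function.update_add]
    simp only [Pi.add_apply, Finset.sum_add_distrib, neg_add]

theorem swapSum_apply {d : ℕ} (j : Fin d) (t : Fin d → UnitAddCircle) :
    swapSum j t = Function.update t j (-∑ i, t i) := rfl

theorem swapSum_swapSum {d : ℕ} (j : Fin d) (t : Fin d → UnitAddCircle) :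
    swapSum j (swapSum j t) = t := by
  have e : ∑ i, swapSum j t i = -t j := by
    rw [swapSum_apply, Finset.sum_update_of_mem (Finset.mem_univ j),
      ← Finset.add_sum_erase _ _ (Finset.mem_univ j), Finset.sdiff_singleton_eq_erase]
    abel
  rw [swapSum_apply, e, neg_neg, swapSum_apply, Function.update_idem, Function.update_eq_self]

theorem measurePreserving_swapSum {d : ℕ} (j : Fin d) :
    MeasurePreserving (swapSum j) volume volume := by
  refine AddMonoidHom.measurePreserving ?_ (fun t => ⟨swapSum j t, swapSum_swapSum j t⟩) rfl
  exact continuous_id.update j (continuous_finsetSum _ fun i _ => continuous_apply i).neg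

/-- A lower bound `b` of `d` numbers is at most their geometric mean, which contributes the extra
exponent `1 / d`. -/
theorem mul_prod_le_prod_rpow {d : ℕ} (hd : 1 ≤ d) {a : Fin d → ℝ≥0∞} {b : ℝ≥0∞}
    (h : ∀ i, b ≤ a i) : (∏ i, a i) * b ≤ ∏ i, a i ^ (1 + 1 / (d : ℝ)) := by
  have hd' : (0 : ℝ) < d := by exact_mod_cast hd
  have h1 : b ≤ (∏ i, a i) ^ (1 / (d : ℝ)) := by
    have h2 : b ^ (d : ℝ) ≤ ∏ i, a i := by
      rw [ENNReal.rpow_natCast]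
      calc b ^ d = ∏ _i : Fin d, b := by simp
        _ ≤ _ := Finset.prod_le_prod' fun i _ => h i
    calc b = (b ^ (d : ℝ)) ^ (1 / (d : ℝ)) := by
          rw [← ENNReal.rpow_mul, mul_one_div_cancel hd'.ne', ENNReal.rpow_one]
      _ ≤ _ := ENNReal.rpow_le_rpow h2 (by positivity)
  calc (∏ i, a i) * b ≤ (∏ i, a i) * (∏ i, a i) ^ (1 / (d : ℝ)) := by gcongr
    _ = (∏ i, a i) ^ (1 + 1 / (d : ℝ)) := by
        rw [ENNReal.rpow_add_of_nonneg _ _ zero_le_one (by positivity), ENNReal.rpow_one]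
    _ = _ := (ENNReal.prod_rpow_of_nonneg (by positivity)).symm

/-- The product of the values of a function at `d + 1` points of zero sum is controlled by the
power `1 + 1 / d` of the function at `d` of them. -/
theorem prod_mul_le_sum_rpow {d : ℕ} (hd : 1 ≤ d) (f : UnitAddCircle → ℝ≥0∞)
    (t : Fin d → UnitAddCircle) : (∏ i, f (t i)) * f (-∑ i, t i) ≤
      (∏ i, f (t i) ^ (1 + 1 / (d : ℝ))) + ∑ j, ∏ i, f (swapSum j t i) ^ (1 + 1 / (d : ℝ)) := by
  by_cases h : ∀ i, f (-∑ i, t i) ≤ f (t i)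
  · exact le_add_right (mul_prod_le_prod_rpow hd h)
  -- Otherwise the smallest of the `d + 1` factors is some `f (t j)`. The map `swapSum j` exchanges
  -- `t j` with minus the sum, so that this smallest factor plays the role of `b`.
  · have : Nonempty (Fin d) := ⟨⟨0, hd⟩⟩
    obtain ⟨j, -, hj⟩ := Finset.exists_min_image Finset.univ (fun i => f (t i))
      Finset.univ_nonempty
    push Not at h
    obtain ⟨i0, hi0⟩ := h
    have hjb : f (t j) ≤ f (-∑ i, t i) := (hj i0 (Finset.mem_univ _)).trans hi0.le
    have hle : ∀ i, f (t j) ≤ f (swapSum j t i) := by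
      intro i
      rw [swapSum_apply]
      by_cases hij : i = j
      · subst hij; rwa [Function.update_self]
      · rw [Function.update_of_ne hij]; exact hj i (Finset.mem_univ _)
    have h1 := mul_prod_le_prod_rpow hd hle
    refine le_add_left (le_trans (le_of_eq ?_) (h1.trans (Finset.single_le_sum
      (f := fun j => ∏ i, f (swapSum j t i) ^ (1 + 1 / (d : ℝ))) (fun _ _ => zero_le)
      (Finset.mem_univ j))))
    rw [← Finset.mul_prod_erase _ _ (Finset.mem_univ j),
      ← Finset.mul_prod_erase _ (fun i => f (swapSum j t i)) (Finset.mem_univ j)]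
    have e : ∏ i ∈ Finset.univ.erase j, f (swapSum j t i) = ∏ i ∈ Finset.univ.erase j, f (t i) :=
      Finset.prod_congr rfl fun i hi => by
        rw [swapSum_apply, Function.update_of_ne (Finset.ne_of_mem_erase hi)]
    rw [e, swapSum_apply, Function.update_self]
    ring

/-- Each term of the bound `prod_mul_le_sum_rpow` integrates to a product of `d` one-variable
integrals, since `swapSum j` preserves the measure. -/
theorem lintegral_prod_mul_lt_top {d : ℕ} (hd : 1 ≤ d) {f : UnitAddCircle → ℝ≥0∞}
    (hf : Measurable f) (hfin : ∫⁻ t, f t ^ (1 + 1 / (d : ℝ)) < ∞) :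
    ∫⁻ t : Fin d → UnitAddCircle, (∏ i, f (t i)) * f (-∑ i, t i) < ∞ := by
  have hg : Measurable fun t => f t ^ (1 + 1 / (d : ℝ)) := hf.pow_const _
  have hgm : Measurable fun t : Fin d → UnitAddCircle => ∏ i, f (t i) ^ (1 + 1 / (d : ℝ)) :=
    Finset.measurable_prod _ fun i _ => hg.comp (measurable_pi_apply i)
  have hprod : ∫⁻ t : Fin d → UnitAddCircle, ∏ i, f (t i) ^ (1 + 1 / (d : ℝ)) < ∞ := by
    have hind : iIndepFun (fun i (t : Fin d → UnitAddCircle) => f (t i) ^ (1 + 1 / (d : ℝ)))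
        (Measure.pi fun _ : Fin d => (volume : Measure UnitAddCircle)) :=
      iIndepFun_pi (X := fun _ s => f s ^ (1 + 1 / (d : ℝ))) fun _ => hg.aemeasurable
    rw [volume_pi, lintegral_prod_eq_prod_lintegral_of_indepFun Finset.univ _ hind
      fun i => hg.comp (measurable_pi_apply i)]
    refine ENNReal.prod_lt_top fun i _ => ?_
    rwa [(measurePreserving_eval (fun _ : Fin d => (volume : Measure UnitAddCircle))
      i).lintegral_comp hg]
  refine (lintegral_mono (prod_mul_le_sum_rpow hd f)).trans_lt ?_
  have hjm : ∀ j : Fin d, Measurable fun t : Fin d → UnitAddCircle =>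
      ∏ i, f (swapSum j t i) ^ (1 + 1 / (d : ℝ)) :=
    fun j => hgm.comp (measurePreserving_swapSum j).measurable
  rw [lintegral_add_left hgm, lintegral_finsetSum _ fun j _ => hjm j]
  refine ENNReal.add_lt_top.2 ⟨hprod, ENNReal.sum_lt_top.2 fun j _ => ?_⟩
  rwa [(measurePreserving_swapSum j).lintegral_comp hgm]

theorem norm_coe_eq_min {s : ℝ} (h0 : 0 ≤ s) (h1 : s < 1) :
    ‖(s : UnitAddCircle)‖ = min s (1 - s) := by
  rw [norm_eq_min_rep, rep_coe h0 h1]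

theorem lintegral_norm_rpow_lt_top {b : ℝ} (hb : b < 1) :
    ∫⁻ t : UnitAddCircle, ENNReal.ofReal (‖t‖ ^ (-b)) < ∞ := by
  rw [← UnitAddCircle.lintegral_preimage 0, zero_add, ← setLIntegral_congr Ioo_ae_eq_Ioc]
  have h1 : IntervalIntegrable (fun s : ℝ => s ^ (-b)) volume 0 1 :=
    intervalIntegral.intervalIntegrable_rpow' (by linarith)
  have h2 : IntervalIntegrable (fun s : ℝ => (1 - s) ^ (-b)) volume 0 1 := by
    have := (h1.comp_sub_left 1).symm
    simpa using this
  have h3 := (h1.add h2).1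
  have h4 := h3.lintegral_lt_top
  refine lt_of_le_of_lt ?_ h4
  refine (setLIntegral_mono' measurableSet_Ioo fun s hs => ?_).trans
    (lintegral_mono_set Set.Ioo_subset_Ioc_self)
  refine ENNReal.ofReal_le_ofReal ?_
  rw [norm_coe_eq_min hs.1.le hs.2]
  have p1 : 0 ≤ s ^ (-b) := Real.rpow_nonneg hs.1.le _
  have p2 : 0 ≤ (1 - s) ^ (-b) := Real.rpow_nonneg (by linarith [hs.2]) _
  rcases min_choice s (1 - s) with h | h <;> rw [h] <;> linarith

theorem summable_max_div_sub {α r : ℝ} (hr : 0 < r) :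
    Summable fun k : ℕ => max 0 (α / ((k : ℝ) + 1) - r) := by
  have ht : Tendsto (fun k : ℕ => α / ((k : ℝ) + 1)) atTop (𝓝 0) := by
    simpa [div_eq_mul_inv] using tendsto_one_div_add_atTop_nhds_zero_nat.const_mul α
  obtain ⟨N, hN⟩ := eventually_atTop.1 (ht.eventually (gt_mem_nhds hr))
  refine summable_of_ne_finset_zero (s := Finset.range N) fun k hk => ?_
  rw [max_eq_left]
  linarith [hN k (by simpa using hk)]

theorem sum_div_le (α : ℝ) (hα : 0 ≤ α) (n : ℕ) :
    ∑ k ∈ Finset.range n, α / ((k : ℝ) + 1) ≤ α * (1 + Real.log n) := by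
  have h := harmonic_le_one_add_log n
  rw [harmonic] at h
  push_cast at h
  simp only [div_eq_mul_inv]
  rw [← Finset.mul_sum]
  exact mul_le_mul_of_nonneg_left h hα

/-- Only the indices `k < ⌊1 / r⌋₊` contribute, and their harmonic sum is at most `α (1 + log (1 /
r))`. -/
theorem radialK_div_le {α r : ℝ} (h0 : 0 < α) (h1 : α < 1) (hr : 0 < r) (hr1 : r ≤ 1) :
    radialK (fun n => α / ((n : ℝ) + 1)) r ≤ Real.exp α * r ^ (-α) := by
  have hge : ∀ k : ℕ, ⌊1 / r⌋₊ ≤ k → α / ((k : ℝ) + 1) ≤ r := by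
    intro k hk
    have h2 : 1 / r < (k : ℝ) + 1 := by
      have := Nat.lt_floor_add_one (1 / r)
      have hk' : ((⌊1 / r⌋₊ : ℕ) : ℝ) ≤ k := by exact_mod_cast hk
      linarith
    rw [div_lt_iff₀ hr] at h2
    rw [div_le_iff₀ (by positivity)]
    nlinarith
  have hn1 : 1 ≤ ⌊1 / r⌋₊ := Nat.one_le_floor_iff _ |>.2 (by rw [le_div_iff₀ hr]; linarith)
  have hn1' : (1 : ℝ) ≤ (⌊1 / r⌋₊ : ℕ) := by exact_mod_cast hn1
  rw [radialK_eq hge]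
  have h3 : ∑ k ∈ Finset.range ⌊1 / r⌋₊, max 0 (α / ((k : ℝ) + 1) - r) ≤ α * (1 - Real.log r) := by
    calc _ ≤ ∑ k ∈ Finset.range ⌊1 / r⌋₊, α / ((k : ℝ) + 1) :=
          Finset.sum_le_sum fun k _ => max_le (by positivity) (by linarith)
      _ ≤ α * (1 + Real.log (⌊1 / r⌋₊ : ℕ)) := sum_div_le α h0.le _
      _ ≤ α * (1 - Real.log r) := by
          have h4 : Real.log (⌊1 / r⌋₊ : ℕ) ≤ Real.log (1 / r) :=
            Real.log_le_log (by linarith) (Nat.floor_le (by positivity))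
          have h5 : Real.log (1 / r) = -Real.log r := by rw [one_div, Real.log_inv]
          exact mul_le_mul_of_nonneg_left (by linarith) h0.le
  calc _ ≤ Real.exp (α * (1 - Real.log r)) := Real.exp_le_exp.2 h3
    _ = _ := by
      rw [Real.rpow_def_of_pos hr, ← Real.exp_add]
      congr 1
      ring

theorem lintegral_kernelK_div_rpow_lt_top {α q : ℝ} (h0 : 0 < α) (h1 : α < 1) (hq : 0 < q)
    (hαq : α * q < 1) : ∫⁻ t, kernelK (fun n => α / ((n : ℝ) + 1)) t ^ q < ∞ := by
  have hne : ∀ᵐ t : UnitAddCircle, t ≠ 0 := by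
    rw [ae_iff]
    simp only [ne_eq, not_not, Set.ofPred_eq_eq_singleton]
    have h1 := volume_closedBall_le 0
    rw [Metric.closedBall_zero, mul_zero, ENNReal.ofReal_zero] at h1
    exact le_antisymm h1 zero_le
  have hle : ∀ᵐ t : UnitAddCircle, kernelK (fun n => α / ((n : ℝ) + 1)) t ^ q ≤
      ENNReal.ofReal (Real.exp α ^ q) * ENNReal.ofReal (‖t‖ ^ (-(α * q))) := by
    filter_upwards [hne] with t ht
    have hpos : 0 < ‖t‖ := norm_pos_iff.2 ht
    have hn1 : ‖t‖ ≤ 1 := by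
      have := norm_eq_min_rep t
      rw [this]
      exact (min_le_left _ _).trans (rep_lt_one t).le
    have h2 := (kernelK_le_radialK (summable_max_div_sub (α := α) hpos) le_rfl).trans
      (ENNReal.ofReal_le_ofReal (radialK_div_le h0 h1 hpos hn1))
    calc _ ≤ ENNReal.ofReal (Real.exp α * ‖t‖ ^ (-α)) ^ q := ENNReal.rpow_le_rpow h2 hq.le
      _ = ENNReal.ofReal ((Real.exp α * ‖t‖ ^ (-α)) ^ q) :=
          ENNReal.ofReal_rpow_of_pos (by positivity)
      _ = _ := by
          rw [Real.mul_rpow (Real.exp_pos _).le (by positivity), ← Real.rpow_mul hpos.le,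
            ENNReal.ofReal_mul (by positivity), neg_mul]
  refine (lintegral_mono_ae hle).trans_lt ?_
  rw [lintegral_const_mul' _ _ ENNReal.ofReal_ne_top]
  exact ENNReal.mul_lt_top ENNReal.ofReal_lt_top
    (lintegral_norm_rpow_lt_top hαq)

/-- The lengths `α / n` satisfy the hypotheses for some exponent. -/
theorem exists_admissible_div {α : ℝ} (h0 : 0 < α) (h1 : α < 1) :
    ∃ d : ℕ, Admissible (fun n => α / ((n : ℝ) + 1)) d := by
  -- The condition `d > α / (1 - α)` is equivalent to `α (1 + 1 / d) < 1`, the integrability of the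
  -- power `1 + 1 / d` of `‖t‖ ^ (-α)`.
  obtain ⟨d, hd⟩ := exists_nat_gt (α / (1 - α))
  have h1' : 0 < 1 - α := by linarith
  have hdpos : (0 : ℝ) < d := lt_trans (by positivity) hd
  have hd1 : 1 ≤ d := by exact_mod_cast hdpos
  have hαd : α * (1 + 1 / (d : ℝ)) < 1 := by
    rw [div_lt_iff₀ h1'] at hd
    have : α * (1 + 1 / (d : ℝ)) = α * (d + 1) / d := by field_simp
    rw [this, div_lt_one hdpos]
    linarith
  refine ⟨d, ?_⟩
  constructor
  · intro n; positivity
  · intro n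
    rw [div_lt_one (by positivity)]
    have : (0 : ℝ) ≤ n := n.cast_nonneg
    linarith
  · intro m n hmn
    have : (m : ℝ) ≤ n := by exact_mod_cast hmn
    exact div_le_div_of_nonneg_left h0.le (by positivity) (by linarith)
  · simpa [div_eq_mul_inv] using tendsto_one_div_add_atTop_nhds_zero_nat.const_mul α
  · intro hs
    have h2 := (hs.mul_left α⁻¹)
    have h3 : Summable fun n : ℕ => 1 / ((n : ℝ) + 1) := by
      refine h2.congr fun n => ?_
      field_simp
    have h4 : Summable fun n : ℕ => 1 / (n : ℝ) := by
      rw [← summable_nat_add_iff 1]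
      simpa using h3
    exact Real.not_summable_one_div_natCast h4
  -- The increments of the lengths are of order `n ^ (-2)` and the exponentials of order `n ^ α`,
  -- with `α - 2 < -1`.
  · have hs : Summable fun n : ℕ => α * Real.exp α * ((n + 1 : ℕ) : ℝ) ^ (α - 2) := by
      refine Summable.mul_left _ ?_
      exact (summable_nat_add_iff 1).2 (Real.summable_nat_rpow.2 (by linarith))
    refine Summable.of_nonneg_of_le (fun n => ?_) (fun n => ?_) hs
    · refine mul_nonneg (sub_nonneg.2 ?_) (Real.exp_pos _).le
      push_cast
      exact div_le_div_of_nonneg_left h0.le (by positivity) (by linarith)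
    · have hn : (0 : ℝ) < ((n + 1 : ℕ) : ℝ) := by positivity
      have e1 : α / ((n : ℝ) + 1) - α / (((n + 1 : ℕ) : ℝ) + 1) ≤
          α * ((n + 1 : ℕ) : ℝ) ^ (-2 : ℝ) := by
        rw [Real.rpow_neg hn.le, ← div_eq_mul_inv]
        have : ((n + 1 : ℕ) : ℝ) ^ (2 : ℝ) = ((n : ℝ) + 1) ^ 2 := by
          rw [← Nat.cast_two, Real.rpow_natCast]; push_cast; rfl
        rw [this]
        push_cast
        rw [div_sub_div _ _ (by positivity) (by positivity), div_le_div_iff₀ (by positivity)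
          (by positivity)]
        have hnn : (0 : ℝ) ≤ n := n.cast_nonneg
        have : α * (n + 1 + 1) - (n + 1) * α = α := by ring
        rw [this]
        nlinarith [mul_nonneg h0.le hnn, sq_nonneg (n : ℝ)]
      have e2 : Real.exp (∑ k ∈ Finset.range (n + 1), α / ((k : ℝ) + 1)) ≤
          Real.exp α * ((n + 1 : ℕ) : ℝ) ^ α := by
        rw [Real.rpow_def_of_pos hn, ← Real.exp_add]
        refine Real.exp_le_exp.2 ((sum_div_le α h0.le (n + 1)).trans_eq ?_)
        ring
      calc _ ≤ (α * ((n + 1 : ℕ) : ℝ) ^ (-2 : ℝ)) * (Real.exp α * ((n + 1 : ℕ) : ℝ) ^ α) :=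
            mul_le_mul e1 e2 (Real.exp_pos _).le (by positivity)
        _ = _ := by
            rw [sub_eq_add_neg, Real.rpow_add hn]
            ring
  · exact hd1
  · exact lintegral_prod_mul_lt_top hd1 (measurable_kernelK _)
      (lintegral_kernelK_div_rpow_lt_top h0 h1 (by positivity) hαd)

end

/-! ### Transfer to an arbitrary sequence of independent uniform variables. -/

section

variable {ℓ : ℕ → ℝ} {d : ℕ}

/-- Independent uniform variables on the circle have the product law. -/
theorem map_eq_unifSeq {Ω : Type*} [MeasurableSpace Ω] {P : Measure Ω} [IsProbabilityMeasure P]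
    {ω : ℕ → Ω → UnitAddCircle} (hm : ∀ n, Measurable (ω n)) (hi : iIndepFun ω P)
    (hu : ∀ n, P.map (ω n) = volume) :
    MeasurePreserving (fun a n => ω n a) P unifSeq := by
  refine ⟨measurable_pi_iff.2 hm, ?_⟩
  rw [hi.map_fun_eq_infinitePi_map hm, unifSeq]
  simp only [hu]

theorem Admissible.ae_unifSeq (hadm : Admissible ℓ d) : ∀ᵐ x ∂unifSeq,
    Tendsto (approxMeasure ℓ x) atTop (𝓝 (dvoretzkyMeasure ℓ x)) ∧
    IsRajchman (dvoretzkyMeasure ℓ x : Measure UnitAddCircle) ∧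
    (dvoretzkyMeasure ℓ x : Measure UnitAddCircle) (uncovered ℓ x)ᶜ = 0 ∧
    ((uncovered ℓ x).Nonempty → dvoretzkyMeasure ℓ x ≠ 0 ∧ IsM0Set (uncovered ℓ x) ∧
      IsSetOfMultiplicity (uncovered ℓ x)) := by
  filter_upwards [ae_exists_tendsto_approxMeasure (fun n => (hadm.pos n).le) hadm.lt_one,
    hadm.ae_isRajchman, hadm.ae_mem_survives] with x hx hR hS
  have ht : Tendsto (approxMeasure ℓ x) atTop (𝓝 (dvoretzkyMeasure ℓ x)) := tendsto_nhds_limUnder hx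
  have h0 := measure_compl_uncovered_eq_zero hadm.lt_one ht
  refine ⟨ht, hR _ ht, h0, fun hne => ?_⟩
  have hν := ne_zero_of_mem_survives hadm.lt_one ht (hS hne)
  exact ⟨hν, ⟨_, hν, h0, hR _ ht⟩,
    isSetOfMultiplicity_of_isRajchman (isClosed_uncovered ℓ x) _ hν h0 (hR _ ht)⟩

theorem Admissible.ae_nonempty_of_mem_survives (hadm : Admissible ℓ d) :
    ∀ᵐ x ∂unifSeq, x ∈ survives ℓ → (uncovered ℓ x).Nonempty := by
  filter_upwards [hadm.ae_unifSeq] with x hx hs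
  exact nonempty_uncovered_of_ne_zero (ne_zero_of_mem_survives hadm.lt_one hx.1 hs) hx.2.2.1

end

end

end Dvoretzky

theorem corollary1 {Ω : Type*} [MeasurableSpace Ω] (P : Measure Ω) [IsProbabilityMeasure P]
    (ω : ℕ → Ω → UnitAddCircle) (hω_meas : ∀ n, Measurable (ω n))
    (hω_indep : iIndepFun ω P) (hω_unif : ∀ n, P.map (ω n) = volume) :
    (∀ (ℓ : ℕ → ℝ) (d : ℕ), Dvoretzky.Admissible ℓ d →
      (∀ᵐ a ∂P,
        Tendsto (Dvoretzky.approxMeasure ℓ fun n => ω n a) atTop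
          (𝓝 (Dvoretzky.dvoretzkyMeasure ℓ fun n => ω n a)) ∧
        Dvoretzky.IsRajchman
          (Dvoretzky.dvoretzkyMeasure ℓ fun n => ω n a : Measure UnitAddCircle) ∧
        (Dvoretzky.dvoretzkyMeasure ℓ fun n => ω n a : Measure UnitAddCircle)
          (Dvoretzky.uncovered ℓ fun n => ω n a)ᶜ = 0 ∧
        ((Dvoretzky.uncovered ℓ fun n => ω n a).Nonempty →
          Dvoretzky.dvoretzkyMeasure ℓ (fun n => ω n a) ≠ 0 ∧
          Dvoretzky.IsM0Set (Dvoretzky.uncovered ℓ fun n => ω n a) ∧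
          Dvoretzky.IsSetOfMultiplicity (Dvoretzky.uncovered ℓ fun n => ω n a))) ∧
      0 < P {a | (Dvoretzky.uncovered ℓ fun n => ω n a).Nonempty}) ∧
    ∀ α : ℝ, 0 < α → α < 1 →
      ∃ d : ℕ, Dvoretzky.Admissible (fun n => α / ((n : ℝ) + 1)) d := by
  have hmp := Dvoretzky.map_eq_unifSeq hω_meas hω_indep hω_unif
  refine ⟨fun ℓ d hadm => ⟨hmp.quasiMeasurePreserving.ae hadm.ae_unifSeq, ?_⟩,
    fun α h0 h1 => Dvoretzky.exists_admissible_div h0 h1⟩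
  calc 0 < Dvoretzky.unifSeq (Dvoretzky.survives ℓ) := hadm.measure_survives_pos
    _ = P ((fun a n => ω n a) ⁻¹' Dvoretzky.survives ℓ) :=
        (hmp.measure_preimage (Dvoretzky.measurableSet_survives ℓ).nullMeasurableSet).symm
    -- The inclusion holds only almost surely: where the mass survives, the limit measure is nonzero
    -- and carried by the uncovered set.
    _ ≤ _ := measure_mono_ae
        (hmp.quasiMeasurePreserving.ae hadm.ae_nonempty_of_mem_survives)
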